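/- **Setting.** Consider $\min_{x\in\mathcal X}F(x)$, $F(x)=\frac1n\sum_{i=1}^n f_i(g_i(x))+r(x)$, with $g_i(x)=\mathbb E_{\zeta\sim\mathbb P_i}[g_i(x;\zeta)]\in\mathbb R^m$, where $\mathcal X\subseteq\mathbb R^d$ is closed and convex and $r:\mathcal X\to(-\infty,\infty]$ is proper, lower semicontinuous and convex. For each $i$ let $\|\cdot\|$ be a norm on $\mathbb R^m$ (it may depend on $i$) with dual norm $\|\cdot\|_*$, and let $\mu_\psi,L_\psi>0$ satisfy $\mu_\psi\|v\|^2\le\|v\|_2^2\le L_\psi\|v\|^2$. Let $f_i^*$ be the convex conjugate of $f_i$, $\mathcal Y_i$ the closure of its effective domain, and $\mathcal Y=\mathcal Y_1\times\dots\times\mathcal Y_n$. A stochastic first-order oracle returns, for $x\in\mathcal X$, an integrable Jacobian $g_i'(x;\zeta)\in\partial g_i(x;\zeta)$ (rows are subgradients on $\mathcal X$ of the components of $g_i(\cdot;\zeta)$); write $g_i'(x)=\mathbb E_{\zeta\sim\mathbb P_i}[g_i'(x;\zeta)]$. Assume, with constants $C_f,C_g>0$, $\sigma_0,\sigma_1,\delta$: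 - each $g_i$ is convex in every component, $\|g_i(x)-g_i(x')\|_*\le C_g\|x-x'\|_2$ and $\|[g_i'(x)]^\top\|_{\rm op}\le C_g$ on $\mathcal X$ (where $\|A^\top\|_{\rm op}=\sup_{\|v\|\le1}\|A^\top v\|_2$); no smoothness of $g_i$ is assumed; - each $f_i:\mathbb R^m\to\mathbb R$ is convex with $|f_i(u)-f_i(u')|\le C_f\|u-u'\|_*$ (possibly non-smooth), and is non-decreasing in each coordinate unless $g_i$ is affine on $\mathcal X$ with $g_i(z)=g_i(x)+g_i'(x)(z-x)$ for all $x,z\in\mathcal X$; - for all $x\in\mathcal X$, $y\in\mathcal Y$ and all $i$: $\mathbb E_{\zeta\sim\mathbb P_i}\|g_i(x)-g_i(x;\zeta)\|_*^2\le\sigma_0^2$, $\mathbb E_{\zeta\sim\mathbb P_i}\|[g_i'(x)]^\top-[g_i'(x;\zeta)]^\top\|_{\rm op}^2\le\sigma_1^2$, and $\frac1n\sum_{j}\|[g_j'(x)]^\top y^{(j)}-\frac1n\sum_i[g_i'(x)]^\top y^{(i)}\|_2^2\le\delta^2$. **Algorithm (ALEXR with $\psi_i=\frac12\|\cdot\|_2^2$,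 $\theta=0$).** Let $1\le S\le n$, $B\ge1$, $\eta,\tau>0$. Start from deterministic $x_0\in\mathcal X$, $y_0\in\mathcal Y$. In iteration $t=0,1,\dots$ draw independently of the past a uniformly random $\mathcal S_t\subset\{1,\dots,n\}$ with $|\mathcal S_t|=S$ and independent i.i.d. batches $\mathcal B_t^{(i)},\tilde{\mathcal B}_t^{(i)}$ of size $B$ from $\mathbb P_i$; set $y_{t+1}^{(i)}=\arg\max_{v\in\mathcal Y_i}\{\langle v,g_i(x_t;\mathcal B_t^{(i)})\rangle-f_i^*(v)-\frac\tau2\|v-y_t^{(i)}\|_2^2\}$ for $i\in\mathcal S_t$, $y_{t+1}^{(i)}=y_t^{(i)}$ for $i\notin\mathcal S_t$, $G_t=\frac1S\sum_{i\in\mathcal S_t}[g_i'(x_t;\tilde{\mathcal B}_t^{(i)})]^\top y_{t+1}^{(i)}$ and $x_{t+1}=\arg\min_{x\in\mathcal X}\{\langle G_t,x\rangle+r(x)+\frac\eta2\|x-x_t\|_2^2\}$, where $g_i(x;\mathcal B)$, $g_i'(x;\mathcal B)$ are averages over the batch. **Theorem.** Let $D\ge0$. There are constants $c_\eta,c_\tau,K>0$,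 depending only on $C_f,C_g,\sigma_0,\sigma_1,\delta,\mu_\psi,L_\psi,D$, such that for every problem as above (all $d,m,n$), all $S,B$, every minimizer $x_*$ of $F$ over $\mathcal X$ with $\|x_0-x_*\|_2\le D$ and every $\epsilon>0$, ALEXR run with $\theta=0$, $\eta=c_\eta/\epsilon$ and $\tau=c_\tau/(B\epsilon)$ has the following property. For $T\ge1$ let $\bar x_T=\frac1T\sum_{t=0}^{T-1}x_{t+1}$, let $\tilde y_T$ be any random vector with $\tilde y_T^{(i)}\in\arg\max_{v\in\mathcal Y_i}\{\langle v,g_i(\bar x_T)\rangle-f_i^*(v)\}$ for all $i$, and let $\Omega_{\mathcal Y}^0=\mathbb E[U_\psi(\tilde y_T,y_0)]=\frac12\sum_{i=1}^n\mathbb E\|\tilde y_T^{(i)}-y_0^{(i)}\|_2^2$. Then $\Omega_{\mathcal Y}^0$ is finite, $\Omega_{\mathcal Y}^0\le Kn$, and $$T\ \ge\ K\max\Big\{1,\frac{\Omega_{\mathcal Y}^0}{BS}\Big\}\epsilon^{-2}\quad\Longrightarrow\quad \mathbb E[F(\bar x_T)-F(x_*)]\le\epsilon .$$ -/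

import Mathlib

open MeasureTheory ProbabilityTheory

namespace FCCO

noncomputable section

/-- `ℝᵏ` with the Euclidean norm. -/
abbrev Vec (k : ℕ) : Type := EuclideanSpace ℝ (Fin k)

/-- `a` is a maximizer of `h` over `s`. -/
def IsArgmax {E : Type*} (h : E → EReal) (s : Set E) (a : E) : Prop :=
  a ∈ s ∧ IsMaxOn h s a

/-- `a` is a minimizer of `h` over `s`. -/
def IsArgmin {E : Type*} (h : E → EReal) (s : Set E) (a : E) : Prop :=
  a ∈ s ∧ IsMinOn h s a

/-- The norm dual to `N`: `‖u‖_* = sup {⟨v, u⟩ : N v ≤ 1}`. -/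
def dualNorm {m : ℕ} (N : Seminorm ℝ (Vec m)) (u : Vec m) : ℝ :=
  sSup ((fun v => inner ℝ v u) '' {v | N v ≤ 1})

/-- The operator norm of the adjoint `Aᵀ : (ℝᵐ, N) → (ℝᵈ, ‖·‖₂)`. -/
def adjointOpNorm {d m : ℕ} (N : Seminorm ℝ (Vec m)) (A : Vec d →L[ℝ] Vec m) : ℝ :=
  sSup ((fun v => ‖ContinuousLinearMap.adjoint A v‖) '' {v | N v ≤ 1})

/-- The convex conjugate `f^*(v) = sup_u {⟨v, u⟩ - f(u)}`, with values in `(-∞, ∞]`. -/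
def conj {m : ℕ} (f : Vec m → ℝ) (v : Vec m) : EReal :=
  ⨆ u : Vec m, ((inner ℝ v u - f u : ℝ) : EReal)

/-- The dual domain of `f`: the closure of the effective domain of `f^*`. -/
def dualDomain {m : ℕ} (f : Vec m → ℝ) : Set (Vec m) :=
  closure {v | conj f v ≠ ⊤}

/-- The Bregman divergence `U_ψ(u, v)`. -/
def bregman {m : ℕ} (ψ : Vec m → ℝ) (u v : Vec m) : ℝ :=
  ψ u - ψ v - inner ℝ (gradient ψ v) (u - v)

/-- The quadratic distance-generating function `½‖·‖₂²`. -/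
def quad {m : ℕ} (u : Vec m) : ℝ := (1 / 2) * ‖u‖ ^ 2

/-- The block-separable divergence `U_ψ(u, v) = ∑ᵢ U_{ψᵢ}(u⁽ⁱ⁾, v⁽ⁱ⁾)`. -/
def bregmanSum {m n : ℕ} (ψ : Fin n → Vec m → ℝ) (u v : Fin n → Vec m) : ℝ :=
  ∑ i, bregman (ψ i) (u i) (v i)

/-- The data of a problem `min_{x ∈ X} (1/n) ∑ᵢ fᵢ(gᵢ(x)) + r(x)`, where `gᵢ(x)` is the
expectation of `gs i x ζ` over `ζ ∼ P i`, and `J i x ζ` is the first-order oracle: a Jacobian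
whose rows are subgradients of the components of `gs i · ζ` at `x`. `N i` is the norm of the
`i`-th dual block. -/
structure Problem (d m n : ℕ) (Z : Type*) [MeasurableSpace Z] where
  X : Set (Vec d)
  r : Vec d → EReal
  f : Fin n → Vec m → ℝ
  P : Fin n → Measure Z
  gs : Fin n → Vec d → Z → Vec m
  J : Fin n → Vec d → Z → (Vec d →L[ℝ] Vec m)
  N : Fin n → Seminorm ℝ (Vec m)

namespace Problem

variable {d m n : ℕ} {Z : Type*} [MeasurableSpace Z]

/-- The inner function `gᵢ(x) = 𝔼 gᵢ(x; ζ)`. -/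
def g (p : Problem d m n Z) (i : Fin n) (x : Vec d) : Vec m :=
  ∫ ζ, p.gs i x ζ ∂(p.P i)

/-- The expected oracle Jacobian `gᵢ'(x) = 𝔼 gᵢ'(x; ζ)`. -/
def meanJ (p : Problem d m n Z) (i : Fin n) (x : Vec d) : Vec d →L[ℝ] Vec m :=
  ∫ ζ, p.J i x ζ ∂(p.P i)

/-- The objective `F`. -/
def F (p : Problem d m n Z) (x : Vec d) : EReal :=
  (((1 / (n : ℝ)) * ∑ i, p.f i (p.g i x) : ℝ) : EReal) + p.r x

/-- The dual domain `𝒴ᵢ` of the `i`-th block. -/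
def Y (p : Problem d m n Z) (i : Fin n) : Set (Vec m) := dualDomain (p.f i)

/-- The standing assumptions, with their constants. -/
structure Assumptions (p : Problem d m n Z) (Cf Cg σ₀ σ₁ δ μψ Lψ : ℝ) : Prop where
  prob : ∀ i, IsProbabilityMeasure (p.P i)
  /-- comparison of the block norms with the Euclidean norm, that is, `½‖·‖₂²` is
  `μψ`-strongly convex and `Lψ`-smooth with respect to `N i` -/
  norm_lower : ∀ i v, μψ * p.N i v ^ 2 ≤ ‖v‖ ^ 2
  norm_upper : ∀ i v, ‖v‖ ^ 2 ≤ Lψ * p.N i v ^ 2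
  /-- the domain -/
  X_closed : IsClosed p.X
  X_convex : Convex ℝ p.X
  /-- the regularizer is proper, lower semicontinuous and convex (epigraph) on `X` -/
  r_ne_bot : ∀ x ∈ p.X, p.r x ≠ ⊥
  r_proper : ∃ x ∈ p.X, p.r x ≠ ⊤
  r_lsc : LowerSemicontinuousOn p.r p.X
  r_convex : Convex ℝ {q : Vec d × ℝ | q.1 ∈ p.X ∧ p.r q.1 ≤ (q.2 : EReal)}
  /-- the stochastic oracles -/
  gs_meas : ∀ i, StronglyMeasurable (Function.uncurry (p.gs i))
  J_meas : ∀ i, StronglyMeasurable (Function.uncurry (p.J i))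
  gs_int : ∀ i, ∀ x ∈ p.X, Integrable (p.gs i x) (p.P i)
  J_int : ∀ i, ∀ x ∈ p.X, Integrable (p.J i x) (p.P i)
  J_subgradient : ∀ i ζ, ∀ x ∈ p.X, ∀ z ∈ p.X, ∀ j,
    p.gs i x ζ j + p.J i x ζ (z - x) j ≤ p.gs i z ζ j
  /-- the inner functions are convex and Lipschitz, and so bounded are their subgradients -/
  g_convex : ∀ i j, ConvexOn ℝ p.X (fun x => p.g i x j)
  g_lip : ∀ i, ∀ x ∈ p.X, ∀ z ∈ p.X, dualNorm (p.N i) (p.g i x - p.g i z) ≤ Cg * ‖x - z‖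
  meanJ_bound : ∀ i, ∀ x ∈ p.X, adjointOpNorm (p.N i) (p.meanJ i x) ≤ Cg
  /-- the outer functions are convex and Lipschitz, and coordinatewise non-decreasing unless
  the inner function is affine on `X` with derivative given by `meanJ` -/
  f_convex : ∀ i, ConvexOn ℝ Set.univ (p.f i)
  f_lip : ∀ i u w, |p.f i u - p.f i w| ≤ Cf * dualNorm (p.N i) (u - w)
  f_mono : ∀ i,
    (∀ u w : Vec m, (∀ j, u j ≤ w j) → p.f i u ≤ p.f i w) ∨
    (∀ x ∈ p.X, ∀ z ∈ p.X, p.g i z = p.g i x + p.meanJ i x (z - x))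
  /-- bounded variances -/
  var₀_int : ∀ i, ∀ x ∈ p.X,
    Integrable (fun ζ => dualNorm (p.N i) (p.g i x - p.gs i x ζ) ^ 2) (p.P i)
  var₀ : ∀ i, ∀ x ∈ p.X, ∫ ζ, dualNorm (p.N i) (p.g i x - p.gs i x ζ) ^ 2 ∂(p.P i) ≤ σ₀ ^ 2
  var₁_int : ∀ i, ∀ x ∈ p.X,
    Integrable (fun ζ => adjointOpNorm (p.N i) (p.meanJ i x - p.J i x ζ) ^ 2) (p.P i)
  var₁ : ∀ i, ∀ x ∈ p.X,
    ∫ ζ, adjointOpNorm (p.N i) (p.meanJ i x - p.J i x ζ) ^ 2 ∂(p.P i) ≤ σ₁ ^ 2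
  var_blocks : ∀ x ∈ p.X, ∀ y : Fin n → Vec m, (∀ i, y i ∈ p.Y i) →
    (1 / (n : ℝ)) * ∑ j, ‖ContinuousLinearMap.adjoint (p.meanJ j x) (y j) -
      (1 / (n : ℝ)) • ∑ i, ContinuousLinearMap.adjoint (p.meanJ i x) (y i)‖ ^ 2 ≤ δ ^ 2

/-- The randomness of one iteration: the block batch `𝒮ₜ` and, for every block, two batches
of `B` samples (those of the blocks outside `𝒮ₜ` are never used by the algorithm). -/
abbrev Draw (n B : ℕ) (Z : Type*) : Type _ :=
  Finset (Fin n) × (Fin n → Fin B → Z) × (Fin n → Fin B → Z)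

/-- The law of one draw: `𝒮ₜ` is uniform among the subsets of size `S`, all samples of block
`i` have law `P i`, and everything is independent. -/
def drawLaw (p : Problem d m n Z) (S B : ℕ) : Measure (Draw n B Z) :=
  (uniformOn {A : Finset (Fin n) | A.card = S}).prod
    ((Measure.pi fun i => Measure.pi fun _ : Fin B => p.P i).prod
      (Measure.pi fun i => Measure.pi fun _ : Fin B => p.P i))

/-- `ξ` is an i.i.d. sequence of draws. -/
structure IsSampling (p : Problem d m n Z) (S B : ℕ) {Ω : Type*} [MeasurableSpace Ω]
    (Pr : Measure Ω) (ξ : ℕ → Ω → Draw n B Z) : Prop where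
  meas : ∀ t, Measurable (ξ t)
  law : ∀ t, Pr.map (ξ t) = p.drawLaw S B
  indep : iIndepFun ξ Pr

/-- The mini-batch estimator `gᵢ(x; ℬ)`. -/
def gBatch (p : Problem d m n Z) {B : ℕ} (i : Fin n) (x : Vec d) (b : Fin B → Z) : Vec m :=
  (1 / (B : ℝ)) • ∑ k, p.gs i x (b k)

/-- The mini-batch Jacobian `gᵢ'(x; ℬ)`. -/
def JBatch (p : Problem d m n Z) {B : ℕ} (i : Fin n) (x : Vec d) (b : Fin B → Z) :
    Vec d →L[ℝ] Vec m :=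
  (1 / (B : ℝ)) • ∑ k, p.J i x (b k)

/-- The extrapolated estimator
`g̃ = gᵢ(x; ℬ) + θ (gᵢ(x; ℬ) - gᵢ(x₋; ℬ))`, where `x₋` is the previous iterate. -/
def extrap (p : Problem d m n Z) {B : ℕ} (θ : ℝ) (i : Fin n) (x xprev : Vec d)
    (b : Fin B → Z) : Vec m :=
  p.gBatch i x b + θ • (p.gBatch i x b - p.gBatch i xprev b)

/-- The gradient estimator `(1/S) ∑_{i ∈ 𝒮} [gᵢ'(x; ℬ̃⁽ⁱ⁾)]ᵀ y⁽ⁱ⁾`. -/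
def gradEst (p : Problem d m n Z) {B : ℕ} (S : ℕ) (A : Finset (Fin n)) (x : Vec d)
    (b : Fin n → Fin B → Z) (y : Fin n → Vec m) : Vec d :=
  (1 / (S : ℝ)) • ∑ i ∈ A, ContinuousLinearMap.adjoint (p.JBatch i x (b i)) (y i)

/-- `(x, y)` is the sequence of iterates of ALEXR driven by the draws `ξ`. The iterate before
`x 0` is `x 0` (here through `0 - 1 = 0`). -/
structure IsALEXR (p : Problem d m n Z) (S B : ℕ) (ψ : Fin n → Vec m → ℝ) (θ η τ : ℝ)
    (x₀ : Vec d) (y₀ : Fin n → Vec m) {Ω : Type*} (ξ : ℕ → Ω → Draw n B Z)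
    (x : ℕ → Ω → Vec d) (y : ℕ → Ω → Fin n → Vec m) : Prop where
  x_zero : ∀ ω, x 0 ω = x₀
  y_zero : ∀ ω, y 0 ω = y₀
  dual_step : ∀ t ω, ∀ i ∈ (ξ t ω).1,
    IsArgmax (fun v => ((inner ℝ v (p.extrap θ i (x t ω) (x (t - 1) ω) ((ξ t ω).2.1 i))
        - τ * bregman (ψ i) v (y t ω i) : ℝ) : EReal) - conj (p.f i) v)
      (p.Y i) (y (t + 1) ω i)
  dual_stay : ∀ t ω, ∀ i ∉ (ξ t ω).1, y (t + 1) ω i = y t ω i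
  primal_step : ∀ t ω,
    IsArgmin (fun z =>
        ((inner ℝ (p.gradEst S (ξ t ω).1 (x t ω) (ξ t ω).2.2 (y (t + 1) ω)) z
          + η / 2 * ‖z - x t ω‖ ^ 2 : ℝ) : EReal) + p.r z)
      p.X (x (t + 1) ω)

/-- `yt` lists, for every block, a maximizer of `⟨v, gᵢ(x)⟩ - fᵢ^*(v)` over `𝒴ᵢ`. -/
def IsDualBest (p : Problem d m n Z) (x : Vec d) (yt : Fin n → Vec m) : Prop :=
  ∀ i, IsArgmax (fun v => ((inner ℝ v (p.g i x) : ℝ) : EReal) - conj (p.f i) v)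
    (p.Y i) (yt i)

end Problem

/-- The average `(1/T) ∑_{t < T} x_{t+1}` of the first `T` updates. -/
def avgIterate {d : ℕ} {Ω : Type*} (x : ℕ → Ω → Vec d) (T : ℕ) (ω : Ω) : Vec d :=
  (1 / (T : ℝ)) • ∑ t ∈ Finset.range T, x (t + 1) ω

end

end FCCO

open FCCO

/-! Conjugacy turns `F` into a saddle function: `F(x)` is the maximum over dual points `y` of `(1/n)
∑ᵢ (⟨yᵢ, gᵢ(x)⟩ - fᵢ*(yᵢ)) + r(x)`. A dual feasible `yᵢ` is coordinatewise non-negative when `fᵢ` is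
monotone, so `⟨yᵢ, gᵢ(·)⟩` lies above its linearizations (`inner_g_subgradient`); in the other case
`gᵢ` is affine. Hence `F(x̄) - F(x_*)` is at most the average over `t` of the saddle function at
`(x_{t+1}, ỹ)` minus its value at `x_*` and any dual feasible point. That point is taken to be the
full dual update `ȳ_t`, the one every block would make if it were drawn. The three-point inequality
of the proximal steps bounds each difference (`step_le`).

Two obstacles remain. First, `g` is not smooth. Replacing `g(x_t)` by `g(x_{t+1})` costs a constant
times `‖x_{t+1} - x_t‖`, and replacing `x_t` by `x_{t+1}` against the stochastic gradient `G` costs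
`‖G‖ ‖x_{t+1} - x_t‖`. Young's inequality absorbs both into the proximal term `η/2 ‖x_{t+1} - x_t‖²`
at price `O(1/η)`, as dual points are bounded and `G` has bounded second moment.

Second, `ỹ` depends on all the draws, so its product with the dual noise `W_t` is not centred. Here
`W_t` is the oracle error plus `τ` times the centred block weight times `ȳ_t - y_t`; the latter is
what comparing `ȳ_t` with the update actually made leaves behind (`dual_block_inequality`). Write `ỹ
- y_t = (ỹ - y_0) + (y_0 - y_t)`. The second part is determined by the past, so it contributes mean
zero. The first does not vary with `t`: Young gives a multiple of `‖ỹ - y_0‖²` plus a multiple of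
`‖∑_t W_t‖²`, whose mean is `∑_t E‖W_t‖²` because the noises are orthogonal
(`integral_norm_sum_noise_sq`). That variance contains `E‖ȳ_t - y_t‖²`; the Young parameter is tuned
so that the `-τ/4 ‖ȳ_t - y_t‖²` kept from the dual proximal step pays for it (`noise_budget`).

The outcome (`expected_gap_le`) is `T·E[gap] ≤ ηD²/2 + (5τ/S)Ω + T(5σ₀²/(4μBτ) + Q/η)`. With `η ∼
1/ε` and `τ ∼ 1/(Bε)` each of the four terms is at most `Tε/4`. -/

namespace FCCO

/-! ### Comparison of the dual and operator norms with the Euclidean ones -/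

section Norms

variable {d m : ℕ} {N : Seminorm ℝ (Vec m)} {μ L : ℝ}

theorem norm_le_sqrt_of_seminorm_le_one (hN : ∀ v, ‖v‖ ^ 2 ≤ L * N v ^ 2) (hL : 0 < L) {v : Vec m}
    (hv : N v ≤ 1) : ‖v‖ ≤ √L := by
  apply Real.le_sqrt_of_sq_le
  have h0 : 0 ≤ N v := apply_nonneg N v
  calc ‖v‖ ^ 2 ≤ L * N v ^ 2 := hN v
    _ ≤ L * 1 := by gcongr; exact pow_le_one₀ h0 hv
    _ = L := mul_one L

theorem inner_le_of_seminorm_le_one (hN : ∀ v, ‖v‖ ^ 2 ≤ L * N v ^ 2) (hL : 0 < L) {v : Vec m}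
    (hv : N v ≤ 1) (u : Vec m) : inner ℝ v u ≤ √L * ‖u‖ :=
  (real_inner_le_norm v u).trans (by gcongr; exact norm_le_sqrt_of_seminorm_le_one hN hL hv)

theorem dualNorm_le (hN : ∀ v, ‖v‖ ^ 2 ≤ L * N v ^ 2) (hL : 0 < L) (u : Vec m) :
    dualNorm N u ≤ √L * ‖u‖ := by
  apply csSup_le
  · exact ⟨_, 0, by simp, rfl⟩
  · rintro _ ⟨v, hv, rfl⟩
    exact inner_le_of_seminorm_le_one hN hL hv u

/-- The Euclidean ball of radius `√μ` lies in the unit ball of `N`, so rescaling `v` to length `√μ`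
gives an admissible test vector for both suprema below. -/
theorem seminorm_smul_le_one (hN : ∀ v, μ * N v ^ 2 ≤ ‖v‖ ^ 2) (hμ : 0 < μ) {v : Vec m}
    (hv : v ≠ 0) : N ((√μ / ‖v‖) • v) ≤ 1 := by
  have h := hN ((√μ / ‖v‖) • v)
  have hv' : 0 < ‖v‖ := norm_pos_iff.2 hv
  have e : ‖(√μ / ‖v‖) • v‖ = √μ := by
    rw [norm_smul, Real.norm_of_nonneg (by positivity)]
    field_simp
  rw [e, Real.sq_sqrt hμ.le] at h
  have h1 : N ((√μ / ‖v‖) • v) ^ 2 ≤ 1 := by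
    by_contra hc
    push Not at hc
    nlinarith
  exact (sq_le_one_iff₀ (apply_nonneg N _)).1 h1

theorem le_dualNorm (hN : ∀ v, μ * N v ^ 2 ≤ ‖v‖ ^ 2) (hμ : 0 < μ)
    (hN' : ∀ v, ‖v‖ ^ 2 ≤ L * N v ^ 2) (hL : 0 < L) (u : Vec m) :
    √μ * ‖u‖ ≤ dualNorm N u := by
  -- A real `sSup` of an unbounded set is `0`, so a lower bound on the dual norm needs boundedness;
  -- this is where the upper comparison `hN'` enters.
  have hb : BddAbove ((fun v => inner ℝ v u) '' {v | N v ≤ 1}) := by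
    refine ⟨√L * ‖u‖, ?_⟩
    rintro _ ⟨v, hv, rfl⟩
    exact inner_le_of_seminorm_le_one hN' hL hv u
  rcases eq_or_ne u 0 with rfl | hu
  · exact le_csSup hb ⟨0, by simp, by simp⟩
  · refine le_csSup hb ⟨(√μ / ‖u‖) • u, seminorm_smul_le_one hN hμ hu, ?_⟩
    have : ‖u‖ ≠ 0 := norm_ne_zero_iff.2 hu
    simp only [inner_smul_left, real_inner_self_eq_norm_sq, conj_trivial]
    field_simp

theorem le_adjointOpNorm (hN : ∀ v, μ * N v ^ 2 ≤ ‖v‖ ^ 2) (hμ : 0 < μ)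
    (hN' : ∀ v, ‖v‖ ^ 2 ≤ L * N v ^ 2) (hL : 0 < L) (A : Vec d →L[ℝ] Vec m) :
    √μ * ‖A‖ ≤ adjointOpNorm N A := by
  have hb : BddAbove ((fun v => ‖ContinuousLinearMap.adjoint A v‖) '' {v | N v ≤ 1}) := by
    refine ⟨‖ContinuousLinearMap.adjoint A‖ * √L, ?_⟩
    rintro _ ⟨v, hv, rfl⟩
    refine (ContinuousLinearMap.le_opNorm _ v).trans ?_
    gcongr
    exact norm_le_sqrt_of_seminorm_le_one hN' hL hv
  have h0 : 0 ≤ adjointOpNorm N A := le_csSup hb ⟨0, by simp, by simp⟩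
  have hs : 0 < √μ := Real.sqrt_pos.2 hμ
  have key : ‖ContinuousLinearMap.adjoint A‖ ≤ adjointOpNorm N A / √μ := by
    refine ContinuousLinearMap.opNorm_le_bound _ (by positivity) fun v => ?_
    rcases eq_or_ne v 0 with rfl | hv
    · simp
    · have h := le_csSup hb ⟨(√μ / ‖v‖) • v, seminorm_smul_le_one hN hμ hv, rfl⟩
      have hv' : 0 < ‖v‖ := norm_pos_iff.2 hv
      simp only [map_smul, norm_smul, norm_div, norm_norm, Real.norm_of_nonneg hs.le] at h
      change _ ≤ adjointOpNorm N A at h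
      rw [div_mul_eq_mul_div, le_div_iff₀ hs]
      rw [div_mul_eq_mul_div, div_le_iff₀ hv'] at h
      linarith
  rw [LinearIsometryEquiv.norm_map, le_div_iff₀ hs] at key
  linarith

end Norms

/-! ### Convex conjugate: bounded domain, sign, Fenchel–Young equality, attainment -/

section Conj

variable {m : ℕ} {f : Vec m → ℝ}

/-- The effective domain of the convex conjugate. -/
def conjDom (f : Vec m → ℝ) : Set (Vec m) := {v | conj f v ≠ ⊤}

/-- The convex conjugate as a real function on its effective domain. -/
noncomputable def conjReal (f : Vec m → ℝ) (v : Vec m) : ℝ := (conj f v).toReal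

theorem le_conj (f : Vec m → ℝ) (v u : Vec m) : ((inner ℝ v u - f u : ℝ) : EReal) ≤ conj f v :=
  le_iSup (fun u : Vec m => ((inner ℝ v u - f u : ℝ) : EReal)) u

theorem conj_ne_bot (f : Vec m → ℝ) (v : Vec m) : conj f v ≠ ⊥ :=
  ne_bot_of_le_ne_bot (EReal.coe_ne_bot _) (le_conj f v 0)

theorem coe_conjReal {v : Vec m} (hv : v ∈ conjDom f) : (conjReal f v : EReal) = conj f v :=
  EReal.coe_toReal hv (conj_ne_bot f v)

theorem inner_sub_le_conjReal {v : Vec m} (hv : v ∈ conjDom f) (u : Vec m) :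
    inner ℝ v u - f u ≤ conjReal f v := by
  have := le_conj f v u
  rw [← coe_conjReal hv] at this
  exact_mod_cast this

theorem conj_le {v : Vec m} {c : ℝ} (h : ∀ u, inner ℝ v u - f u ≤ c) : conj f v ≤ c :=
  iSup_le fun u => EReal.coe_le_coe_iff.2 (h u)

theorem mem_conjDom {v : Vec m} {c : ℝ} (h : ∀ u, inner ℝ v u - f u ≤ c) : v ∈ conjDom f :=
  ((conj_le h).trans_lt (EReal.coe_lt_top c)).ne

theorem conjReal_le {v : Vec m} {c : ℝ} (h : ∀ u, inner ℝ v u - f u ≤ c) : conjReal f v ≤ c := by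
  have := conj_le h
  rw [← coe_conjReal (mem_conjDom h)] at this
  exact_mod_cast this

theorem convexOn_conjReal (f : Vec m → ℝ) : ConvexOn ℝ (conjDom f) (conjReal f) := by
  have key : ∀ v ∈ conjDom f, ∀ w ∈ conjDom f, ∀ a b : ℝ, 0 ≤ a → 0 ≤ b → a + b = 1 →
      ∀ u, inner ℝ (a • v + b • w) u - f u ≤ a * conjReal f v + b * conjReal f w := by
    intro v hv w hw a b ha hb hab u
    have h1 := mul_le_mul_of_nonneg_left (inner_sub_le_conjReal hv u) ha
    have h2 := mul_le_mul_of_nonneg_left (inner_sub_le_conjReal hw u) hb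
    rw [inner_add_left, real_inner_smul_left, real_inner_smul_left]
    have h3 : f u = a * f u + b * f u := by rw [← add_mul, hab, one_mul]
    linarith
  exact ⟨fun v hv w hw a b ha hb hab => mem_conjDom (key v hv w hw a b ha hb hab),
    fun v hv w hw a b ha hb hab => conjReal_le (key v hv w hw a b ha hb hab)⟩

theorem norm_le_of_mem_conjDom {C : ℝ} (hC : 0 ≤ C) (hf : ∀ u w, |f u - f w| ≤ C * ‖u - w‖)
    {v : Vec m} (hv : v ∈ conjDom f) : ‖v‖ ≤ C := by
  by_contra hc
  push Not at hc
  have hv0 : 0 < ‖v‖ := hC.trans_lt hc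
  have hp : 0 < ‖v‖ * (‖v‖ - C) := mul_pos hv0 (by linarith)
  -- Along the ray `s • v` the affine minorants of the conjugate grow at least like `s‖v‖(‖v‖ - C)`;
  -- this `s` makes them exceed the finite value of the conjugate.
  set s : ℝ := (|conjReal f v + f 0| + 1) / (‖v‖ * (‖v‖ - C)) with hs
  have hs0 : 0 ≤ s := by positivity
  have h1 := inner_sub_le_conjReal hv (s • v)
  have h2 := (le_abs_self _).trans (hf (s • v) 0)
  rw [sub_zero, norm_smul, Real.norm_of_nonneg hs0] at h2
  rw [real_inner_smul_right, real_inner_self_eq_norm_sq] at h1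
  have h3 : s * (‖v‖ * (‖v‖ - C)) = |conjReal f v + f 0| + 1 := by
    rw [hs]; field_simp
  nlinarith [le_abs_self (conjReal f v + f 0)]

/-- Testing with `-s eⱼ`, where monotonicity keeps `f` below `f 0`, a negative `v j` would make the
conjugate infinite as `s` grows. -/
theorem nonneg_of_mem_conjDom (hf : ∀ u w : Vec m, (∀ j, u j ≤ w j) → f u ≤ f w) {v : Vec m}
    (hv : v ∈ conjDom f) (j : Fin m) : 0 ≤ v j := by
  by_contra hc
  push Not at hc
  set s : ℝ := (|conjReal f v + f 0| + 1) / (- v j) with hs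
  have hs0 : 0 ≤ s := div_nonneg (by positivity) (by linarith)
  have h1 := inner_sub_le_conjReal hv (EuclideanSpace.single j (-s))
  have h2 : f (EuclideanSpace.single j (-s)) ≤ f 0 := by
    refine hf _ _ fun k => ?_
    by_cases hk : k = j
    · subst hk; simpa using hs0
    · simp [hk]
  have h3 : s * (- v j) = |conjReal f v + f 0| + 1 := by
    rw [hs]; field_simp [hc.ne]
  have h4 : inner ℝ v (EuclideanSpace.single j (-s)) = s * (- v j) := by
    simp [EuclideanSpace.inner_single_right]
  rw [h4] at h1
  linarith [le_abs_self (conjReal f v + f 0)]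

/-- A hyperplane supporting the strict epigraph at `(u, f u)` cannot be vertical because `f` is
finite everywhere. Normalized by its vertical coefficient, it yields a slope at which Fenchel–Young
is an equality. -/
theorem exists_subgradient (hf : ConvexOn ℝ Set.univ f) (hc : Continuous f) (u : Vec m) :
    ∃ v ∈ conjDom f, conjReal f v ≤ inner ℝ v u - f u := by
  have ho : IsOpen {q : Vec m × ℝ | f q.1 < q.2} :=
    isOpen_lt (hc.comp continuous_fst) continuous_snd
  have hcv : Convex ℝ {q : Vec m × ℝ | f q.1 < q.2} := by
    simpa using hf.convex_strict_epigraph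
  obtain ⟨ℓ, hℓ⟩ := geometric_hahn_banach_open_point hcv ho
    (x := (u, f u)) (by simp)
  have dec : ∀ z : Vec m, ∀ s : ℝ, ℓ (z, s) = ℓ (z, 0) + s * ℓ (0, 1) := by
    intro z s
    have : ((z, s) : Vec m × ℝ) = (z, 0) + s • (0, 1) := by simp
    rw [this, map_add, map_smul, smul_eq_mul]
  set κ := ℓ (0, 1) with hκ
  have hκ0 : κ < 0 := by
    have := hℓ (u, f u + 1) (by simp)
    rw [dec u (f u + 1), dec u (f u)] at this
    linarith
  have hle : ∀ z, ℓ (z, 0) + f z * κ ≤ ℓ (u, 0) + f u * κ := by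
    intro z
    apply le_of_forall_pos_le_add
    intro e he
    -- Only the open epigraph is separated, so the graph point is approached from above; the height
    -- is scaled so that the loss is exactly `e`.
    have := hℓ (z, f z + e / (-κ)) (by simpa using div_pos he (by linarith))
    rw [dec z, dec u (f u)] at this
    have hκn := hκ0.ne
    have h5 : e / (-κ) * κ = -e := by field_simp
    linarith
  let φ : StrongDual ℝ (Vec m) := (-κ)⁻¹ • (ℓ.comp (ContinuousLinearMap.inl ℝ (Vec m) ℝ))
  set v := (InnerProductSpace.toDual ℝ (Vec m)).symm φ with hv
  have hin : ∀ z, inner ℝ v z = (-κ)⁻¹ * ℓ (z, 0) := by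
    intro z
    rw [hv, InnerProductSpace.toDual_symm_apply]
    simp [φ]
  have key : ∀ z, inner ℝ v z - f z ≤ inner ℝ v u - f u := by
    intro z
    rw [hin, hin]
    have hk : 0 < (-κ)⁻¹ := by
      apply inv_pos.2; linarith
    have := mul_le_mul_of_nonneg_left (hle z) hk.le
    have hκn := hκ0.ne
    have h6 : ∀ a : ℝ, (-κ)⁻¹ * (a * κ) = -a := fun a => by field_simp
    rw [mul_add, mul_add, h6, h6] at this
    linarith
  exact ⟨v, mem_conjDom key, conjReal_le key⟩

theorem conjDom_nonempty (hf : ConvexOn ℝ Set.univ f) (hc : Continuous f) :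
    (conjDom f).Nonempty :=
  let ⟨v, hv, _⟩ := exists_subgradient hf hc 0
  ⟨v, hv⟩

/-- Outside the effective domain the objective is `⊥`, which cannot be maximal while the domain is
nonempty. A maximizer over the closure is thus a real minimizer over the domain itself. -/
theorem isArgmax_conj {ℓ : Vec m → ℝ} {a : Vec m} (hne : (conjDom f).Nonempty)
    (h : IsArgmax (fun v => (ℓ v : EReal) - conj f v) (dualDomain f) a) :
    a ∈ conjDom f ∧ ∀ v ∈ conjDom f, conjReal f a - ℓ a ≤ conjReal f v - ℓ v := by
  have hmem : ∀ v ∈ conjDom f, (ℓ v : EReal) - conjReal f v ≤ (ℓ a : EReal) - conj f a := by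
    intro v hv
    have := h.2 (subset_closure hv : v ∈ dualDomain f)
    simp only [Set.mem_ofPred_eq] at this
    rwa [coe_conjReal hv]
  have ha : a ∈ conjDom f := by
    intro htop
    obtain ⟨v, hv⟩ := hne
    have := hmem v hv
    rw [htop, EReal.sub_top, le_bot_iff, ← EReal.coe_sub] at this
    exact EReal.coe_ne_bot _ this
  refine ⟨ha, fun v hv => ?_⟩
  have := hmem v hv
  rw [← coe_conjReal ha, ← EReal.coe_sub, ← EReal.coe_sub, EReal.coe_le_coe_iff] at this
  linarith

theorem isClosed_dualDomain (f : Vec m → ℝ) : IsClosed (dualDomain f) := isClosed_closure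

theorem norm_le_of_mem_dualDomain {C : ℝ} (hC : 0 ≤ C) (hf : ∀ u w, |f u - f w| ≤ C * ‖u - w‖)
    {v : Vec m} (hv : v ∈ dualDomain f) : ‖v‖ ≤ C := by
  have : dualDomain f ⊆ Metric.closedBall 0 C :=
    closure_minimal (fun w hw => by simpa using norm_le_of_mem_conjDom hC hf hw)
      Metric.isClosed_closedBall
  simpa using this hv

/-- The maximum of a continuous function minus the conjugate is attained on the domain. -/
theorem exists_min_conjReal {C : ℝ} (hC : 0 ≤ C) (hf : ∀ u w, |f u - f w| ≤ C * ‖u - w‖)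
    (hne : (conjDom f).Nonempty) {ℓ : Vec m → ℝ} (hℓ : Continuous ℓ) :
    ∃ a ∈ conjDom f, ∀ v ∈ conjDom f, conjReal f a + ℓ a ≤ conjReal f v + ℓ v := by
  have hcomp : IsCompact (dualDomain f) :=
    (isCompact_closedBall (0 : Vec m) C).of_isClosed_subset (isClosed_dualDomain f)
      fun v hv => by simpa using norm_le_of_mem_dualDomain hC hf hv
  -- Moving `ℓ v` inside the supremum keeps everything a supremum of continuous functions and avoids
  -- addition in `EReal`.
  have hlsc : LowerSemicontinuous fun v =>
      ⨆ u : Vec m, ((inner ℝ v u - f u + ℓ v : ℝ) : EReal) := by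
    refine lowerSemicontinuous_iSup fun u => Continuous.lowerSemicontinuous ?_
    exact continuous_coe_real_ereal.comp (by fun_prop)
  obtain ⟨a, ha, hmin⟩ := LowerSemicontinuousOn.exists_isMinOn
    (s := dualDomain f) (hne.mono subset_closure) hcomp (hlsc.lowerSemicontinuousOn _)
  have hup : ∀ v ∈ conjDom f,
      (⨆ u : Vec m, ((inner ℝ v u - f u + ℓ v : ℝ) : EReal)) ≤ (conjReal f v + ℓ v : ℝ) :=
    fun v hv => iSup_le fun u => EReal.coe_le_coe_iff.2 <| by
      linarith [inner_sub_le_conjReal hv u]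
  -- The minimizer is found on the compact closure; comparison with a point of finite value shows
  -- that it belongs to the domain.
  have key : ∀ v ∈ conjDom f, ∀ u, inner ℝ a u - f u ≤ conjReal f v + ℓ v - ℓ a := by
    intro v hv u
    have h1 := hmin (subset_closure hv : v ∈ dualDomain f)
    have h2 := (le_iSup (fun u : Vec m => ((inner ℝ a u - f u + ℓ a : ℝ) : EReal)) u).trans
      (h1.trans (hup v hv))
    have h3 := EReal.coe_le_coe_iff.1 h2
    linarith
  obtain ⟨v₀, hv₀⟩ := hne
  refine ⟨a, mem_conjDom (key v₀ hv₀), fun v hv => ?_⟩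
  linarith [conjReal_le (key v hv)]

end Conj

/-! ### Proximal steps: three-point inequality, nonexpansiveness, Lipschitz dependence -/

section Prox

variable {E : Type*} [NormedAddCommGroup E] [InnerProductSpace ℝ E]

theorem nonneg_of_forall_add_mul {A B : ℝ} (h : ∀ s : ℝ, 0 < s → s ≤ 1 → 0 ≤ A + s * B) :
    0 ≤ A := by
  by_contra hA
  push Not at hA
  have hb := abs_nonneg B
  have hd : 0 < 2 * (|B| + -A) := by linarith
  -- At this `s` the perturbation satisfies `s * |B| ≤ -A / 2`, so `A + s * B` would still be
  -- negative.
  have hs : 0 < -A / (2 * (|B| + -A)) := div_pos (by linarith) hd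
  have hs1 : -A / (2 * (|B| + -A)) ≤ 1 := by rw [div_le_one hd]; linarith
  have h1 := h _ hs hs1
  have h2 : -A / (2 * (|B| + -A)) * (2 * (|B| + -A)) = -A := div_mul_cancel₀ _ hd.ne'
  nlinarith [le_abs_self B]

/-- A minimizer of a convex function plus a multiple of the squared distance to `w` satisfies
the three-point inequality. -/
theorem prox_three_point {C : Set E} {φ : E → ℝ} (hφ : ConvexOn ℝ C φ) {c : ℝ}
    {a w : E} (ha : a ∈ C)
    (hmin : ∀ z ∈ C, φ a + c / 2 * ‖a - w‖ ^ 2 ≤ φ z + c / 2 * ‖z - w‖ ^ 2) {z : E} (hz : z ∈ C) :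
    φ a + c / 2 * ‖a - w‖ ^ 2 + c / 2 * ‖z - a‖ ^ 2 ≤ φ z + c / 2 * ‖z - w‖ ^ 2 := by
  -- First-order optimality, from moving from `a` towards `z` by a fraction `s` and letting `s` tend
  -- to `0`.
  have h0 : 0 ≤ φ z - φ a + c * inner ℝ (a - w) (z - a) := by
    apply nonneg_of_forall_add_mul (B := c / 2 * ‖z - a‖ ^ 2)
    intro s hs hs1
    have hmem : (1 - s) • a + s • z ∈ C := hφ.1 ha hz (by linarith) hs.le (by ring)
    have h1 := hmin _ hmem
    have h2 := hφ.2 ha hz (by linarith : 0 ≤ 1 - s) hs.le (by ring)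
    have h3 : (1 - s) • a + s • z - w = (a - w) + s • (z - a) := by module
    rw [h3, norm_add_sq_real, norm_smul, real_inner_smul_right, mul_pow, Real.norm_eq_abs,
      sq_abs] at h1
    simp only [smul_eq_mul] at h2
    have h4 : 0 ≤ s * (φ z - φ a + c * inner ℝ (a - w) (z - a) + s * (c / 2 * ‖z - a‖ ^ 2)) := by
      nlinarith
    exact nonneg_of_mul_nonneg_right h4 hs
  have h5 : ‖z - w‖ ^ 2 = ‖a - w‖ ^ 2 + 2 * inner ℝ (a - w) (z - a) + ‖z - a‖ ^ 2 := by
    rw [← norm_add_sq_real]; congr 2; abel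
  rw [h5]; linarith

/-- The proximal point is a nonexpansive function of the centre shifted by the linear term. -/
theorem prox_nonexpansive {C : Set E} {φ : E → ℝ} (hφ : ConvexOn ℝ C φ) {c : ℝ} (hc : 0 < c)
    {a a' w w' l l' : E} (ha : a ∈ C) (ha' : a' ∈ C)
    (hmin : ∀ z ∈ C, φ a + inner ℝ l a + c / 2 * ‖a - w‖ ^ 2 ≤
      φ z + inner ℝ l z + c / 2 * ‖z - w‖ ^ 2)
    (hmin' : ∀ z ∈ C, φ a' + inner ℝ l' a' + c / 2 * ‖a' - w'‖ ^ 2 ≤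
      φ z + inner ℝ l' z + c / 2 * ‖z - w'‖ ^ 2) :
    ‖a - a'‖ ≤ ‖(w - c⁻¹ • l) - (w' - c⁻¹ • l')‖ := by
  have hcv : ∀ l : E, ConvexOn ℝ C fun z => φ z + inner ℝ l z := fun l =>
    hφ.add ((innerₛₗ ℝ l).convexOn hφ.1)
  have h1 := prox_three_point (hcv l) ha hmin ha'
  have h2 := prox_three_point (hcv l') ha' hmin' ha
  have e1 : ‖a' - w‖ ^ 2 = ‖a - w‖ ^ 2 + 2 * inner ℝ (a - w) (a' - a) + ‖a' - a‖ ^ 2 := by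
    rw [← norm_add_sq_real]; congr 2; abel
  have e2 : ‖a' - w'‖ ^ 2 = ‖a - w'‖ ^ 2 + 2 * inner ℝ (a - w') (a' - a) + ‖a' - a‖ ^ 2 := by
    rw [← norm_add_sq_real]; congr 2; abel
  have e3 : inner ℝ (a - a') ((w - c⁻¹ • l) - (w' - c⁻¹ • l')) =
      inner ℝ (a - w) (a' - a) - inner ℝ (a - w') (a' - a)
        - c⁻¹ * (inner ℝ l a - inner ℝ l a' - inner ℝ l' a + inner ℝ l' a') := by
    simp only [inner_sub_left, inner_sub_right, inner_smul_right, real_inner_comm]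
    ring
  -- The two three-point inequalities, each tested at the other minimizer, add up to firm
  -- nonexpansiveness; Cauchy–Schwarz finishes.
  have h3 : c * ‖a - a'‖ ^ 2 ≤ c * inner ℝ (a - a') ((w - c⁻¹ • l) - (w' - c⁻¹ • l')) := by
    rw [e3, mul_sub, mul_inv_cancel_left₀ hc.ne']
    rw [norm_sub_rev a' a] at h1 e1 e2
    rw [e1] at h1
    rw [e2] at h2
    linarith
  have h4 : ‖a - a'‖ ^ 2 ≤ ‖a - a'‖ * ‖(w - c⁻¹ • l) - (w' - c⁻¹ • l')‖ :=
    (le_of_mul_le_mul_left h3 hc).trans (real_inner_le_norm _ _)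
  rcases (norm_nonneg (a - a')).eq_or_lt with h | h
  · rw [← h]; positivity
  · rw [sq] at h4; exact le_of_mul_le_mul_left h4 h

/-- A map dominated by a measurable map is a Lipschitz function of it. -/
theorem exists_lipschitz_factor {Ω : Type*} [FiniteDimensional ℝ E] {a q : Ω → E}
    (h : ∀ ω ω', ‖a ω - a ω'‖ ≤ ‖q ω - q ω'‖) :
    ∃ (K : NNReal) (φ : E → E), LipschitzWith K φ ∧ ∀ ω, a ω = φ (q ω) := by
  classical
  rcases isEmpty_or_nonempty Ω with hΩ | hΩ
  · exact ⟨0, fun _ => 0, LipschitzWith.const 0, fun ω => (hΩ.false ω).elim⟩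
  have hsec : ∀ y ∈ Set.range q, q (Function.invFun q y) = y := fun y hy => Function.invFun_eq hy
  have hl : LipschitzOnWith 1 (fun y => a (Function.invFun q y)) (Set.range q) := by
    refine LipschitzOnWith.of_dist_le_mul fun y hy z hz => ?_
    rw [dist_eq_norm, dist_eq_norm, NNReal.coe_one, one_mul]
    refine (h _ _).trans ?_
    rw [hsec y hy, hsec z hz]
  -- The factor is 1-Lipschitz on the range of `q`; extending it to the whole space may enlarge the
  -- constant, whose value is irrelevant.
  obtain ⟨φ, hφ, heq⟩ := hl.extend_finite_dimension
  refine ⟨_, φ, hφ, fun ω => ?_⟩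
  rw [← heq ⟨ω, rfl⟩]
  have := h ω (Function.invFun q (q ω))
  rw [hsec _ ⟨ω, rfl⟩, sub_self, norm_zero] at this
  exact sub_eq_zero.1 (norm_le_zero_iff.1 this)

end Prox


/-! ### Independence of a fresh draw from the past -/

section Fresh

variable {Ω γ α : Type*} [MeasurableSpace γ] {ξ : ℕ → Ω → γ} {t : ℕ}

/-- The σ-algebra generated by the draws before time `t`. -/
@[reducible] def past (ξ : ℕ → Ω → γ) (t : ℕ) : MeasurableSpace Ω :=
  ⨆ s ∈ Set.Iio t, MeasurableSpace.comap (ξ s) inferInstance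

theorem past_mono {s t : ℕ} (h : s ≤ t) : past ξ s ≤ past ξ t :=
  biSup_mono fun _ hr => lt_of_lt_of_le hr h

theorem measurable_past (ξ : ℕ → Ω → γ) {s t : ℕ} (h : s < t) : Measurable[past ξ t] (ξ s) :=
  measurable_iff_comap_le.2
    (le_iSup₂ (f := fun s (_ : s ∈ Set.Iio t) =>
      MeasurableSpace.comap (ξ s) (inferInstance : MeasurableSpace γ)) s h)

variable [mΩ : MeasurableSpace Ω] [mα : MeasurableSpace α] {Pr : Measure Ω}

theorem past_le (hξ : ∀ t, Measurable (ξ t)) (t : ℕ) : past ξ t ≤ mΩ :=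
  iSup₂_le fun s _ => (hξ s).comap_le

theorem indepFun_past (hξ : ∀ t, Measurable (ξ t)) (hi : iIndepFun ξ Pr) {U : Ω → α}
    (hU : Measurable[past ξ t] U) : IndepFun U (ξ t) Pr := by
  rw [IndepFun_iff_Indep]
  have h := indep_iSup_of_disjoint (fun s => (hξ s).comap_le) hi.iIndep
    (S := Set.Iio t) (T := {t}) (by simp)
  refine indep_of_indep_of_le_right (indep_of_indep_of_le_left h hU.comap_le) ?_
  simp

theorem map_past_prod [IsFiniteMeasure Pr] (hξ : ∀ t, Measurable (ξ t)) (hi : iIndepFun ξ Pr)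
    {U : Ω → α} (hU : Measurable[past ξ t] U) :
    Pr.map (fun ω => (U ω, ξ t ω)) = (Pr.map U).prod (Pr.map (ξ t)) :=
  (indepFun_iff_map_prod_eq_prod_map_map (hU.mono (past_le hξ t) le_rfl).aemeasurable
    (hξ t).aemeasurable).1 (indepFun_past hξ hi hU)

variable [IsFiniteMeasure Pr]

/-- The past and the fresh draw have a product joint law, so a function centred in the draw for
every past value has mean zero. All martingale arguments below reduce to this. -/
theorem integral_fresh_eq_zero {E : Type*} [NormedAddCommGroup E] [NormedSpace ℝ E]
    (hξ : ∀ t, Measurable (ξ t)) (hi : iIndepFun ξ Pr) {U : Ω → α}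
    (hU : Measurable[past ξ t] U) {φ : α → γ → E} (hφ : StronglyMeasurable (Function.uncurry φ))
    (h0 : ∀ ω, ∫ d, φ (U ω) d ∂(Pr.map (ξ t)) = 0) :
    ∫ ω, φ (U ω) (ξ t ω) ∂Pr = 0 := by
  have hU' := hU.mono (past_le hξ t) le_rfl
  have hp := hU'.prodMk (hξ t)
  by_cases hint : Integrable (fun ω => φ (U ω) (ξ t ω)) Pr
  · have e : ∫ ω, φ (U ω) (ξ t ω) ∂Pr
        = ∫ q, Function.uncurry φ q ∂(Pr.map (fun ω => (U ω, ξ t ω))) :=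
      (integral_map hp.aemeasurable hφ.aestronglyMeasurable).symm
    have hint' : Integrable (Function.uncurry φ) (Pr.map (fun ω => (U ω, ξ t ω))) :=
      (integrable_map_measure hφ.aestronglyMeasurable hp.aemeasurable).2 hint
    rw [map_past_prod hξ hi hU] at e hint'
    rw [e, integral_prod _ hint', integral_map hU'.aemeasurable
      hφ.integral_prod_right'.aestronglyMeasurable]
    simp [h0]
  -- A non-integrable function has Bochner integral `0`, so integrability need not be assumed.
  · exact integral_undef hint

/-- A uniform conditional bound becomes an unconditional one. Since integrability is part of the
conclusion, the computation uses Tonelli for the lower integral. -/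
theorem integrable_fresh_of_le [IsProbabilityMeasure Pr] (hξ : ∀ t, Measurable (ξ t))
    (hi : iIndepFun ξ Pr)
    {U : Ω → α} (hU : Measurable[past ξ t] U) {φ : α → γ → ℝ}
    (hφ : StronglyMeasurable (Function.uncurry φ)) (hn : ∀ u d, 0 ≤ φ u d) {c : ℝ}
    (hint : ∀ ω, Integrable (φ (U ω)) (Pr.map (ξ t)))
    (hle : ∀ ω, ∫ d, φ (U ω) d ∂(Pr.map (ξ t)) ≤ c) :
    Integrable (fun ω => φ (U ω) (ξ t ω)) Pr ∧ ∫ ω, φ (U ω) (ξ t ω) ∂Pr ≤ c := by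
  have hU' := hU.mono (past_le hξ t) le_rfl
  have hp := hU'.prodMk (hξ t)
  have hm : StronglyMeasurable (fun ω => φ (U ω) (ξ t ω)) := hφ.comp_measurable hp
  have hF : Measurable (fun q => ENNReal.ofReal (Function.uncurry φ q)) :=
    hφ.measurable.ennreal_ofReal
  have hlin : ∫⁻ ω, ENNReal.ofReal (φ (U ω) (ξ t ω)) ∂Pr ≤ ENNReal.ofReal c := by
    have e : ∫⁻ ω, ENNReal.ofReal (φ (U ω) (ξ t ω)) ∂Pr
        = ∫⁻ q, ENNReal.ofReal (Function.uncurry φ q) ∂(Pr.map (fun ω => (U ω, ξ t ω))) :=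
      (lintegral_map hF hp).symm
    rw [e, map_past_prod hξ hi hU, lintegral_prod _ hF.aemeasurable,
      lintegral_map hF.lintegral_prod_right' hU']
    calc _ ≤ ∫⁻ _, ENNReal.ofReal c ∂Pr := by
          refine lintegral_mono fun ω => ?_
          simp only [Function.uncurry_apply_pair]
          rw [← ofReal_integral_eq_lintegral_ofReal (hint ω)
            (Filter.Eventually.of_forall fun d => hn _ d)]
          exact ENNReal.ofReal_le_ofReal (hle ω)
      _ = _ := by simp
  have hi' : Integrable (fun ω => φ (U ω) (ξ t ω)) Pr := by
    refine ⟨hm.aestronglyMeasurable, ?_⟩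
    rw [hasFiniteIntegral_iff_ofReal (Filter.Eventually.of_forall fun ω => hn _ _)]
    exact hlin.trans_lt ENNReal.ofReal_lt_top
  refine ⟨hi', ?_⟩
  obtain ⟨ω₀⟩ := nonempty_of_isProbabilityMeasure Pr
  have hc : 0 ≤ c := (integral_nonneg fun d => hn _ d).trans (hle ω₀)
  rw [← ofReal_integral_eq_lintegral_ofReal hi'
    (Filter.Eventually.of_forall fun ω => hn _ _)] at hlin
  exact (ENNReal.ofReal_le_ofReal_iff hc).1 hlin

end Fresh

/-! ### Pythagoras for orthogonal square-integrable vectors -/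

section Orthogonal

variable {Ω E ι : Type*} [MeasurableSpace Ω] {μ : Measure Ω} [NormedAddCommGroup E]

theorem memLp_two_of_integrable_sq {f : Ω → E} (hf : AEStronglyMeasurable f μ)
    (h : Integrable (fun ω => ‖f ω‖ ^ 2) μ) : MemLp f 2 μ :=
  (memLp_two_iff_integrable_sq_norm hf).2 h

theorem integrable_sq_of_memLp {f : Ω → E} (hf : MemLp f 2 μ) :
    Integrable (fun ω => ‖f ω‖ ^ 2) μ :=
  (memLp_two_iff_integrable_sq_norm hf.aestronglyMeasurable).1 hf

variable [InnerProductSpace ℝ E]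

theorem integrable_inner_of_memLp {f g : Ω → E} (hf : MemLp f 2 μ) (hg : MemLp g 2 μ) :
    Integrable (fun ω => inner ℝ (f ω) (g ω)) μ := by
  refine (hf.norm.integrable_mul hg.norm).mono
    (hf.aestronglyMeasurable.inner hg.aestronglyMeasurable)
    (Filter.Eventually.of_forall fun ω => ?_)
  simpa using norm_inner_le_norm (𝕜 := ℝ) (f ω) (g ω)

theorem integral_norm_sum_sq [DecidableEq ι] (s : Finset ι) {u : ι → Ω → E}
    (hu : ∀ i ∈ s, MemLp (u i) 2 μ)
    (ho : ∀ i ∈ s, ∀ j ∈ s, i ≠ j → ∫ ω, inner ℝ (u i ω) (u j ω) ∂μ = 0) :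
    ∫ ω, ‖∑ i ∈ s, u i ω‖ ^ 2 ∂μ = ∑ i ∈ s, ∫ ω, ‖u i ω‖ ^ 2 ∂μ := by
  have e : ∀ ω, ‖∑ i ∈ s, u i ω‖ ^ 2 = ∑ i ∈ s, ∑ j ∈ s, inner ℝ (u i ω) (u j ω) := by
    intro ω
    rw [← real_inner_self_eq_norm_sq, sum_inner]
    exact Finset.sum_congr rfl fun i _ => inner_sum _ _ _
  simp_rw [e]
  rw [integral_finsetSum _ fun i hi => integrable_finsetSum _ fun j hj =>
    integrable_inner_of_memLp (hu i hi) (hu j hj)]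
  refine Finset.sum_congr rfl fun i hi => ?_
  rw [integral_finsetSum _ fun j hj => integrable_inner_of_memLp (hu i hi) (hu j hj),
    Finset.sum_eq_single_of_mem i hi fun j hj hji => ho i hi j hj hji.symm]
  simp_rw [real_inner_self_eq_norm_sq]

end Orthogonal

/-! ### Uniform block sampling: inclusion probability and centred weights -/

section BlockBatch

variable {n S : ℕ}

/-- The law of the block batch. -/
noncomputable def blockLaw (n S : ℕ) : Measure (Finset (Fin n)) :=
  uniformOn {A : Finset (Fin n) | A.card = S}

/-- Membership of block `i` in the batch, as a number. -/
def incl (i : Fin n) (A : Finset (Fin n)) : ℝ := if i ∈ A then 1 else 0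

/-- The centred inverse-propensity weight of block `i`. -/
noncomputable def weight (S : ℕ) (i : Fin n) (A : Finset (Fin n)) : ℝ :=
  1 - (n : ℝ) / S * incl i A

/-- This is `n·C(n-1, S-1) = S·C(n, S)`, which gives the inclusion probability `S/n`. -/
theorem card_filter_mem_powersetCard (i : Fin n) (hS : 1 ≤ S) :
    n * ((Finset.powersetCard S Finset.univ).filter (i ∈ ·)).card =
      S * (Finset.powersetCard S (Finset.univ : Finset (Fin n))).card := by
  have h := Finset.card_filter_powersetCard_subset {i} (Finset.univ : Finset (Fin n)) S
    (Finset.subset_univ _) (by simpa using hS)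
  simp only [Finset.singleton_subset_iff, Finset.card_univ, Fintype.card_fin,
    Finset.card_singleton] at h
  rw [h, Finset.card_powersetCard, Finset.card_univ, Fintype.card_fin]
  have hn : 1 ≤ n := i.pos
  obtain ⟨n', rfl⟩ := Nat.exists_eq_add_of_le' hn
  obtain ⟨S', rfl⟩ := Nat.exists_eq_add_of_le' hS
  simpa [mul_comm] using Nat.add_one_mul_choose_eq n' S'

theorem isProbabilityMeasure_blockLaw (hSn : S ≤ n) : IsProbabilityMeasure (blockLaw n S) := by
  refine isProbabilityMeasure_uniformOn (Set.toFinite _) ?_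
  obtain ⟨A, -, hA⟩ := Finset.exists_subset_card_eq
    (s := (Finset.univ : Finset (Fin n))) (n := S) (by simpa using hSn)
  exact ⟨A, hA⟩

theorem ae_card_blockLaw : ∀ᵐ A ∂(blockLaw n S), A.card = S :=
  ae_cond_mem (μ := Measure.count) (s := {A : Finset (Fin n) | A.card = S})
    (Set.toFinite _).measurableSet

theorem integrable_blockLaw (hSn : S ≤ n) (f : Finset (Fin n) → ℝ) :
    Integrable f (blockLaw n S) := by
  have := isProbabilityMeasure_blockLaw hSn
  exact Integrable.of_finite

theorem integral_incl (i : Fin n) (hS : 1 ≤ S) (hSn : S ≤ n) :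
    ∫ A, incl i A ∂(blockLaw n S) = S / n := by
  have hp := isProbabilityMeasure_blockLaw hSn
  have e : (fun A : Finset (Fin n) => incl i A) = Set.indicator {A | i ∈ A} (fun _ => (1 : ℝ)) := by
    ext A; simp [incl, Set.indicator_apply]
  rw [e, integral_indicator_const _ (Set.toFinite _).measurableSet, smul_eq_mul, mul_one,
    Measure.real, blockLaw, uniformOn, cond_apply (Set.toFinite _).measurableSet]
  have e1 : {A : Finset (Fin n) | A.card = S} = ↑(Finset.powersetCard S (Finset.univ : Finset (Fin n))) := by
    ext A; simp [Finset.mem_powersetCard]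
  have e2 : {A : Finset (Fin n) | A.card = S} ∩ {A | i ∈ A}
      = ↑((Finset.powersetCard S (Finset.univ : Finset (Fin n))).filter (i ∈ ·)) := by
    ext A; simp [Finset.mem_powersetCard]
  rw [e2, e1, Measure.count_apply_finset, Measure.count_apply_finset]
  have h := card_filter_mem_powersetCard i hS
  have hc : 0 < (Finset.powersetCard S (Finset.univ : Finset (Fin n))).card := by
    rw [Finset.card_powersetCard]; exact Nat.choose_pos (by simpa using hSn)
  have hn : 0 < n := i.pos
  rw [ENNReal.toReal_mul, ENNReal.toReal_inv, ENNReal.toReal_natCast, ENNReal.toReal_natCast]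
  rify at h hc hn
  field_simp
  linarith

theorem integral_weight (i : Fin n) (hS : 1 ≤ S) (hSn : S ≤ n) :
    ∫ A, weight S i A ∂(blockLaw n S) = 0 := by
  have hp := isProbabilityMeasure_blockLaw hSn
  have hn : 0 < n := i.pos
  unfold weight
  rw [integral_sub (integrable_const _) (integrable_blockLaw hSn _), integral_const_mul,
    integral_incl i hS hSn]
  rify at hn hS
  have hS' : (0 : ℝ) < S := by linarith
  simp
  field_simp
  ring

/-- The weight takes only the values `1` and `1 - n/S`, the roots of this quadratic. Its variance
`n/S - 1` thus follows from its mean, and the centred form suits the zero-mean principle for a fresh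
draw. -/
theorem weight_sq (i : Fin n) (A : Finset (Fin n)) :
    weight S i A ^ 2 - ((n : ℝ) / S - 1) = (2 - (n : ℝ) / S) * weight S i A := by
  unfold weight incl
  split_ifs <;> ring

theorem integral_weight_sq (i : Fin n) (hS : 1 ≤ S) (hSn : S ≤ n) :
    ∫ A, (weight S i A ^ 2 - ((n : ℝ) / S - 1)) ∂(blockLaw n S) = 0 := by
  simp_rw [weight_sq]
  rw [integral_const_mul, integral_weight i hS hSn, mul_zero]

end BlockBatch

/-! ### Mini-batch averages: mean and variance -/

section MiniBatch

variable {Z E : Type*} [MeasurableSpace Z] {P : Measure Z} [IsProbabilityMeasure P]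
  [NormedAddCommGroup E] {B : ℕ} {u : Z → E}

theorem integrable_comp_eval (hu : Integrable u P) (k : Fin B) :
    Integrable (fun b : Fin B → Z => u (b k)) (Measure.pi fun _ => P) :=
  (measurePreserving_eval (fun _ : Fin B => P) k).integrable_comp_of_integrable hu

theorem integral_comp_eval [NormedSpace ℝ E] (hu : AEStronglyMeasurable u P) (k : Fin B) :
    ∫ b : Fin B → Z, u (b k) ∂(Measure.pi fun _ => P) = ∫ z, u z ∂P := by
  have h := measurePreserving_eval (fun _ : Fin B => P) k
  rw [← h.map_eq] at hu
  have := integral_map h.aemeasurable hu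
  rw [h.map_eq] at this
  exact this.symm

theorem memLp_comp_eval (hu : MemLp u 2 P) (k : Fin B) :
    MemLp (fun b : Fin B → Z => u (b k)) 2 (Measure.pi fun _ => P) :=
  hu.comp_measurePreserving (measurePreserving_eval (fun _ : Fin B => P) k)

theorem integrable_batch [NormedSpace ℝ E] (hu : Integrable u P) :
    Integrable (fun b : Fin B → Z => (1 / (B : ℝ)) • ∑ k, u (b k)) (Measure.pi fun _ => P) :=
  (integrable_finsetSum _ fun k _ => integrable_comp_eval hu k).smul _

theorem memLp_batch [NormedSpace ℝ E] (hu : MemLp u 2 P) :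
    MemLp (fun b : Fin B → Z => (1 / (B : ℝ)) • ∑ k, u (b k)) 2 (Measure.pi fun _ => P) :=
  (memLp_finsetSum _ fun k _ => memLp_comp_eval hu k).const_smul _

theorem integral_batch [NormedSpace ℝ E] [CompleteSpace E] (hB : 1 ≤ B) (hu : Integrable u P) :
    ∫ b : Fin B → Z, (1 / (B : ℝ)) • ∑ k, u (b k) ∂(Measure.pi fun _ => P) = ∫ z, u z ∂P := by
  rw [integral_smul, integral_finsetSum _ fun k _ => integrable_comp_eval hu k]
  simp_rw [integral_comp_eval hu.aestronglyMeasurable]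
  rw [Finset.sum_const, Finset.card_univ, Fintype.card_fin, ← Nat.cast_smul_eq_nsmul ℝ, smul_smul]
  have : (B : ℝ) ≠ 0 := by positivity
  rw [one_div, inv_mul_cancel₀ this, one_smul]

/-- Distinct samples are independent and centred, so the cross terms vanish; this is the source of
the factor `1/B` in the dual noise. -/
theorem integral_norm_sq_batch [InnerProductSpace ℝ E] [CompleteSpace E] [MeasurableSpace E]
    [BorelSpace E] [SecondCountableTopology E]
    (hB : 1 ≤ B) (hm : Measurable u) (hu : MemLp u 2 P) (h0 : ∫ z, u z ∂P = 0) :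
    ∫ b : Fin B → Z, ‖(1 / (B : ℝ)) • ∑ k, u (b k)‖ ^ 2 ∂(Measure.pi fun _ => P)
      = (∫ z, ‖u z‖ ^ 2 ∂P) / B := by
  have hB' : (B : ℝ) ≠ 0 := by positivity
  have ho : ∀ i ∈ (Finset.univ : Finset (Fin B)), ∀ j ∈ (Finset.univ : Finset (Fin B)), i ≠ j →
      ∫ b : Fin B → Z, inner ℝ (u (b i)) (u (b j)) ∂(Measure.pi fun _ => P) = 0 := by
    intro i _ j _ hij
    have hind := (iIndepFun_pi (μ := fun _ : Fin B => P) (X := fun _ => u)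
      (fun _ => hm.aemeasurable)).indepFun hij
    have hmi : Measurable fun b : Fin B → Z => u (b i) := hm.comp (measurable_pi_apply i)
    have hmj : Measurable fun b : Fin B → Z => u (b j) := hm.comp (measurable_pi_apply j)
    have hmap := (indepFun_iff_map_prod_eq_prod_map_map hmi.aemeasurable hmj.aemeasurable).1 hind
    have hin : Continuous fun q : E × E => (inner ℝ q.1 q.2 : ℝ) := by fun_prop
    have hIn := integrable_inner_of_memLp (memLp_comp_eval hu i) (memLp_comp_eval hu j)
    have e : ∫ b : Fin B → Z, inner ℝ (u (b i)) (u (b j)) ∂(Measure.pi fun _ => P)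
        = ∫ q : E × E, inner ℝ q.1 q.2 ∂((Measure.pi fun _ => P).map
          (fun b : Fin B → Z => (u (b i), u (b j)))) :=
      (integral_map (hmi.prodMk hmj).aemeasurable hin.aestronglyMeasurable).symm
    have hIn' : Integrable (fun q : E × E => (inner ℝ q.1 q.2 : ℝ)) ((Measure.pi fun _ => P).map
          (fun b : Fin B → Z => (u (b i), u (b j)))) :=
      (integrable_map_measure hin.aestronglyMeasurable (hmi.prodMk hmj).aemeasurable).2 hIn
    rw [hmap] at e hIn'
    rw [e, integral_prod _ hIn']
    have hint : Integrable (fun v : E => v)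
        ((Measure.pi fun _ => P).map fun b : Fin B → Z => u (b j)) :=
      (integrable_map_measure aestronglyMeasurable_id hmj.aemeasurable).2
        (integrable_comp_eval (hu.integrable (by norm_num)) j)
    have hz : ∫ v, v ∂((Measure.pi fun _ => P).map fun b : Fin B → Z => u (b j)) = 0 := by
      rw [integral_map (f := fun v : E => v) hmj.aemeasurable aestronglyMeasurable_id,
        integral_comp_eval hm.aestronglyMeasurable, h0]
    simp_rw [integral_inner hint, hz, inner_zero_right, integral_zero]
  simp_rw [norm_smul, mul_pow]
  rw [integral_const_mul, integral_norm_sum_sq _ (fun k _ => memLp_comp_eval hu k) ho]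
  have hsq := integrable_sq_of_memLp hu
  simp_rw [integral_comp_eval (u := fun z => ‖u z‖ ^ 2) hsq.aestronglyMeasurable]
  rw [Finset.sum_const, Finset.card_univ, Fintype.card_fin, nsmul_eq_mul, Real.norm_eq_abs, sq_abs]
  field_simp

theorem norm_sq_average_le [NormedSpace ℝ E] (hB : 1 ≤ B) (a : Fin B → E) :
    ‖(1 / (B : ℝ)) • ∑ k, a k‖ ^ 2 ≤ (1 / (B : ℝ)) * ∑ k, ‖a k‖ ^ 2 := by
  have hB' : (0 : ℝ) < B := by positivity
  rw [norm_smul, Real.norm_of_nonneg (by positivity), mul_pow]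
  have h1 : ‖∑ k, a k‖ ^ 2 ≤ (∑ k, ‖a k‖) ^ 2 := by gcongr; exact norm_sum_le _ _
  have h2 : (∑ k, ‖a k‖) ^ 2 ≤ B * ∑ k, ‖a k‖ ^ 2 := by
    simpa using sq_sum_le_card_mul_sum_sq (s := Finset.univ) (f := fun k => ‖a k‖)
  calc _ ≤ (1 / (B : ℝ)) ^ 2 * (B * ∑ k, ‖a k‖ ^ 2) := by gcongr; exact h1.trans h2
    _ = _ := by field_simp

/-- Convexity of the squared norm suffices here, and it works in any normed space. It serves the
Jacobians, whose operator norm is not Hilbertian and for which no gain in `B` is needed. -/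
theorem integral_norm_sq_batch_le [NormedSpace ℝ E] (hB : 1 ≤ B)
    (hsq : Integrable (fun z => ‖u z‖ ^ 2) P) :
    ∫ b : Fin B → Z, ‖(1 / (B : ℝ)) • ∑ k, u (b k)‖ ^ 2 ∂(Measure.pi fun _ => P)
      ≤ ∫ z, ‖u z‖ ^ 2 ∂P := by
  have hi : Integrable (fun b : Fin B → Z => (1 / (B : ℝ)) • ∑ k, ‖u (b k)‖ ^ 2)
      (Measure.pi fun _ => P) := integrable_batch hsq
  refine (integral_mono_of_nonneg (Filter.Eventually.of_forall fun b => by positivity) hi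
    (Filter.Eventually.of_forall fun b => norm_sq_average_le hB fun k => u (b k))).trans ?_
  exact (integral_batch hB hsq).le

end MiniBatch


/-! ### The dual proximal map -/

section DualProx

variable {m : ℕ} {f : Vec m → ℝ} {C τ : ℝ}

open Classical in
/-- The proximal point of `q` for the conjugate of `f`. -/
noncomputable def dualProx (f : Vec m → ℝ) (τ : ℝ) (q : Vec m) : Vec m :=
  if h : ∃ a ∈ conjDom f, ∀ v ∈ conjDom f,
      conjReal f a + τ / 2 * ‖a - q‖ ^ 2 ≤ conjReal f v + τ / 2 * ‖v - q‖ ^ 2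
  then h.choose else 0

theorem dualProx_spec (hC : 0 ≤ C) (hf : ∀ u w, |f u - f w| ≤ C * ‖u - w‖)
    (hne : (conjDom f).Nonempty) (τ : ℝ) (q : Vec m) :
    dualProx f τ q ∈ conjDom f ∧ ∀ v ∈ conjDom f,
      conjReal f (dualProx f τ q) + τ / 2 * ‖dualProx f τ q - q‖ ^ 2
        ≤ conjReal f v + τ / 2 * ‖v - q‖ ^ 2 := by
  have h : ∃ a ∈ conjDom f, ∀ v ∈ conjDom f,
      conjReal f a + τ / 2 * ‖a - q‖ ^ 2 ≤ conjReal f v + τ / 2 * ‖v - q‖ ^ 2 :=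
    exists_min_conjReal hC hf hne (ℓ := fun v => τ / 2 * ‖v - q‖ ^ 2) (by fun_prop)
  rw [dualProx, dif_pos h]
  exact h.choose_spec

theorem norm_dualProx_sub_le (hC : 0 ≤ C) (hf : ∀ u w, |f u - f w| ≤ C * ‖u - w‖)
    (hne : (conjDom f).Nonempty) (hτ : 0 < τ) (q q' : Vec m) :
    ‖dualProx f τ q - dualProx f τ q'‖ ≤ ‖q - q'‖ := by
  obtain ⟨h1, h2⟩ := dualProx_spec hC hf hne τ q
  obtain ⟨h1', h2'⟩ := dualProx_spec hC hf hne τ q'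
  simpa using prox_nonexpansive (convexOn_conjReal f) hτ h1 h1' (l := 0) (l' := 0)
    (by simpa using h2) (by simpa using h2')

theorem continuous_dualProx (hC : 0 ≤ C) (hf : ∀ u w, |f u - f w| ≤ C * ‖u - w‖)
    (hne : (conjDom f).Nonempty) (hτ : 0 < τ) : Continuous (dualProx f τ) :=
  (LipschitzWith.of_dist_le_mul (K := 1) fun q q' => by
    simpa [dist_eq_norm] using norm_dualProx_sub_le hC hf hne hτ q q').continuous

/-- Completing the square absorbs the linear term into a shift of the centre by `τ⁻¹ • g`. -/
theorem dualProx_add_min (hC : 0 ≤ C) (hf : ∀ u w, |f u - f w| ≤ C * ‖u - w‖)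
    (hne : (conjDom f).Nonempty) (hτ : 0 < τ) (y g : Vec m) :
    ∀ v ∈ conjDom f, conjReal f (dualProx f τ (y + τ⁻¹ • g)) - inner ℝ (dualProx f τ (y + τ⁻¹ • g)) g
        + τ / 2 * ‖dualProx f τ (y + τ⁻¹ • g) - y‖ ^ 2
      ≤ conjReal f v - inner ℝ v g + τ / 2 * ‖v - y‖ ^ 2 := by
  intro v hv
  have h := (dualProx_spec hC hf hne τ (y + τ⁻¹ • g)).2 v hv
  have e : ∀ w : Vec m, τ / 2 * ‖w - (y + τ⁻¹ • g)‖ ^ 2 =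
      τ / 2 * ‖w - y‖ ^ 2 - inner ℝ w g + (inner ℝ y g + τ / 2 * ‖τ⁻¹ • g‖ ^ 2) := by
    intro w
    rw [← sub_sub, norm_sub_sq_real, real_inner_smul_right, inner_sub_left]
    field_simp
    ring
  rw [e, e] at h
  linarith

/-- Nonexpansiveness for two minimizers with the same data forces distance zero. This identifies the
maximizer returned by the algorithm with a continuous function of the data. -/
theorem eq_dualProx_add (hC : 0 ≤ C) (hf : ∀ u w, |f u - f w| ≤ C * ‖u - w‖)
    (hne : (conjDom f).Nonempty) (hτ : 0 < τ) {a y g : Vec m} (ha : a ∈ conjDom f)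
    (hmin : ∀ v ∈ conjDom f, conjReal f a - inner ℝ a g + τ / 2 * ‖a - y‖ ^ 2
      ≤ conjReal f v - inner ℝ v g + τ / 2 * ‖v - y‖ ^ 2) :
    a = dualProx f τ (y + τ⁻¹ • g) := by
  have h1 := (dualProx_spec hC hf hne τ (y + τ⁻¹ • g)).1
  have h2 := dualProx_add_min hC hf hne hτ y g
  have := prox_nonexpansive (convexOn_conjReal f) hτ ha h1 (w := y) (w' := y) (l := -g) (l' := -g)
    (fun z hz => by simpa [inner_neg_left, real_inner_comm, ← sub_eq_add_neg] using hmin z hz)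
    (fun z hz => by simpa [inner_neg_left, real_inner_comm, ← sub_eq_add_neg] using h2 z hz)
  rw [sub_self, norm_zero] at this
  exact sub_eq_zero.1 (norm_le_zero_iff.1 this)

end DualProx

/-! ### The quadratic Bregman divergence -/

theorem gradient_quad {m : ℕ} (v : Vec m) : gradient quad v = v := by
  apply HasGradientAt.gradient
  rw [hasGradientAt_iff_hasFDerivAt]
  have h := ((hasStrictFDerivAt_norm_sq (F := Vec m) v).hasFDerivAt).const_mul (1 / 2 : ℝ)
  have e : InnerProductSpace.toDual ℝ (Vec m) v = (1 / 2 : ℝ) • (2 : ℕ) • innerSL ℝ v := by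
    ext w
    simp [InnerProductSpace.toDual_apply_apply]
  rw [e]
  exact h

theorem bregman_quad {m : ℕ} (u v : Vec m) : bregman quad u v = 1 / 2 * ‖u - v‖ ^ 2 := by
  rw [bregman, gradient_quad, quad, quad, norm_sub_sq_real, inner_sub_right,
    real_inner_self_eq_norm_sq, real_inner_comm]
  ring

/-! ### Assumptions in Euclidean form; convexity of the coupling term -/

namespace Problem

variable {d m n : ℕ} {Z : Type*} [MeasurableSpace Z] {p : Problem d m n Z}
  {Cf Cg σ₀ σ₁ δ μψ Lψ : ℝ}

namespace Assumptions

theorem abs_f_sub_le (h : p.Assumptions Cf Cg σ₀ σ₁ δ μψ Lψ) (hCf : 0 < Cf) (hL : 0 < Lψ)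
    (i : Fin n) (u w : Vec m) : |p.f i u - p.f i w| ≤ Cf * √Lψ * ‖u - w‖ := by
  rw [mul_assoc]
  exact (h.f_lip i u w).trans (by gcongr; exact dualNorm_le (h.norm_upper i) hL _)

theorem continuous_f (h : p.Assumptions Cf Cg σ₀ σ₁ δ μψ Lψ) (hCf : 0 < Cf) (hL : 0 < Lψ)
    (i : Fin n) : Continuous (p.f i) :=
  (LipschitzWith.of_dist_le_mul (K := (Cf * √Lψ).toNNReal) fun u w => by
    rw [dist_eq_norm, dist_eq_norm, Real.coe_toNNReal _ (by positivity)]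
    exact h.abs_f_sub_le hCf hL i u w).continuous

theorem conjDom_nonempty (h : p.Assumptions Cf Cg σ₀ σ₁ δ μψ Lψ) (hCf : 0 < Cf) (hL : 0 < Lψ)
    (i : Fin n) : (conjDom (p.f i)).Nonempty :=
  FCCO.conjDom_nonempty (h.f_convex i) (h.continuous_f hCf hL i)

theorem norm_le_of_mem_Y (h : p.Assumptions Cf Cg σ₀ σ₁ δ μψ Lψ) (hCf : 0 < Cf) (hL : 0 < Lψ)
    {i : Fin n} {v : Vec m} (hv : v ∈ p.Y i) : ‖v‖ ≤ Cf * √Lψ :=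
  norm_le_of_mem_dualDomain (by positivity) (h.abs_f_sub_le hCf hL i) hv

theorem norm_g_sub_le (h : p.Assumptions Cf Cg σ₀ σ₁ δ μψ Lψ) (hμ : 0 < μψ) (hL : 0 < Lψ)
    (i : Fin n) {x z : Vec d} (hx : x ∈ p.X) (hz : z ∈ p.X) :
    ‖p.g i x - p.g i z‖ ≤ Cg / √μψ * ‖x - z‖ := by
  have h1 := (le_dualNorm (h.norm_lower i) hμ (h.norm_upper i) hL _).trans (h.g_lip i x hx z hz)
  rw [div_mul_eq_mul_div, le_div_iff₀ (Real.sqrt_pos.2 hμ)]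
  linarith

theorem norm_meanJ_le (h : p.Assumptions Cf Cg σ₀ σ₁ δ μψ Lψ) (hμ : 0 < μψ) (hL : 0 < Lψ)
    (i : Fin n) {x : Vec d} (hx : x ∈ p.X) : ‖p.meanJ i x‖ ≤ Cg / √μψ := by
  have h1 := (le_adjointOpNorm (h.norm_lower i) hμ (h.norm_upper i) hL _).trans
    (h.meanJ_bound i x hx)
  rw [le_div_iff₀ (Real.sqrt_pos.2 hμ)]
  linarith

theorem stronglyMeasurable_g (h : p.Assumptions Cf Cg σ₀ σ₁ δ μψ Lψ) (i : Fin n) :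
    StronglyMeasurable (p.g i) := by
  have := h.prob i
  exact (h.gs_meas i).integral_prod_right

theorem stronglyMeasurable_meanJ (h : p.Assumptions Cf Cg σ₀ σ₁ δ μψ Lψ) (i : Fin n) :
    StronglyMeasurable (p.meanJ i) := by
  have := h.prob i
  exact (h.J_meas i).integral_prod_right

theorem stronglyMeasurable_gs (h : p.Assumptions Cf Cg σ₀ σ₁ δ μψ Lψ) (i : Fin n) (x : Vec d) :
    StronglyMeasurable (p.gs i x) := (h.gs_meas i).comp_measurable measurable_prodMk_left

theorem stronglyMeasurable_J (h : p.Assumptions Cf Cg σ₀ σ₁ δ μψ Lψ) (i : Fin n) (x : Vec d) :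
    StronglyMeasurable (p.J i x) := (h.J_meas i).comp_measurable measurable_prodMk_left

theorem sq_le_of_sqrt_mul_le {a b μ : ℝ} (hμ : 0 < μ) (ha : 0 ≤ a) (hab : √μ * a ≤ b) :
    a ^ 2 ≤ b ^ 2 / μ := by
  rw [le_div_iff₀ hμ]
  calc a ^ 2 * μ = (√μ * a) ^ 2 := by rw [mul_pow, Real.sq_sqrt hμ.le]; ring
    _ ≤ b ^ 2 := by gcongr

theorem gs_sq (h : p.Assumptions Cf Cg σ₀ σ₁ δ μψ Lψ) (hμ : 0 < μψ) (hL : 0 < Lψ)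
    (i : Fin n) {x : Vec d} (hx : x ∈ p.X) :
    Integrable (fun ζ => ‖p.g i x - p.gs i x ζ‖ ^ 2) (p.P i) ∧
      ∫ ζ, ‖p.g i x - p.gs i x ζ‖ ^ 2 ∂(p.P i) ≤ σ₀ ^ 2 / μψ := by
  have hle : ∀ ζ, ‖p.g i x - p.gs i x ζ‖ ^ 2 ≤ dualNorm (p.N i) (p.g i x - p.gs i x ζ) ^ 2 / μψ :=
    fun ζ => sq_le_of_sqrt_mul_le hμ (norm_nonneg _)
      (le_dualNorm (h.norm_lower i) hμ (h.norm_upper i) hL _)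
  have hi := (h.var₀_int i x hx).div_const μψ
  have hi' : Integrable (fun ζ => ‖p.g i x - p.gs i x ζ‖ ^ 2) (p.P i) :=
    hi.mono' ((stronglyMeasurable_const.sub (h.stronglyMeasurable_gs i x)).norm.pow
      2).aestronglyMeasurable
      (Filter.Eventually.of_forall fun ζ => by simpa using hle ζ)
  refine ⟨hi', (integral_mono hi' hi hle).trans ?_⟩
  rw [integral_div]
  exact div_le_div_of_nonneg_right (h.var₀ i x hx) hμ.le

theorem J_sq (h : p.Assumptions Cf Cg σ₀ σ₁ δ μψ Lψ) (hμ : 0 < μψ) (hL : 0 < Lψ)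
    (i : Fin n) {x : Vec d} (hx : x ∈ p.X) :
    Integrable (fun ζ => ‖p.J i x ζ‖ ^ 2) (p.P i) ∧
      ∫ ζ, ‖p.J i x ζ‖ ^ 2 ∂(p.P i) ≤ 2 * (Cg / √μψ) ^ 2 + 2 * (σ₁ ^ 2 / μψ) := by
  have := h.prob i
  have hle : ∀ ζ, ‖p.J i x ζ‖ ^ 2 ≤ 2 * (Cg / √μψ) ^ 2 +
      2 * (adjointOpNorm (p.N i) (p.meanJ i x - p.J i x ζ) ^ 2 / μψ) := by
    intro ζ
    have h1 := sq_le_of_sqrt_mul_le hμ (norm_nonneg _)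
      (le_adjointOpNorm (h.norm_lower i) hμ (h.norm_upper i) hL (p.meanJ i x - p.J i x ζ))
    have h2 := h.norm_meanJ_le hμ hL i hx
    have h3 : ‖p.J i x ζ‖ ≤ ‖p.meanJ i x‖ + ‖p.meanJ i x - p.J i x ζ‖ := by
      simpa using norm_sub_le (p.meanJ i x) (p.meanJ i x - p.J i x ζ)
    have h4 : ‖p.J i x ζ‖ ^ 2 ≤ (‖p.meanJ i x‖ + ‖p.meanJ i x - p.J i x ζ‖) ^ 2 := by gcongr
    have h5 : ‖p.meanJ i x‖ ^ 2 ≤ (Cg / √μψ) ^ 2 := by gcongr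
    nlinarith [sq_nonneg (‖p.meanJ i x‖ - ‖p.meanJ i x - p.J i x ζ‖)]
  have hi1 := ((h.var₁_int i x hx).div_const μψ).const_mul 2
  have hi := (integrable_const (μ := p.P i) (2 * (Cg / √μψ) ^ 2)).add hi1
  have hi' : Integrable (fun ζ => ‖p.J i x ζ‖ ^ 2) (p.P i) :=
    hi.mono' ((h.stronglyMeasurable_J i x).norm.pow 2).aestronglyMeasurable
      (Filter.Eventually.of_forall fun ζ => by simpa using hle ζ)
  refine ⟨hi', (integral_mono hi' hi hle).trans ?_⟩
  simp only [Pi.add_apply]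
  rw [integral_add (integrable_const _) hi1, integral_const_mul 2, integral_const_mul 2,
    integral_div]
  have := div_le_div_of_nonneg_right (h.var₁ i x hx) hμ.le
  simp
  linarith

theorem g_subgradient (h : p.Assumptions Cf Cg σ₀ σ₁ δ μψ Lψ) (i : Fin n) {x z : Vec d}
    (hx : x ∈ p.X) (hz : z ∈ p.X) (j : Fin m) :
    p.g i x j + p.meanJ i x (z - x) j ≤ p.g i z j := by
  have := h.prob i
  have e : ∀ w ∈ p.X, p.g i w j = ∫ ζ, p.gs i w ζ j ∂(p.P i) := fun w hw =>
    ((EuclideanSpace.proj (𝕜 := ℝ) j).integral_comp_comm (h.gs_int i w hw)).symm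
  have hJ := (h.J_int i x hx).apply_continuousLinearMap (z - x)
  have e2 : p.meanJ i x (z - x) j = ∫ ζ, p.J i x ζ (z - x) j ∂(p.P i) := by
    rw [meanJ, ContinuousLinearMap.integral_apply (h.J_int i x hx)]
    exact ((EuclideanSpace.proj (𝕜 := ℝ) j).integral_comp_comm hJ).symm
  have i1 : ∀ w ∈ p.X, Integrable (fun ζ => p.gs i w ζ j) (p.P i) := fun w hw =>
    (EuclideanSpace.proj (𝕜 := ℝ) j).integrable_comp (h.gs_int i w hw)
  have i2 : Integrable (fun ζ => p.J i x ζ (z - x) j) (p.P i) :=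
    (EuclideanSpace.proj (𝕜 := ℝ) j).integrable_comp hJ
  rw [e x hx, e z hz, e2, ← integral_add (i1 x hx) i2]
  exact integral_mono ((i1 x hx).add i2) (i1 z hz) fun ζ => h.J_subgradient i ζ x hx z hz j

/-- For a dual feasible `v`, `[gᵢ'(x)]ᵀ v` is a subgradient of `⟨v, gᵢ(·)⟩` at `x`. -/
theorem inner_g_subgradient (h : p.Assumptions Cf Cg σ₀ σ₁ δ μψ Lψ) (i : Fin n) {x z : Vec d}
    (hx : x ∈ p.X) (hz : z ∈ p.X) {v : Vec m} (hv : v ∈ conjDom (p.f i)) :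
    inner ℝ v (p.g i x) + inner ℝ (ContinuousLinearMap.adjoint (p.meanJ i x) v) (z - x)
      ≤ inner ℝ v (p.g i z) := by
  rw [ContinuousLinearMap.adjoint_inner_left, ← inner_add_right]
  rcases h.f_mono i with hm | ha
  · have : 0 ≤ inner ℝ v (p.g i z - (p.g i x + p.meanJ i x (z - x))) := by
      rw [PiLp.inner_apply]
      refine Finset.sum_nonneg fun j _ => ?_
      have h1 := nonneg_of_mem_conjDom hm hv j
      have h2 := h.g_subgradient i hx hz j
      simp only [PiLp.sub_apply, PiLp.add_apply]
      simpa using mul_nonneg (sub_nonneg.2 h2) h1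
    rw [inner_sub_right] at this
    linarith
  · rw [ha x hx z hz]

/-- Jensen's inequality, from the linearizations at the average: the deviations from it sum to zero,
so the linear terms cancel. -/
theorem inner_g_average_le (h : p.Assumptions Cf Cg σ₀ σ₁ δ μψ Lψ) (i : Fin n) {T : ℕ}
    (hT : 1 ≤ T) {x : ℕ → Vec d} (hx : ∀ t, x t ∈ p.X)
    (hxb : (1 / (T : ℝ)) • ∑ t ∈ Finset.range T, x t ∈ p.X)
    {v : Vec m} (hv : v ∈ conjDom (p.f i)) :
    T * inner ℝ v (p.g i ((1 / (T : ℝ)) • ∑ t ∈ Finset.range T, x t))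
      ≤ ∑ t ∈ Finset.range T, inner ℝ v (p.g i (x t)) := by
  have hT' : (T : ℝ) ≠ 0 := by positivity
  set xb := (1 / (T : ℝ)) • ∑ t ∈ Finset.range T, x t with hxb'
  have h1 := Finset.sum_le_sum fun t (_ : t ∈ Finset.range T) =>
    h.inner_g_subgradient i hxb (hx t) hv
  have h2 : ∑ t ∈ Finset.range T, (x t - xb) = 0 := by
    rw [Finset.sum_sub_distrib, Finset.sum_const, Finset.card_range, ← Nat.cast_smul_eq_nsmul ℝ, hxb', smul_smul,
      mul_one_div_cancel hT', one_smul, sub_self]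
  rw [Finset.sum_add_distrib, ← inner_sum (Finset.range T) (fun t => x t - xb), h2,
    inner_zero_right, add_zero] at h1
  simpa using h1

end Assumptions

end Problem


/-! ### One draw: full dual update, dual noise, stochastic gradient -/

namespace Problem

variable {d m n : ℕ} {Z : Type*} [MeasurableSpace Z]

section Defs

variable (p : Problem d m n Z) {B : ℕ}

/-- The law of the mini-batches of all blocks. -/
noncomputable def sampleLaw (p : Problem d m n Z) (B : ℕ) : Measure (Fin n → Fin B → Z) :=
  Measure.pi fun i => Measure.pi fun _ : Fin B => p.P i

/-- The dual update that would be made if block `i` were drawn. -/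
noncomputable def fullDual (τ : ℝ) (u : Vec d × (Fin n → Vec m)) (q : Draw n B Z) (i : Fin n) :
    Vec m :=
  dualProx (p.f i) τ (u.2 i + τ⁻¹ • p.gBatch i u.1 (q.2.1 i))

/-- The oracle noise together with the scaled block sampling noise. -/
noncomputable def dualNoise (S : ℕ) (τ : ℝ) (i : Fin n) (u : Vec d × (Fin n → Vec m))
    (q : Draw n B Z) : Vec m :=
  (p.g i u.1 - p.gBatch i u.1 (q.2.1 i)) + (τ * weight S i q.1) • (p.fullDual τ u q i - u.2 i)

/-- The gradient of the coupling term at the full dual update. -/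
noncomputable def gradMean (τ : ℝ) (u : Vec d × (Fin n → Vec m)) (q : Draw n B Z) : Vec d :=
  (1 / (n : ℝ)) • ∑ i, ContinuousLinearMap.adjoint (p.meanJ i u.1) (p.fullDual τ u q i)

/-- The stochastic gradient as a function of the state and the draw. -/
noncomputable def gradFull (S : ℕ) (τ : ℝ) (u : Vec d × (Fin n → Vec m)) (q : Draw n B Z) :
    Vec d :=
  p.gradEst S q.1 u.1 q.2.2 (p.fullDual τ u q)

theorem gradEst_eq (S : ℕ) (A : Finset (Fin n)) (x : Vec d) (b : Fin n → Fin B → Z)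
    (y : Fin n → Vec m) : p.gradEst S A x b y =
      (1 / (S : ℝ)) • ∑ i, incl i A • ContinuousLinearMap.adjoint (p.JBatch i x (b i)) (y i) := by
  simp [gradEst, incl, ite_smul]

end Defs

namespace Assumptions

variable {p : Problem d m n Z} {Cf Cg σ₀ σ₁ δ μψ Lψ : ℝ} {S B : ℕ} {τ : ℝ}

theorem isProbabilityMeasure_sampleLaw (h : p.Assumptions Cf Cg σ₀ σ₁ δ μψ Lψ) :
    IsProbabilityMeasure (p.sampleLaw B) := by
  have := h.prob
  unfold sampleLaw
  infer_instance

theorem isProbabilityMeasure_drawLaw (h : p.Assumptions Cf Cg σ₀ σ₁ δ μψ Lψ) (hSn : S ≤ n) :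
    IsProbabilityMeasure (p.drawLaw S B) := by
  have := isProbabilityMeasure_blockLaw hSn
  have := h.isProbabilityMeasure_sampleLaw (B := B)
  exact (inferInstance :
    IsProbabilityMeasure ((blockLaw n S).prod ((p.sampleLaw B).prod (p.sampleLaw B))))

theorem measurePreserving_dual (h : p.Assumptions Cf Cg σ₀ σ₁ δ μψ Lψ) (hSn : S ≤ n) (i : Fin n) :
    MeasurePreserving (fun q : Draw n B Z => q.2.1 i) (p.drawLaw S B)
      (Measure.pi fun _ : Fin B => p.P i) := by
  have := isProbabilityMeasure_blockLaw hSn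
  have := h.isProbabilityMeasure_sampleLaw (B := B)
  have := h.prob
  exact (measurePreserving_eval (fun i => Measure.pi fun _ : Fin B => p.P i) i).comp
    ((measurePreserving_fst (μ := p.sampleLaw B) (ν := p.sampleLaw B)).comp
      (measurePreserving_snd (μ := blockLaw n S)))

theorem measurePreserving_primal (h : p.Assumptions Cf Cg σ₀ σ₁ δ μψ Lψ) (hSn : S ≤ n)
    (i : Fin n) :
    MeasurePreserving (fun q : Draw n B Z => q.2.2 i) (p.drawLaw S B)
      (Measure.pi fun _ : Fin B => p.P i) := by
  have := isProbabilityMeasure_blockLaw hSn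
  have := h.isProbabilityMeasure_sampleLaw (B := B)
  have := h.prob
  exact (measurePreserving_eval (fun i => Measure.pi fun _ : Fin B => p.P i) i).comp
    ((measurePreserving_snd (μ := p.sampleLaw B) (ν := p.sampleLaw B)).comp
      (measurePreserving_snd (μ := blockLaw n S)))

/-! ### Joint measurability in the state and the draw -/

section Measurability

theorem stronglyMeasurable_gBatch (h : p.Assumptions Cf Cg σ₀ σ₁ δ μψ Lψ) (i : Fin n) :
    StronglyMeasurable fun w : (Vec d × (Fin n → Vec m)) × Draw n B Z =>
      p.gBatch i w.1.1 (w.2.2.1 i) := by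
  change StronglyMeasurable fun w : (Vec d × (Fin n → Vec m)) × Draw n B Z =>
    (1 / (B : ℝ)) • ∑ k, p.gs i w.1.1 (w.2.2.1 i k)
  refine StronglyMeasurable.fun_const_smul (Finset.stronglyMeasurable_fun_sum _ fun k _ => ?_) _
  have : Measurable fun w : (Vec d × (Fin n → Vec m)) × Draw n B Z => (w.1.1, w.2.2.1 i k) := by
    fun_prop
  exact (h.gs_meas i).comp_measurable this

theorem stronglyMeasurable_JBatch (h : p.Assumptions Cf Cg σ₀ σ₁ δ μψ Lψ) (i : Fin n) :
    StronglyMeasurable fun w : (Vec d × (Fin n → Vec m)) × Draw n B Z =>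
      p.JBatch i w.1.1 (w.2.2.2 i) := by
  change StronglyMeasurable fun w : (Vec d × (Fin n → Vec m)) × Draw n B Z =>
    (1 / (B : ℝ)) • ∑ k, p.J i w.1.1 (w.2.2.2 i k)
  refine StronglyMeasurable.fun_const_smul (Finset.stronglyMeasurable_fun_sum _ fun k _ => ?_) _
  have : Measurable fun w : (Vec d × (Fin n → Vec m)) × Draw n B Z => (w.1.1, w.2.2.2 i k) := by
    fun_prop
  exact (h.J_meas i).comp_measurable this

theorem stronglyMeasurable_fullDual (h : p.Assumptions Cf Cg σ₀ σ₁ δ μψ Lψ) (hCf : 0 < Cf)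
    (hL : 0 < Lψ) (hτ : 0 < τ) (i : Fin n) :
    StronglyMeasurable fun w : (Vec d × (Fin n → Vec m)) × Draw n B Z =>
      p.fullDual τ w.1 w.2 i := by
  refine (continuous_dualProx (by positivity) (h.abs_f_sub_le hCf hL i)
    (h.conjDom_nonempty hCf hL i) hτ).comp_stronglyMeasurable ?_
  refine StronglyMeasurable.add ?_ ((h.stronglyMeasurable_gBatch i).fun_const_smul _)
  have : Measurable fun w : (Vec d × (Fin n → Vec m)) × Draw n B Z => w.1.2 i := by fun_prop
  exact this.stronglyMeasurable

theorem stronglyMeasurable_weight (i : Fin n) :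
    StronglyMeasurable fun w : (Vec d × (Fin n → Vec m)) × Draw n B Z => weight S i w.2.1 := by
  have : Measurable (weight (n := n) S i) := Measurable.of_discrete
  exact (this.comp (by fun_prop)).stronglyMeasurable

theorem stronglyMeasurable_incl (i : Fin n) :
    StronglyMeasurable fun w : (Vec d × (Fin n → Vec m)) × Draw n B Z => incl i w.2.1 := by
  have : Measurable (incl i) := Measurable.of_discrete
  exact (this.comp (by fun_prop)).stronglyMeasurable

theorem stronglyMeasurable_dualDir (h : p.Assumptions Cf Cg σ₀ σ₁ δ μψ Lψ) (hCf : 0 < Cf)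
    (hL : 0 < Lψ) (hτ : 0 < τ) (i : Fin n) :
    StronglyMeasurable fun w : (Vec d × (Fin n → Vec m)) × Draw n B Z =>
      p.fullDual τ w.1 w.2 i - w.1.2 i := by
  have : Measurable fun w : (Vec d × (Fin n → Vec m)) × Draw n B Z => w.1.2 i := by fun_prop
  exact (h.stronglyMeasurable_fullDual hCf hL hτ i).sub this.stronglyMeasurable

theorem stronglyMeasurable_dualErr (h : p.Assumptions Cf Cg σ₀ σ₁ δ μψ Lψ) (i : Fin n) :
    StronglyMeasurable fun w : (Vec d × (Fin n → Vec m)) × Draw n B Z =>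
      p.g i w.1.1 - p.gBatch i w.1.1 (w.2.2.1 i) :=
  ((h.stronglyMeasurable_g i).comp_measurable (by fun_prop)).sub (h.stronglyMeasurable_gBatch i)

theorem stronglyMeasurable_dualNoise (h : p.Assumptions Cf Cg σ₀ σ₁ δ μψ Lψ) (hCf : 0 < Cf)
    (hL : 0 < Lψ) (hτ : 0 < τ) (i : Fin n) :
    StronglyMeasurable fun w : (Vec d × (Fin n → Vec m)) × Draw n B Z =>
      p.dualNoise S τ i w.1 w.2 :=
  (h.stronglyMeasurable_dualErr i).add
    (((stronglyMeasurable_weight i).const_mul τ).smul (h.stronglyMeasurable_dualDir hCf hL hτ i))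

theorem stronglyMeasurable_adjoint_apply {α : Type*} [MeasurableSpace α]
    {A : α → Vec d →L[ℝ] Vec m} {v : α → Vec m} (hA : StronglyMeasurable A)
    (hv : StronglyMeasurable v) :
    StronglyMeasurable fun w => ContinuousLinearMap.adjoint (A w) (v w) := by
  have hadj : Continuous fun A : Vec d →L[ℝ] Vec m => ContinuousLinearMap.adjoint A :=
    LinearIsometryEquiv.continuous _
  exact isBoundedBilinearMap_apply.continuous.comp_stronglyMeasurable
    ((hadj.comp_stronglyMeasurable hA).prodMk hv)

theorem stronglyMeasurable_gradMean (h : p.Assumptions Cf Cg σ₀ σ₁ δ μψ Lψ) (hCf : 0 < Cf)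
    (hL : 0 < Lψ) (hτ : 0 < τ) :
    StronglyMeasurable fun w : (Vec d × (Fin n → Vec m)) × Draw n B Z =>
      p.gradMean τ w.1 w.2 :=
  StronglyMeasurable.fun_const_smul (Finset.stronglyMeasurable_fun_sum _ fun i _ =>
    stronglyMeasurable_adjoint_apply
      ((h.stronglyMeasurable_meanJ i).comp_measurable (measurable_fst.comp measurable_fst))
      (h.stronglyMeasurable_fullDual hCf hL hτ i)) _

theorem stronglyMeasurable_gradFull (h : p.Assumptions Cf Cg σ₀ σ₁ δ μψ Lψ) (hCf : 0 < Cf)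
    (hL : 0 < Lψ) (hτ : 0 < τ) :
    StronglyMeasurable fun w : (Vec d × (Fin n → Vec m)) × Draw n B Z =>
      p.gradFull S τ w.1 w.2 := by
  simp only [gradFull, gradEst_eq]
  exact StronglyMeasurable.fun_const_smul (Finset.stronglyMeasurable_fun_sum _ fun i _ =>
    (stronglyMeasurable_incl i).smul
    (stronglyMeasurable_adjoint_apply (h.stronglyMeasurable_JBatch i)
      (h.stronglyMeasurable_fullDual hCf hL hτ i))) _

end Measurability

/-! ### Moments of the dual noise under the law of one draw -/

section Moments

theorem fullDual_mem (h : p.Assumptions Cf Cg σ₀ σ₁ δ μψ Lψ) (hCf : 0 < Cf) (hL : 0 < Lψ)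
    (u : Vec d × (Fin n → Vec m)) (q : Draw n B Z) (i : Fin n) :
    p.fullDual τ u q i ∈ conjDom (p.f i) :=
  (dualProx_spec (by positivity) (h.abs_f_sub_le hCf hL i) (h.conjDom_nonempty hCf hL i) _ _).1

theorem norm_fullDual_le (h : p.Assumptions Cf Cg σ₀ σ₁ δ μψ Lψ) (hCf : 0 < Cf) (hL : 0 < Lψ)
    (u : Vec d × (Fin n → Vec m)) (q : Draw n B Z) (i : Fin n) :
    ‖p.fullDual τ u q i‖ ≤ Cf * √Lψ :=
  norm_le_of_mem_conjDom (by positivity) (h.abs_f_sub_le hCf hL i) (h.fullDual_mem hCf hL u q i)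

theorem g_sub_gBatch (hB : 1 ≤ B) (i : Fin n) (x : Vec d) (b : Fin B → Z) :
    p.g i x - p.gBatch i x b = (1 / (B : ℝ)) • ∑ k, (p.g i x - p.gs i x (b k)) := by
  have hB' : (B : ℝ) ≠ 0 := by positivity
  rw [Finset.sum_sub_distrib, Finset.sum_const, Finset.card_univ, Fintype.card_fin,
    ← Nat.cast_smul_eq_nsmul ℝ, smul_sub, smul_smul, one_div_mul_cancel hB', one_smul, gBatch]

theorem dualErr_sq (h : p.Assumptions Cf Cg σ₀ σ₁ δ μψ Lψ) (hμ : 0 < μψ) (hL : 0 < Lψ)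
    (hSn : S ≤ n) (hB : 1 ≤ B) (i : Fin n) {x : Vec d} (hx : x ∈ p.X) :
    Integrable (fun q : Draw n B Z => ‖p.g i x - p.gBatch i x (q.2.1 i)‖ ^ 2) (p.drawLaw S B) ∧
    ∫ q : Draw n B Z, ‖p.g i x - p.gBatch i x (q.2.1 i)‖ ^ 2 ∂(p.drawLaw S B)
      ≤ σ₀ ^ 2 / μψ / B := by
  have := h.prob i
  have hmp := h.measurePreserving_dual (B := B) hSn i
  obtain ⟨h1, h2⟩ := h.gs_sq hμ hL i hx
  have hm : StronglyMeasurable fun ζ => p.g i x - p.gs i x ζ :=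
    stronglyMeasurable_const.sub (h.stronglyMeasurable_gs i x)
  have hLp := memLp_two_of_integrable_sq hm.aestronglyMeasurable h1
  have h0 : ∫ ζ, (p.g i x - p.gs i x ζ) ∂(p.P i) = 0 := by
    rw [integral_sub (integrable_const _) (h.gs_int i x hx)]
    simp [g]
  have hb := integral_norm_sq_batch hB hm.measurable hLp h0
  have hbi := integrable_sq_of_memLp (memLp_batch (B := B) hLp)
  simp only [← g_sub_gBatch hB] at hb hbi
  refine ⟨hmp.integrable_comp_of_integrable hbi, ?_⟩
  have e := integral_map (f := fun b => ‖p.g i x - p.gBatch i x b‖ ^ 2) hmp.aemeasurable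
    (by rw [hmp.map_eq]; exact hbi.aestronglyMeasurable)
  rw [hmp.map_eq] at e
  rw [← e, hb]
  gcongr

theorem integral_dualErr (h : p.Assumptions Cf Cg σ₀ σ₁ δ μψ Lψ)
    (hSn : S ≤ n) (hB : 1 ≤ B) (i : Fin n) {x : Vec d} (hx : x ∈ p.X) :
    Integrable (fun q : Draw n B Z => p.g i x - p.gBatch i x (q.2.1 i)) (p.drawLaw S B) ∧
    ∫ q : Draw n B Z, (p.g i x - p.gBatch i x (q.2.1 i)) ∂(p.drawLaw S B) = 0 := by
  have := h.prob i
  have := h.isProbabilityMeasure_drawLaw (B := B) hSn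
  have hmp := h.measurePreserving_dual (B := B) hSn i
  have hbi : Integrable (fun b : Fin B → Z => p.gBatch i x b) (Measure.pi fun _ => p.P i) :=
    integrable_batch (h.gs_int i x hx)
  have hi : Integrable (fun q : Draw n B Z => p.gBatch i x (q.2.1 i)) (p.drawLaw S B) :=
    hmp.integrable_comp_of_integrable hbi
  have e := integral_map (f := fun b => p.gBatch i x b) hmp.aemeasurable
    (by rw [hmp.map_eq]; exact hbi.aestronglyMeasurable)
  rw [hmp.map_eq] at e
  refine ⟨(integrable_const _).sub hi, ?_⟩
  rw [integral_sub (integrable_const _) hi, ← e]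
  have e2 := integral_batch (P := p.P i) hB (h.gs_int i x hx)
  simp only [gBatch]
  rw [e2]
  simp [g]

/-- The block batch is independent of the samples, so the centred weight factors out. The product
formula holds without integrability of `H`. -/
theorem integral_weight_smul (h : p.Assumptions Cf Cg σ₀ σ₁ δ μψ Lψ) (hS : 1 ≤ S)
    (hSn : S ≤ n) (i : Fin n) {E : Type*} [NormedAddCommGroup E] [NormedSpace ℝ E]
    (H : (Fin n → Fin B → Z) × (Fin n → Fin B → Z) → E) :
    ∫ q : Draw n B Z, weight S i q.1 • H q.2 ∂(p.drawLaw S B) = 0 := by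
  have := isProbabilityMeasure_blockLaw hSn
  have := h.isProbabilityMeasure_sampleLaw (B := B)
  have e := integral_prod_smul (μ := blockLaw n S) (ν := (p.sampleLaw B).prod (p.sampleLaw B))
    (weight S i) H
  rw [integral_weight i hS hSn, zero_smul] at e
  exact e

theorem integral_weight_sq_sub_mul (h : p.Assumptions Cf Cg σ₀ σ₁ δ μψ Lψ) (hS : 1 ≤ S)
    (hSn : S ≤ n) (i : Fin n) (H : (Fin n → Fin B → Z) × (Fin n → Fin B → Z) → ℝ) :
    ∫ q : Draw n B Z, (weight S i q.1 ^ 2 - ((n : ℝ) / S - 1)) * H q.2 ∂(p.drawLaw S B) = 0 := by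
  have := isProbabilityMeasure_blockLaw hSn
  have := h.isProbabilityMeasure_sampleLaw (B := B)
  have e := integral_prod_mul (μ := blockLaw n S) (ν := (p.sampleLaw B).prod (p.sampleLaw B))
    (fun A => weight S i A ^ 2 - ((n : ℝ) / S - 1)) H
  rw [integral_weight_sq i hS hSn, zero_mul] at e
  exact e

theorem abs_weight_le (i : Fin n) (A : Finset (Fin n)) : |weight S i A| ≤ 1 + (n : ℝ) / S := by
  have h0 : 0 ≤ (n : ℝ) / S := by positivity
  unfold weight incl
  rw [abs_le]
  split_ifs <;> constructor <;> linarith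

theorem integral_dualNoise (h : p.Assumptions Cf Cg σ₀ σ₁ δ μψ Lψ) (hCf : 0 < Cf) (hL : 0 < Lψ)
    (hτ : 0 < τ) (hS : 1 ≤ S) (hSn : S ≤ n) (hB : 1 ≤ B) (i : Fin n)
    {u : Vec d × (Fin n → Vec m)} (hx : u.1 ∈ p.X) :
    Integrable (fun q : Draw n B Z => p.dualNoise S τ i u q) (p.drawLaw S B) ∧
    ∫ q : Draw n B Z, p.dualNoise S τ i u q ∂(p.drawLaw S B) = 0 := by
  have := h.isProbabilityMeasure_drawLaw (B := B) hSn
  obtain ⟨h1, h2⟩ := h.integral_dualErr hSn hB i hx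
  have h3 : ∫ q : Draw n B Z, (τ * weight S i q.1) • (p.fullDual τ u q i - u.2 i)
      ∂(p.drawLaw S B) = 0 := by
    simp_rw [mul_smul]
    rw [integral_smul]
    -- Written out, the full dual update involves the samples only and not the block batch; this is
    -- why it, rather than the actual update, enters the noise.
    have := h.integral_weight_smul (B := B) hS hSn i
      (fun b => dualProx (p.f i) τ (u.2 i + τ⁻¹ • p.gBatch i u.1 (b.1 i)) - u.2 i)
    simp only [fullDual]
    rw [this, smul_zero]
  have h4 : Integrable (fun q : Draw n B Z => (τ * weight S i q.1) • (p.fullDual τ u q i - u.2 i))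
      (p.drawLaw S B) := by
    refine Integrable.of_bound ?_ (|τ| * (1 + (n : ℝ) / S) * (Cf * √Lψ + ‖u.2 i‖))
      (Filter.Eventually.of_forall fun q => ?_)
    · exact ((((stronglyMeasurable_weight i).const_mul τ).smul
        (h.stronglyMeasurable_dualDir hCf hL hτ i)).comp_measurable
          (measurable_prodMk_left (x := u))).aestronglyMeasurable
    · rw [norm_smul, norm_mul, Real.norm_eq_abs, Real.norm_eq_abs]
      gcongr
      · exact abs_weight_le i q.1
      · exact (norm_sub_le _ _).trans (by gcongr; exact h.norm_fullDual_le hCf hL u q i)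
  refine ⟨h1.add h4, ?_⟩
  simp only [dualNoise]
  rw [integral_add h1 h4, h2, h3, add_zero]

theorem JBatch_sq (h : p.Assumptions Cf Cg σ₀ σ₁ δ μψ Lψ) (hμ : 0 < μψ) (hL : 0 < Lψ)
    (hB : 1 ≤ B) (i : Fin n) {x : Vec d} (hx : x ∈ p.X) :
    Integrable (fun b : Fin B → Z => ‖p.JBatch i x b‖ ^ 2) (Measure.pi fun _ => p.P i) ∧
    ∫ b : Fin B → Z, ‖p.JBatch i x b‖ ^ 2 ∂(Measure.pi fun _ => p.P i)
      ≤ 2 * (Cg / √μψ) ^ 2 + 2 * (σ₁ ^ 2 / μψ) := by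
  have := h.prob i
  obtain ⟨h1, h2⟩ := h.J_sq hμ hL i hx
  have hLp : MemLp (p.J i x) 2 (p.P i) :=
    (memLp_two_iff_integrable_sq_norm (h.stronglyMeasurable_J i x).aestronglyMeasurable).2 h1
  have hLb := memLp_batch (B := B) hLp
  exact ⟨(memLp_two_iff_integrable_sq_norm hLb.aestronglyMeasurable).1 hLb,
    (integral_norm_sq_batch_le hB h1).trans h2⟩

theorem norm_adjoint_fullDual_le (h : p.Assumptions Cf Cg σ₀ σ₁ δ μψ Lψ) (hCf : 0 < Cf)
    (hL : 0 < Lψ) (A : Vec d →L[ℝ] Vec m) (u : Vec d × (Fin n → Vec m)) (q : Draw n B Z)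
    (i : Fin n) :
    ‖ContinuousLinearMap.adjoint A (p.fullDual τ u q i)‖ ≤ ‖A‖ * (Cf * √Lψ) := by
  refine (ContinuousLinearMap.le_opNorm _ _).trans ?_
  rw [LinearIsometryEquiv.norm_map]
  gcongr
  exact h.norm_fullDual_le hCf hL u q i

end Moments

end Assumptions

end Problem


/-! ### The stochastic gradient: second moment and unbiasedness -/

namespace Problem

namespace Assumptions

variable {d m n : ℕ} {Z : Type*} [MeasurableSpace Z]
  {p : Problem d m n Z} {Cf Cg σ₀ σ₁ δ μψ Lψ : ℝ} {S B : ℕ} {τ : ℝ}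

/-- Cauchy–Schwarz over the `S` summands replaces `1/S²` by `1/S`. With inclusion indicators of mean
`S/n`, the expected bound becomes free of `S` and `n`. -/
theorem norm_sq_gradFull_le (h : p.Assumptions Cf Cg σ₀ σ₁ δ μψ Lψ) (hCf : 0 < Cf) (hL : 0 < Lψ)
    (hS : 1 ≤ S) (u : Vec d × (Fin n → Vec m)) (q : Draw n B Z) (hq : q.1.card = S) :
    ‖p.gradFull S τ u q‖ ^ 2 ≤
      1 / (S : ℝ) * ∑ i, incl i q.1 * ((Cf * √Lψ) ^ 2 * ‖p.JBatch i u.1 (q.2.2 i)‖ ^ 2) := by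
  have hS' : (0 : ℝ) < S := by positivity
  have h1 : ∑ i, incl i q.1 * ((Cf * √Lψ) ^ 2 * ‖p.JBatch i u.1 (q.2.2 i)‖ ^ 2)
      = ∑ i ∈ q.1, (Cf * √Lψ) ^ 2 * ‖p.JBatch i u.1 (q.2.2 i)‖ ^ 2 := by
    simp [incl, Finset.sum_ite_mem]
  rw [h1, gradFull, gradEst, norm_smul, Real.norm_of_nonneg (by positivity), mul_pow]
  have h2 : ‖∑ i ∈ q.1, ContinuousLinearMap.adjoint (p.JBatch i u.1 (q.2.2 i))
      (p.fullDual τ u q i)‖ ^ 2 ≤ (∑ i ∈ q.1, ‖p.JBatch i u.1 (q.2.2 i)‖ * (Cf * √Lψ)) ^ 2 := by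
    gcongr
    exact (norm_sum_le _ _).trans
      (Finset.sum_le_sum fun i _ => h.norm_adjoint_fullDual_le hCf hL _ u q i)
  have h3 := sq_sum_le_card_mul_sum_sq (s := q.1)
    (f := fun i => ‖p.JBatch i u.1 (q.2.2 i)‖ * (Cf * √Lψ))
  rw [hq] at h3
  calc _ ≤ (1 / (S : ℝ)) ^ 2 *
        (S * ∑ i ∈ q.1, (‖p.JBatch i u.1 (q.2.2 i)‖ * (Cf * √Lψ)) ^ 2) := by
        gcongr; exact h2.trans h3
    _ = 1 / (S : ℝ) * ∑ i ∈ q.1, (‖p.JBatch i u.1 (q.2.2 i)‖ * (Cf * √Lψ)) ^ 2 := by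
        rw [← mul_assoc]; congr 1; field_simp
    _ = _ := by
        congr 1
        exact Finset.sum_congr rfl fun i _ => by ring

theorem JBatch_sq_prod (h : p.Assumptions Cf Cg σ₀ σ₁ δ μψ Lψ) (hμ : 0 < μψ) (hL : 0 < Lψ)
    (hB : 1 ≤ B) (i : Fin n) {x : Vec d} (hx : x ∈ p.X) :
    Integrable (fun b : (Fin n → Fin B → Z) × (Fin n → Fin B → Z) => ‖p.JBatch i x (b.2 i)‖ ^ 2)
      ((p.sampleLaw B).prod (p.sampleLaw B)) ∧
    ∫ b : (Fin n → Fin B → Z) × (Fin n → Fin B → Z), ‖p.JBatch i x (b.2 i)‖ ^ 2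
      ∂((p.sampleLaw B).prod (p.sampleLaw B)) ≤ 2 * (Cg / √μψ) ^ 2 + 2 * (σ₁ ^ 2 / μψ) := by
  have := h.isProbabilityMeasure_sampleLaw (B := B)
  have := h.prob
  have hmp : MeasurePreserving (fun b : (Fin n → Fin B → Z) × (Fin n → Fin B → Z) => b.2 i)
      ((p.sampleLaw B).prod (p.sampleLaw B)) (Measure.pi fun _ : Fin B => p.P i) :=
    (measurePreserving_eval (fun i => Measure.pi fun _ : Fin B => p.P i) i).comp
      (measurePreserving_snd (μ := p.sampleLaw B) (ν := p.sampleLaw B))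
  obtain ⟨h1, h2⟩ := h.JBatch_sq hμ hL hB i hx
  refine ⟨hmp.integrable_comp_of_integrable h1, ?_⟩
  have e := integral_map (f := fun b => ‖p.JBatch i x b‖ ^ 2) hmp.aemeasurable
    (by rw [hmp.map_eq]; exact h1.aestronglyMeasurable)
  rw [hmp.map_eq] at e
  rwa [← e]

theorem gradFull_sq (h : p.Assumptions Cf Cg σ₀ σ₁ δ μψ Lψ) (hCf : 0 < Cf) (hμ : 0 < μψ)
    (hL : 0 < Lψ) (hτ : 0 < τ) (hS : 1 ≤ S) (hSn : S ≤ n) (hB : 1 ≤ B)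
    {u : Vec d × (Fin n → Vec m)} (hx : u.1 ∈ p.X) :
    Integrable (fun q : Draw n B Z => ‖p.gradFull S τ u q‖ ^ 2) (p.drawLaw S B) ∧
    ∫ q : Draw n B Z, ‖p.gradFull S τ u q‖ ^ 2 ∂(p.drawLaw S B)
      ≤ (Cf * √Lψ) ^ 2 * (2 * (Cg / √μψ) ^ 2 + 2 * (σ₁ ^ 2 / μψ)) := by
  have hbl := isProbabilityMeasure_blockLaw hSn
  have := h.isProbabilityMeasure_sampleLaw (B := B)
  set C := 2 * (Cg / √μψ) ^ 2 + 2 * (σ₁ ^ 2 / μψ) with hC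
  have hi : ∀ i, Integrable (fun q : Draw n B Z =>
      incl i q.1 * ((Cf * √Lψ) ^ 2 * ‖p.JBatch i u.1 (q.2.2 i)‖ ^ 2)) (p.drawLaw S B) := fun i =>
    (integrable_blockLaw hSn (incl i)).mul_prod
      ((h.JBatch_sq_prod hμ hL hB i hx).1.const_mul ((Cf * √Lψ) ^ 2))
  have hsum : Integrable (fun q : Draw n B Z => 1 / (S : ℝ) * ∑ i, incl i q.1 *
      ((Cf * √Lψ) ^ 2 * ‖p.JBatch i u.1 (q.2.2 i)‖ ^ 2)) (p.drawLaw S B) :=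
    (integrable_finsetSum _ fun i _ => hi i).const_mul _
  -- A draw may carry any finite set of blocks; its size is `S` only almost surely.
  have hcard : ∀ᵐ q ∂(p.drawLaw S B), q.1.card = S :=
    (Measure.quasiMeasurePreserving_fst (μ := blockLaw n S)
      (ν := (p.sampleLaw B).prod (p.sampleLaw B))).ae ae_card_blockLaw
  have hle : ∀ᵐ q ∂(p.drawLaw S B), ‖p.gradFull S τ u q‖ ^ 2 ≤ 1 / (S : ℝ) * ∑ i, incl i q.1 *
      ((Cf * √Lψ) ^ 2 * ‖p.JBatch i u.1 (q.2.2 i)‖ ^ 2) :=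
    hcard.mono fun q hq => h.norm_sq_gradFull_le hCf hL hS u q hq
  have hmeas := ((h.stronglyMeasurable_gradFull (S := S) (B := B) hCf hL hτ).comp_measurable
    (measurable_prodMk_left (x := u))).norm.pow 2
  have hint : Integrable (fun q : Draw n B Z => ‖p.gradFull S τ u q‖ ^ 2) (p.drawLaw S B) :=
    hsum.mono' hmeas.aestronglyMeasurable (hle.mono fun q hq => by simpa using hq)
  refine ⟨hint, (integral_mono_ae hint hsum hle).trans ?_⟩
  rw [integral_const_mul, integral_finsetSum _ fun i _ => hi i]
  have hS' : (0 : ℝ) < S := by positivity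
  have hn' : (0 : ℝ) < n := lt_of_lt_of_le hS' (by exact_mod_cast hSn)
  have hterm : ∀ i, ∫ q : Draw n B Z, incl i q.1 *
      ((Cf * √Lψ) ^ 2 * ‖p.JBatch i u.1 (q.2.2 i)‖ ^ 2) ∂(p.drawLaw S B)
      ≤ (S : ℝ) / n * ((Cf * √Lψ) ^ 2 * C) := by
    intro i
    have e := integral_prod_mul (μ := blockLaw n S)
      (ν := (p.sampleLaw B).prod (p.sampleLaw B)) (incl i)
      (fun b => (Cf * √Lψ) ^ 2 * ‖p.JBatch i u.1 (b.2 i)‖ ^ 2)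
    rw [integral_incl i hS hSn, integral_const_mul] at e
    refine e.le.trans ?_
    gcongr
    exact (h.JBatch_sq_prod hμ hL hB i hx).2
  calc _ ≤ 1 / (S : ℝ) * ∑ i : Fin n, (S : ℝ) / n * ((Cf * √Lψ) ^ 2 * C) := by
        gcongr with i; exact hterm i
    _ = _ := by
        rw [Finset.sum_const, Finset.card_univ, Fintype.card_fin, nsmul_eq_mul]
        field_simp

/-- Inserting the mini-batch Jacobians of all blocks splits the error into a block sampling part,
centred through its weights, and an oracle part, centred through the second batch. -/
theorem gradMean_sub_gradFull (hS : 1 ≤ S) (hSn : S ≤ n) (u : Vec d × (Fin n → Vec m))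
    (q : Draw n B Z) :
    p.gradMean τ u q - p.gradFull S τ u q = (1 / (n : ℝ)) • ∑ i,
      (weight S i q.1 • ContinuousLinearMap.adjoint (p.JBatch i u.1 (q.2.2 i)) (p.fullDual τ u q i)
        + ContinuousLinearMap.adjoint (p.meanJ i u.1 - p.JBatch i u.1 (q.2.2 i))
          (p.fullDual τ u q i)) := by
  have hS' : (S : ℝ) ≠ 0 := by positivity
  have hn' : (n : ℝ) ≠ 0 := by
    have : 1 ≤ n := hS.trans hSn
    positivity
  rw [gradMean, gradFull, gradEst_eq, Finset.smul_sum, Finset.smul_sum, Finset.smul_sum,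
    ← Finset.sum_sub_distrib]
  refine Finset.sum_congr rfl fun i _ => ?_
  rw [map_sub, sub_apply, weight, smul_smul]
  have e : 1 / (S : ℝ) * incl i q.1 = 1 / n * (n / S * incl i q.1) := by field_simp
  rw [e]
  module

theorem integrable_JBatch_draw (h : p.Assumptions Cf Cg σ₀ σ₁ δ μψ Lψ) (hSn : S ≤ n) (i : Fin n)
    {x : Vec d} (hx : x ∈ p.X) :
    Integrable (fun q : Draw n B Z => p.JBatch i x (q.2.2 i)) (p.drawLaw S B) := by
  have := h.prob i
  exact (h.measurePreserving_primal hSn i).integrable_comp_of_integrable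
    (integrable_batch (h.J_int i x hx))

theorem integrable_weight_mul_inner (h : p.Assumptions Cf Cg σ₀ σ₁ δ μψ Lψ)
    (hCf : 0 < Cf) (hL : 0 < Lψ) (hτ : 0 < τ) (hSn : S ≤ n)
    {u : Vec d × (Fin n → Vec m)} (hx : u.1 ∈ p.X) (e : Vec d) (i : Fin n) :
    Integrable (fun q : Draw n B Z => weight S i q.1 *
      inner ℝ (ContinuousLinearMap.adjoint (p.JBatch i u.1 (q.2.2 i)) (p.fullDual τ u q i)) e)
      (p.drawLaw S B) := by
  have hm : StronglyMeasurable fun q : Draw n B Z => weight S i q.1 *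
      inner ℝ (ContinuousLinearMap.adjoint (p.JBatch i u.1 (q.2.2 i)) (p.fullDual τ u q i)) e :=
    ((stronglyMeasurable_weight i).mul ((stronglyMeasurable_adjoint_apply
      (h.stronglyMeasurable_JBatch i) (h.stronglyMeasurable_fullDual hCf hL hτ i)).inner
      stronglyMeasurable_const)).comp_measurable (measurable_prodMk_left (x := u))
  refine ((h.integrable_JBatch_draw hSn i hx).norm.const_mul
    ((1 + (n : ℝ) / S) * ((Cf * √Lψ) * ‖e‖))).mono' hm.aestronglyMeasurable
    (Filter.Eventually.of_forall fun q => ?_)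
  rw [norm_mul, Real.norm_eq_abs]
  have h1 := abs_weight_le (S := S) i q.1
  have h2 := norm_inner_le_norm (𝕜 := ℝ)
    (ContinuousLinearMap.adjoint (p.JBatch i u.1 (q.2.2 i)) (p.fullDual τ u q i)) e
  have h3 := h.norm_adjoint_fullDual_le (τ := τ) hCf hL (p.JBatch i u.1 (q.2.2 i)) u q i
  have h4 := h2.trans (mul_le_mul_of_nonneg_right h3 (norm_nonneg e))
  calc _ ≤ (1 + (n : ℝ) / S) * (‖p.JBatch i u.1 (q.2.2 i)‖ * (Cf * √Lψ) * ‖e‖) :=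
        mul_le_mul h1 h4 (norm_nonneg _) (by positivity)
    _ = _ := by ring

theorem integrable_inner_JBatch_error (h : p.Assumptions Cf Cg σ₀ σ₁ δ μψ Lψ)
    (hCf : 0 < Cf) (hL : 0 < Lψ) (hτ : 0 < τ) (hSn : S ≤ n)
    {u : Vec d × (Fin n → Vec m)} (hx : u.1 ∈ p.X) (e : Vec d) (i : Fin n) :
    Integrable (fun q : Draw n B Z =>
      inner ℝ (ContinuousLinearMap.adjoint (p.meanJ i u.1 - p.JBatch i u.1 (q.2.2 i))
        (p.fullDual τ u q i)) e) (p.drawLaw S B) := by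
  have hpl := h.isProbabilityMeasure_drawLaw (B := B) hSn
  have hm : StronglyMeasurable fun q : Draw n B Z =>
      inner ℝ (ContinuousLinearMap.adjoint (p.meanJ i u.1 - p.JBatch i u.1 (q.2.2 i))
        (p.fullDual τ u q i)) e :=
    (stronglyMeasurable_adjoint_apply (stronglyMeasurable_const.sub
      ((h.stronglyMeasurable_JBatch i).comp_measurable (measurable_prodMk_left (x := u))))
      ((h.stronglyMeasurable_fullDual hCf hL hτ i).comp_measurable
        (measurable_prodMk_left (x := u)))).inner stronglyMeasurable_const
  refine (((integrable_const (p.meanJ i u.1)).sub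
    (h.integrable_JBatch_draw hSn i hx)).norm.const_mul ((Cf * √Lψ) * ‖e‖)).mono'
    hm.aestronglyMeasurable (Filter.Eventually.of_forall fun q => ?_)
  have h2 := norm_inner_le_norm (𝕜 := ℝ)
    (ContinuousLinearMap.adjoint (p.meanJ i u.1 - p.JBatch i u.1 (q.2.2 i))
      (p.fullDual τ u q i)) e
  have h3 := h.norm_adjoint_fullDual_le (τ := τ) hCf hL
    (p.meanJ i u.1 - p.JBatch i u.1 (q.2.2 i)) u q i
  calc _ ≤ ‖p.meanJ i u.1 - p.JBatch i u.1 (q.2.2 i)‖ * (Cf * √Lψ) * ‖e‖ :=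
        h2.trans (mul_le_mul_of_nonneg_right h3 (norm_nonneg e))
    _ = _ := by simp only [Pi.sub_apply]; ring

theorem integral_JBatch_error (h : p.Assumptions Cf Cg σ₀ σ₁ δ μψ Lψ) (hB : 1 ≤ B) (i : Fin n)
    {x : Vec d} (hx : x ∈ p.X) :
    Integrable (fun b : Fin n → Fin B → Z => p.meanJ i x - p.JBatch i x (b i)) (p.sampleLaw B) ∧
    ∫ b : Fin n → Fin B → Z, (p.meanJ i x - p.JBatch i x (b i)) ∂(p.sampleLaw B) = 0 := by
  have hsl := h.isProbabilityMeasure_sampleLaw (B := B)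
  have hprob := h.prob
  have hmp : MeasurePreserving (fun b : (Fin n → Fin B → Z) => b i)
      (p.sampleLaw B) (Measure.pi fun _ : Fin B => p.P i) :=
    measurePreserving_eval (fun i => Measure.pi fun _ : Fin B => p.P i) i
  have hJ : Integrable (fun b : Fin B → Z => p.JBatch i x b) (Measure.pi fun _ => p.P i) :=
    integrable_batch (h.J_int i x hx)
  have hJs : Integrable (fun b : Fin n → Fin B → Z => p.JBatch i x (b i)) (p.sampleLaw B) :=
    hmp.integrable_comp_of_integrable hJ
  have hmean : ∫ b, p.JBatch i x (b i) ∂(p.sampleLaw B) = p.meanJ i x := by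
    have e := integral_map (f := fun b => p.JBatch i x b) hmp.aemeasurable
      (by rw [hmp.map_eq]; exact hJ.aestronglyMeasurable)
    rw [hmp.map_eq] at e
    rw [← e]
    exact integral_batch hB (h.J_int i x hx)
  refine ⟨(integrable_const _).sub hJs, ?_⟩
  rw [integral_sub (integrable_const _) hJs, hmean]
  simp

theorem integral_inner_JBatch_error (h : p.Assumptions Cf Cg σ₀ σ₁ δ μψ Lψ)
    (hCf : 0 < Cf) (hL : 0 < Lψ) (hτ : 0 < τ) (hSn : S ≤ n) (hB : 1 ≤ B)
    {u : Vec d × (Fin n → Vec m)} (hx : u.1 ∈ p.X) (e : Vec d) (i : Fin n) :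
    ∫ q : Draw n B Z,
      inner ℝ (ContinuousLinearMap.adjoint (p.meanJ i u.1 - p.JBatch i u.1 (q.2.2 i))
        (p.fullDual τ u q i)) e ∂(p.drawLaw S B) = 0 := by
  have hbl := isProbabilityMeasure_blockLaw hSn
  have hsl := h.isProbabilityMeasure_sampleLaw (B := B)
  let H : (Fin n → Fin B → Z) × (Fin n → Fin B → Z) → ℝ := fun b =>
    inner ℝ (ContinuousLinearMap.adjoint (p.meanJ i u.1 - p.JBatch i u.1 (b.2 i))
      (dualProx (p.f i) τ (u.2 i + τ⁻¹ • p.gBatch i u.1 (b.1 i)))) e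
  have hi2 := h.integrable_inner_JBatch_error (B := B) hCf hL hτ hSn hx e i
  have hH : Integrable H ((p.sampleLaw B).prod (p.sampleLaw B)) :=
    Integrable.of_comp_snd (μ := blockLaw n S) (f := H) hi2 (NeZero.ne _)
  have e1 : ∫ q : Draw n B Z, H q.2 ∂(p.drawLaw S B)
      = ∫ b, H b ∂((p.sampleLaw B).prod (p.sampleLaw B)) := by
    have := integral_fun_snd (μ := blockLaw n S) (ν := (p.sampleLaw B).prod (p.sampleLaw B)) H
    rw [probReal_univ, one_smul] at this
    exact this
  refine e1.trans ?_
  rw [integral_prod _ hH]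
  obtain ⟨hd, hz⟩ := h.integral_JBatch_error hB i hx
  -- With the dual batch `b` fixed the full dual update is constant, and only the independent
  -- Jacobian batch is averaged. This is the role of the second batch.
  have hin : ∀ b, ∫ b', H (b, b') ∂(p.sampleLaw B) = 0 := by
    intro b
    simp only [H, ContinuousLinearMap.adjoint_inner_left]
    have := integral_inner (𝕜 := ℝ) (hd.apply_continuousLinearMap e)
      (dualProx (p.f i) τ (u.2 i + τ⁻¹ • p.gBatch i u.1 (b i)))
    rw [this, ← ContinuousLinearMap.integral_apply hd, hz, zero_apply, inner_zero_right]
  simp_rw [hin, integral_zero]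

theorem integral_inner_gradMean_sub_gradFull (h : p.Assumptions Cf Cg σ₀ σ₁ δ μψ Lψ)
    (hCf : 0 < Cf) (hL : 0 < Lψ) (hτ : 0 < τ) (hS : 1 ≤ S) (hSn : S ≤ n)
    (hB : 1 ≤ B) {u : Vec d × (Fin n → Vec m)} (hx : u.1 ∈ p.X) (e : Vec d) :
    ∫ q : Draw n B Z, inner ℝ (p.gradMean τ u q - p.gradFull S τ u q) e ∂(p.drawLaw S B) = 0 := by
  have i1 := h.integrable_weight_mul_inner (B := B) hCf hL hτ hSn hx e
  have i2 := h.integrable_inner_JBatch_error (B := B) hCf hL hτ hSn hx e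
  have z1 : ∀ i, ∫ q : Draw n B Z, weight S i q.1 *
      inner ℝ (ContinuousLinearMap.adjoint (p.JBatch i u.1 (q.2.2 i)) (p.fullDual τ u q i)) e
      ∂(p.drawLaw S B) = 0 := fun i =>
    h.integral_weight_smul (B := B) hS hSn i (fun b =>
      inner ℝ (ContinuousLinearMap.adjoint (p.JBatch i u.1 (b.2 i))
        (dualProx (p.f i) τ (u.2 i + τ⁻¹ • p.gBatch i u.1 (b.1 i)))) e)
  have z2 := h.integral_inner_JBatch_error (B := B) hCf hL hτ hSn hB hx e
  simp_rw [gradMean_sub_gradFull hS hSn, real_inner_smul_left, sum_inner, inner_add_left,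
    real_inner_smul_left]
  rw [integral_const_mul, integral_finsetSum _ fun i _ => (i1 i).fun_add (i2 i)]
  have hsum : ∀ i, ∫ q : Draw n B Z, (weight S i q.1 *
      inner ℝ (ContinuousLinearMap.adjoint (p.JBatch i u.1 (q.2.2 i)) (p.fullDual τ u q i)) e
      + inner ℝ (ContinuousLinearMap.adjoint (p.meanJ i u.1 - p.JBatch i u.1 (q.2.2 i))
        (p.fullDual τ u q i)) e) ∂(p.drawLaw S B) = 0 := fun i => by
    rw [integral_add (i1 i) (i2 i), z1, z2, add_zero]
  rw [Finset.sum_congr rfl fun i _ => hsum i, Finset.sum_const_zero, mul_zero]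

end Assumptions

end Problem


/-! ### The iterates as measurable functions of the past draws -/

namespace Problem

variable {d m n : ℕ} {Z : Type*} [MeasurableSpace Z]

namespace Assumptions

variable {p : Problem d m n Z} {Cf Cg σ₀ σ₁ δ μψ Lψ : ℝ}

/-- The part of the domain on which the regularizer is finite. -/
def finiteDom (p : Problem d m n Z) : Set (Vec d) := {z | z ∈ p.X ∧ p.r z ≠ ⊤}

theorem coe_toReal_r (h : p.Assumptions Cf Cg σ₀ σ₁ δ μψ Lψ) {z : Vec d} (hz : z ∈ finiteDom p) :
    ((p.r z).toReal : EReal) = p.r z := EReal.coe_toReal hz.2 (h.r_ne_bot z hz.1)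

theorem convexOn_toReal_r (h : p.Assumptions Cf Cg σ₀ σ₁ δ μψ Lψ) :
    ConvexOn ℝ (finiteDom p) fun z => (p.r z).toReal := by
  have key : ∀ z ∈ finiteDom p, ∀ w ∈ finiteDom p, ∀ a b : ℝ, 0 ≤ a → 0 ≤ b → a + b = 1 →
      a • z + b • w ∈ p.X ∧
        p.r (a • z + b • w) ≤ ((a * (p.r z).toReal + b * (p.r w).toReal : ℝ) : EReal) :=
    fun z hz w hw a b ha hb hab =>
      h.r_convex (x := (z, (p.r z).toReal)) ⟨hz.1, (h.coe_toReal_r hz).ge⟩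
        (y := (w, (p.r w).toReal)) ⟨hw.1, (h.coe_toReal_r hw).ge⟩ ha hb hab
  have hmem : Convex ℝ (finiteDom p) := fun z hz w hw a b ha hb hab =>
    ⟨(key z hz w hw a b ha hb hab).1,
      ((key z hz w hw a b ha hb hab).2.trans_lt (EReal.coe_lt_top _)).ne⟩
  refine ⟨hmem, fun z hz w hw a b ha hb hab => ?_⟩
  have := (key z hz w hw a b ha hb hab).2
  rw [← h.coe_toReal_r (hmem hz hw ha hb hab)] at this
  exact EReal.coe_le_coe_iff.1 this

theorem isArgmin_prox (h : p.Assumptions Cf Cg σ₀ σ₁ δ μψ Lψ) {ℓ : Vec d → ℝ} {a : Vec d}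
    (ha : IsArgmin (fun z => (ℓ z : EReal) + p.r z) p.X a) :
    a ∈ finiteDom p ∧ ∀ z ∈ finiteDom p, (p.r a).toReal + ℓ a ≤ (p.r z).toReal + ℓ z := by
  have hle : ∀ z ∈ p.X, (ℓ a : EReal) + p.r a ≤ (ℓ z : EReal) + p.r z := fun z hz => ha.2 hz
  have haf : a ∈ finiteDom p := by
    refine ⟨ha.1, fun htop => ?_⟩
    obtain ⟨z, hz, hzt⟩ := h.r_proper
    have := hle z hz
    rw [htop, EReal.coe_add_top, top_le_iff, ← h.coe_toReal_r ⟨hz, hzt⟩, ← EReal.coe_add] at this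
    exact EReal.coe_ne_top _ this
  refine ⟨haf, fun z hz => ?_⟩
  have := hle z hz.1
  rw [← h.coe_toReal_r haf, ← h.coe_toReal_r hz, ← EReal.coe_add, ← EReal.coe_add,
    EReal.coe_le_coe_iff] at this
  linarith

end Assumptions

/-- A run of ALEXR with quadratic distance-generating functions and no extrapolation. -/
structure Run (p : Problem d m n Z) (Cf Cg σ₀ σ₁ δ μψ Lψ : ℝ) (S B : ℕ) (η τ : ℝ)
    (x₀ : Vec d) (y₀ : Fin n → Vec m) {Ω : Type*} [MeasurableSpace Ω] (Pr : Measure Ω)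
    (ξ : ℕ → Ω → Draw n B Z) (x : ℕ → Ω → Vec d) (y : ℕ → Ω → Fin n → Vec m) : Prop where
  asm : p.Assumptions Cf Cg σ₀ σ₁ δ μψ Lψ
  Cf_pos : 0 < Cf
  μ_pos : 0 < μψ
  L_pos : 0 < Lψ
  S_pos : 1 ≤ S
  S_le : S ≤ n
  B_pos : 1 ≤ B
  η_pos : 0 < η
  τ_pos : 0 < τ
  x₀_mem : x₀ ∈ p.X
  y₀_mem : ∀ i, y₀ i ∈ p.Y i
  sampling : p.IsSampling S B Pr ξ
  alexr : p.IsALEXR S B (fun _ => quad) 0 η τ x₀ y₀ ξ x y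

namespace Run

variable {p : Problem d m n Z} {Cf Cg σ₀ σ₁ δ μψ Lψ : ℝ} {S B : ℕ} {η τ : ℝ} {x₀ : Vec d}
  {y₀ : Fin n → Vec m} {Ω : Type*} [MeasurableSpace Ω] {Pr : Measure Ω}
  {ξ : ℕ → Ω → Draw n B Z} {x : ℕ → Ω → Vec d} {y : ℕ → Ω → Fin n → Vec m}

theorem x_mem (R : Run p Cf Cg σ₀ σ₁ δ μψ Lψ S B η τ x₀ y₀ Pr ξ x y) (t : ℕ) (ω : Ω) :
    x t ω ∈ p.X := by
  cases t with
  | zero => rw [R.alexr.x_zero]; exact R.x₀_mem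
  | succ t => exact (R.alexr.primal_step t ω).1

/-- The algorithm's dual step is the full update masked by inclusion: on a drawn block, uniqueness
of the proximal point applies. -/
theorem y_succ (R : Run p Cf Cg σ₀ σ₁ δ μψ Lψ S B η τ x₀ y₀ Pr ξ x y) (t : ℕ) (ω : Ω)
    (i : Fin n) : y (t + 1) ω i = y t ω i + incl i (ξ t ω).1 •
      (p.fullDual τ (x t ω, y t ω) (ξ t ω) i - y t ω i) := by
  unfold incl
  split_ifs with hi
  · obtain ⟨h1, h2⟩ := isArgmax_conj (R.asm.conjDom_nonempty R.Cf_pos R.L_pos i)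
      (R.alexr.dual_step t ω i hi)
    rw [one_smul, add_sub_cancel]
    have hC : 0 ≤ Cf * √Lψ := mul_nonneg R.Cf_pos.le (Real.sqrt_nonneg _)
    refine eq_dualProx_add hC (R.asm.abs_f_sub_le R.Cf_pos R.L_pos i)
      (R.asm.conjDom_nonempty R.Cf_pos R.L_pos i) R.τ_pos h1 fun v hv => ?_
    have := h2 v hv
    simp only [extrap, zero_smul, add_zero, bregman_quad] at this
    linarith
  · rw [zero_smul, add_zero]; exact R.alexr.dual_stay t ω i hi

theorem y_mem (R : Run p Cf Cg σ₀ σ₁ δ μψ Lψ S B η τ x₀ y₀ Pr ξ x y) (t : ℕ) (ω : Ω)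
    (i : Fin n) : y t ω i ∈ p.Y i := by
  induction t with
  | zero => rw [R.alexr.y_zero]; exact R.y₀_mem i
  | succ t ih =>
    by_cases hi : i ∈ (ξ t ω).1
    · exact (R.alexr.dual_step t ω i hi).1
    · rw [R.alexr.dual_stay t ω i hi]; exact ih

theorem norm_y_le (R : Run p Cf Cg σ₀ σ₁ δ μψ Lψ S B η τ x₀ y₀ Pr ξ x y) (t : ℕ) (ω : Ω)
    (i : Fin n) : ‖y t ω i‖ ≤ Cf * √Lψ :=
  R.asm.norm_le_of_mem_Y R.Cf_pos R.L_pos (R.y_mem t ω i)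

theorem gradEst_eq_gradFull (R : Run p Cf Cg σ₀ σ₁ δ μψ Lψ S B η τ x₀ y₀ Pr ξ x y) (t : ℕ)
    (ω : Ω) : p.gradEst S (ξ t ω).1 (x t ω) (ξ t ω).2.2 (y (t + 1) ω) =
      p.gradFull S τ (x t ω, y t ω) (ξ t ω) := by
  unfold gradFull gradEst
  congr 1
  refine Finset.sum_congr rfl fun i hi => ?_
  rw [R.y_succ, incl, if_pos hi, one_smul, add_sub_cancel]

theorem primal_min (R : Run p Cf Cg σ₀ σ₁ δ μψ Lψ S B η τ x₀ y₀ Pr ξ x y) (t : ℕ) (ω : Ω) :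
    x (t + 1) ω ∈ Assumptions.finiteDom p ∧ ∀ z ∈ Assumptions.finiteDom p,
      (p.r (x (t + 1) ω)).toReal + inner ℝ (p.gradFull S τ (x t ω, y t ω) (ξ t ω)) (x (t + 1) ω)
        + η / 2 * ‖x (t + 1) ω - x t ω‖ ^ 2
      ≤ (p.r z).toReal + inner ℝ (p.gradFull S τ (x t ω, y t ω) (ξ t ω)) z
        + η / 2 * ‖z - x t ω‖ ^ 2 := by
  have h := R.alexr.primal_step t ω
  rw [R.gradEst_eq_gradFull] at h
  obtain ⟨h1, h2⟩ := R.asm.isArgmin_prox h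
  exact ⟨h1, fun z hz => by linarith [h2 z hz]⟩

theorem primal_three_point (R : Run p Cf Cg σ₀ σ₁ δ μψ Lψ S B η τ x₀ y₀ Pr ξ x y) (t : ℕ)
    (ω : Ω) {z : Vec d} (hz : z ∈ Assumptions.finiteDom p) :
      (p.r (x (t + 1) ω)).toReal + inner ℝ (p.gradFull S τ (x t ω, y t ω) (ξ t ω)) (x (t + 1) ω)
        + η / 2 * ‖x (t + 1) ω - x t ω‖ ^ 2 + η / 2 * ‖z - x (t + 1) ω‖ ^ 2
      ≤ (p.r z).toReal + inner ℝ (p.gradFull S τ (x t ω, y t ω) (ξ t ω)) z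
        + η / 2 * ‖z - x t ω‖ ^ 2 := by
  obtain ⟨h1, h2⟩ := R.primal_min t ω
  exact prox_three_point (R.asm.convexOn_toReal_r.add
    ((innerₛₗ ℝ (p.gradFull S τ (x t ω, y t ω) (ξ t ω))).convexOn R.asm.convexOn_toReal_r.1))
    h1 h2 hz

/-- The primal minimizer is given only along the trajectory. Nonexpansiveness still makes it a
Lipschitz function of the shifted centre, which yields both its measurability and its square
integrability. -/
theorem exists_lipschitz_primal (R : Run p Cf Cg σ₀ σ₁ δ μψ Lψ S B η τ x₀ y₀ Pr ξ x y) (t : ℕ) :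
    ∃ (K : NNReal) (φ : Vec d → Vec d), LipschitzWith K φ ∧ ∀ ω, x (t + 1) ω =
      φ (x t ω - η⁻¹ • p.gradFull S τ (x t ω, y t ω) (ξ t ω)) :=
  exists_lipschitz_factor (q := fun ω => x t ω - η⁻¹ • p.gradFull S τ (x t ω, y t ω) (ξ t ω))
    fun ω ω' => prox_nonexpansive R.asm.convexOn_toReal_r R.η_pos (R.primal_min t ω).1
      (R.primal_min t ω').1 (R.primal_min t ω).2 (R.primal_min t ω').2

/-- The state at time `t` depends on the draws before `t` only, hence is independent of the draw at
time `t`. -/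
theorem measurable_state (R : Run p Cf Cg σ₀ σ₁ δ μψ Lψ S B η τ x₀ y₀ Pr ξ x y) (t : ℕ) :
    Measurable[past ξ t] fun ω => (x t ω, y t ω) := by
  induction t with
  | zero =>
    have : (fun ω => (x 0 ω, y 0 ω)) = fun _ => (x₀, y₀) := by
      ext1 ω; rw [R.alexr.x_zero, R.alexr.y_zero]
    rw [this]
    exact measurable_const
  | succ t ih =>
    have ih' : Measurable[past ξ (t + 1)] fun ω => (x t ω, y t ω) :=
      ih.mono (past_mono t.le_succ) le_rfl
    have hp : Measurable[past ξ (t + 1)] fun ω => ((x t ω, y t ω), ξ t ω) :=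
      ih'.prodMk (measurable_past ξ t.lt_succ_self)
    have hx : Measurable[past ξ (t + 1)] (x (t + 1)) := by
      obtain ⟨K, φ, hφ, he⟩ := R.exists_lipschitz_primal t
      have : x (t + 1) = fun ω => φ (x t ω - η⁻¹ • p.gradFull S τ (x t ω, y t ω) (ξ t ω)) :=
        funext he
      rw [this]
      have hG := (R.asm.stronglyMeasurable_gradFull (S := S) (B := B) R.Cf_pos R.L_pos
        R.τ_pos).measurable.comp hp
      exact hφ.continuous.measurable.comp ((measurable_fst.comp ih').sub (hG.fun_const_smul _))
    have hy : Measurable[past ξ (t + 1)] (y (t + 1)) := by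
      refine (@measurable_pi_iff _ _ _ (past ξ (t + 1)) _ _).2 fun i => ?_
      have : (fun ω => y (t + 1) ω i) = fun ω => y t ω i + incl i (ξ t ω).1 •
          (p.fullDual τ (x t ω, y t ω) (ξ t ω) i - y t ω i) := funext fun ω => R.y_succ t ω i
      rw [this]
      have hyi : Measurable[past ξ (t + 1)] fun ω => y t ω i :=
        (measurable_pi_apply i).comp (measurable_snd.comp ih')
      have hd := (R.asm.stronglyMeasurable_dualDir (B := B) R.Cf_pos R.L_pos
        R.τ_pos i).measurable.comp hp
      have hi := (Assumptions.stronglyMeasurable_incl (B := B) (m := m) (d := d) (Z := Z)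
        i).measurable.comp hp
      exact hyi.add (hi.smul hd)
    exact hx.prodMk hy

theorem integral_fresh (R : Run p Cf Cg σ₀ σ₁ δ μψ Lψ S B η τ x₀ y₀ Pr ξ x y)
    [IsProbabilityMeasure Pr] {α E : Type*} [MeasurableSpace α] [NormedAddCommGroup E]
    [NormedSpace ℝ E] (t : ℕ) {U : Ω → α} (hU : Measurable[past ξ t] U)
    {φ : α → Draw n B Z → E} (hφ : StronglyMeasurable (Function.uncurry φ))
    (h0 : ∀ ω, ∫ q, φ (U ω) q ∂(p.drawLaw S B) = 0) :
    ∫ ω, φ (U ω) (ξ t ω) ∂Pr = 0 :=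
  integral_fresh_eq_zero R.sampling.meas R.sampling.indep hU hφ
    (by rw [R.sampling.law t]; exact h0)

theorem measurable_pair (R : Run p Cf Cg σ₀ σ₁ δ μψ Lψ S B η τ x₀ y₀ Pr ξ x y) (t : ℕ) :
    Measurable fun ω => ((x t ω, y t ω), ξ t ω) :=
  ((R.measurable_state t).mono (past_le R.sampling.meas t) le_rfl).prodMk (R.sampling.meas t)

theorem stronglyMeasurable_noise (R : Run p Cf Cg σ₀ σ₁ δ μψ Lψ S B η τ x₀ y₀ Pr ξ x y)
    (t : ℕ) (i : Fin n) :
    StronglyMeasurable fun ω => p.dualNoise S τ i (x t ω, y t ω) (ξ t ω) :=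
  (R.asm.stronglyMeasurable_dualNoise R.Cf_pos R.L_pos R.τ_pos i).comp_measurable
    (R.measurable_pair t)

end Run

end Problem


/-! ### Moments along the trajectory; orthogonality of the dual noises -/

namespace Problem

namespace Run

variable {d m n : ℕ} {Z : Type*} [MeasurableSpace Z]
  {p : Problem d m n Z} {Cf Cg σ₀ σ₁ δ μψ Lψ : ℝ} {S B : ℕ} {η τ : ℝ} {x₀ : Vec d}
  {y₀ : Fin n → Vec m} {Ω : Type*} [MeasurableSpace Ω] {Pr : Measure Ω}
  {ξ : ℕ → Ω → Draw n B Z} {x : ℕ → Ω → Vec d} {y : ℕ → Ω → Fin n → Vec m}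

theorem norm_dir_le (R : Run p Cf Cg σ₀ σ₁ δ μψ Lψ S B η τ x₀ y₀ Pr ξ x y) (t : ℕ) (ω : Ω)
    (i : Fin n) : ‖p.fullDual τ (x t ω, y t ω) (ξ t ω) i - y t ω i‖ ≤ 2 * (Cf * √Lψ) := by
  have h1 := R.asm.norm_fullDual_le (τ := τ) R.Cf_pos R.L_pos (x t ω, y t ω) (ξ t ω) i
  have h2 := R.norm_y_le t ω i
  linarith [norm_sub_le (p.fullDual τ (x t ω, y t ω) (ξ t ω) i) (y t ω i)]

theorem stronglyMeasurable_dir (R : Run p Cf Cg σ₀ σ₁ δ μψ Lψ S B η τ x₀ y₀ Pr ξ x y)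
    (t : ℕ) (i : Fin n) :
    StronglyMeasurable fun ω => p.fullDual τ (x t ω, y t ω) (ξ t ω) i - y t ω i := by
  have := (R.asm.stronglyMeasurable_dualDir (B := B) R.Cf_pos R.L_pos R.τ_pos i).comp_measurable
    (R.measurable_pair t)
  exact this

theorem stronglyMeasurable_wt (R : Run p Cf Cg σ₀ σ₁ δ μψ Lψ S B η τ x₀ y₀ Pr ξ x y)
    (t : ℕ) (i : Fin n) : StronglyMeasurable fun ω => weight S i (ξ t ω).1 :=
  (Assumptions.stronglyMeasurable_weight (d := d) (m := m) i).comp_measurable (R.measurable_pair t)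

theorem norm_sq_dualNoise_le (p : Problem d m n Z) (S : ℕ) (τ : ℝ) (i : Fin n)
    (u : Vec d × (Fin n → Vec m)) (q : Draw n B Z) : ‖p.dualNoise S τ i u q‖ ^ 2 ≤
      2 * ‖p.g i u.1 - p.gBatch i u.1 (q.2.1 i)‖ ^ 2 + 2 * τ ^ 2 *
      (weight S i q.1 ^ 2 * ‖p.fullDual τ u q i - u.2 i‖ ^ 2) := by
  unfold dualNoise
  set a := p.g i u.1 - p.gBatch i u.1 (q.2.1 i)
  set e := (τ * weight S i q.1) • (p.fullDual τ u q i - u.2 i) with he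
  have h1 : ‖e‖ ^ 2 = τ ^ 2 * (weight S i q.1 ^ 2 * ‖p.fullDual τ u q i - u.2 i‖ ^ 2) := by
    rw [he, norm_smul, mul_pow, Real.norm_eq_abs, sq_abs]; ring
  have h2 : ‖a + e‖ ^ 2 ≤ (‖a‖ + ‖e‖) ^ 2 := by gcongr; exact norm_add_le a e
  rw [mul_assoc 2, ← h1]
  linarith [add_sq_le (a := ‖a‖) (b := ‖e‖)]

theorem measurable_noise_past (R : Run p Cf Cg σ₀ σ₁ δ μψ Lψ S B η τ x₀ y₀ Pr ξ x y)
    {s t : ℕ} (hst : s < t) (i : Fin n) :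
    Measurable[past ξ t] fun ω => p.dualNoise S τ i (x s ω, y s ω) (ξ s ω) :=
  (R.asm.stronglyMeasurable_dualNoise R.Cf_pos R.L_pos R.τ_pos i).measurable.comp
    (((R.measurable_state s).mono (past_mono hst.le) le_rfl).prodMk (measurable_past ξ hst))

theorem stronglyMeasurable_grad (R : Run p Cf Cg σ₀ σ₁ δ μψ Lψ S B η τ x₀ y₀ Pr ξ x y) (t : ℕ) :
    StronglyMeasurable fun ω => p.gradFull S τ (x t ω, y t ω) (ξ t ω) := by
  have := (R.asm.stronglyMeasurable_gradFull (S := S) (B := B) R.Cf_pos R.L_pos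
    R.τ_pos).comp_measurable (R.measurable_pair t)
  exact this

variable [IsProbabilityMeasure Pr]

theorem integrable_fresh (R : Run p Cf Cg σ₀ σ₁ δ μψ Lψ S B η τ x₀ y₀ Pr ξ x y)
    {α : Type*} [MeasurableSpace α] (t : ℕ) {U : Ω → α} (hU : Measurable[past ξ t] U)
    {φ : α → Draw n B Z → ℝ} (hφ : StronglyMeasurable (Function.uncurry φ))
    (hn : ∀ u q, 0 ≤ φ u q) {c : ℝ}
    (h : ∀ ω, Integrable (φ (U ω)) (p.drawLaw S B) ∧ ∫ q, φ (U ω) q ∂(p.drawLaw S B) ≤ c) :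
    Integrable (fun ω => φ (U ω) (ξ t ω)) Pr ∧ ∫ ω, φ (U ω) (ξ t ω) ∂Pr ≤ c :=
  integrable_fresh_of_le R.sampling.meas R.sampling.indep hU hφ hn
    (by rw [R.sampling.law t]; exact fun ω => (h ω).1)
    (by rw [R.sampling.law t]; exact fun ω => (h ω).2)

theorem err_sq (R : Run p Cf Cg σ₀ σ₁ δ μψ Lψ S B η τ x₀ y₀ Pr ξ x y) (t : ℕ) (i : Fin n) :
    Integrable (fun ω => ‖p.g i (x t ω) - p.gBatch i (x t ω) ((ξ t ω).2.1 i)‖ ^ 2) Pr ∧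
    ∫ ω, ‖p.g i (x t ω) - p.gBatch i (x t ω) ((ξ t ω).2.1 i)‖ ^ 2 ∂Pr ≤ σ₀ ^ 2 / μψ / B :=
  R.integrable_fresh t (R.measurable_state t)
    (φ := fun u q => ‖p.g i u.1 - p.gBatch i u.1 (q.2.1 i)‖ ^ 2)
    ((R.asm.stronglyMeasurable_dualErr i).norm.pow 2) (fun _ _ => by positivity)
    fun ω => R.asm.dualErr_sq R.μ_pos R.L_pos R.S_le R.B_pos i (R.x_mem t ω)

theorem grad_sq (R : Run p Cf Cg σ₀ σ₁ δ μψ Lψ S B η τ x₀ y₀ Pr ξ x y) (t : ℕ) :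
    Integrable (fun ω => ‖p.gradFull S τ (x t ω, y t ω) (ξ t ω)‖ ^ 2) Pr ∧
    ∫ ω, ‖p.gradFull S τ (x t ω, y t ω) (ξ t ω)‖ ^ 2 ∂Pr
      ≤ (Cf * √Lψ) ^ 2 * (2 * (Cg / √μψ) ^ 2 + 2 * (σ₁ ^ 2 / μψ)) :=
  R.integrable_fresh t (R.measurable_state t) (φ := fun u q => ‖p.gradFull S τ u q‖ ^ 2)
    ((R.asm.stronglyMeasurable_gradFull R.Cf_pos R.L_pos R.τ_pos).norm.pow 2)
    (fun _ _ => by positivity)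
    fun ω => R.asm.gradFull_sq R.Cf_pos R.μ_pos R.L_pos R.τ_pos R.S_pos R.S_le R.B_pos
      (R.x_mem t ω)

theorem integrable_wt_mul_dir_sq (R : Run p Cf Cg σ₀ σ₁ δ μψ Lψ S B η τ x₀ y₀ Pr ξ x y)
    (t : ℕ) (i : Fin n) (k : ℕ) :
    Integrable (fun ω => weight S i (ξ t ω).1 ^ k *
      ‖p.fullDual τ (x t ω, y t ω) (ξ t ω) i - y t ω i‖ ^ 2) Pr := by
  refine Integrable.of_bound (((R.stronglyMeasurable_wt t i).pow k).mul
    ((R.stronglyMeasurable_dir t i).norm.pow 2)).aestronglyMeasurable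
    ((1 + (n : ℝ) / S) ^ k * (2 * (Cf * √Lψ)) ^ 2) (Filter.Eventually.of_forall fun ω => ?_)
  rw [norm_mul, norm_pow, norm_pow, norm_norm, Real.norm_eq_abs]
  have h1 := Assumptions.abs_weight_le (S := S) i (ξ t ω).1
  have h2 := R.norm_dir_le t ω i
  gcongr

theorem integrable_dir_sq (R : Run p Cf Cg σ₀ σ₁ δ μψ Lψ S B η τ x₀ y₀ Pr ξ x y)
    (t : ℕ) (i : Fin n) :
    Integrable (fun ω => ‖p.fullDual τ (x t ω, y t ω) (ξ t ω) i - y t ω i‖ ^ 2) Pr := by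
  simpa using R.integrable_wt_mul_dir_sq t i 0

theorem integral_wt_mul_dir_sq (R : Run p Cf Cg σ₀ σ₁ δ μψ Lψ S B η τ x₀ y₀ Pr ξ x y)
    (t : ℕ) (i : Fin n) :
    ∫ ω, weight S i (ξ t ω).1 *
      ‖p.fullDual τ (x t ω, y t ω) (ξ t ω) i - y t ω i‖ ^ 2 ∂Pr = 0 :=
  R.integral_fresh t (R.measurable_state t)
    (φ := fun u q => weight S i q.1 * ‖p.fullDual τ u q i - u.2 i‖ ^ 2)
    ((Assumptions.stronglyMeasurable_weight i).mul
      ((R.asm.stronglyMeasurable_dualDir R.Cf_pos R.L_pos R.τ_pos i).norm.pow 2))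
    fun ω => R.asm.integral_weight_smul R.S_pos R.S_le i fun b =>
      ‖dualProx (p.f i) τ (y t ω i + τ⁻¹ • p.gBatch i (x t ω) (b.1 i)) - y t ω i‖ ^ 2

/-- Given the past and the samples, the squared weight averages to `n/S - 1`, here relaxed to `n/S`.
-/
theorem integral_wt_sq_mul_dir_sq (R : Run p Cf Cg σ₀ σ₁ δ μψ Lψ S B η τ x₀ y₀ Pr ξ x y)
    (t : ℕ) (i : Fin n) :
    ∫ ω, weight S i (ξ t ω).1 ^ 2 *
      ‖p.fullDual τ (x t ω, y t ω) (ξ t ω) i - y t ω i‖ ^ 2 ∂Pr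
    ≤ (n : ℝ) / S * ∫ ω, ‖p.fullDual τ (x t ω, y t ω) (ξ t ω) i - y t ω i‖ ^ 2 ∂Pr := by
  have h0 : ∫ ω, (weight S i (ξ t ω).1 ^ 2 - ((n : ℝ) / S - 1)) *
      ‖p.fullDual τ (x t ω, y t ω) (ξ t ω) i - y t ω i‖ ^ 2 ∂Pr = 0 :=
    R.integral_fresh t (R.measurable_state t)
      (φ := fun u q => (weight S i q.1 ^ 2 - ((n : ℝ) / S - 1)) * ‖p.fullDual τ u q i - u.2 i‖ ^ 2)
      ((((Assumptions.stronglyMeasurable_weight i).pow 2).sub stronglyMeasurable_const).mul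
        ((R.asm.stronglyMeasurable_dualDir R.Cf_pos R.L_pos R.τ_pos i).norm.pow 2))
      fun ω => R.asm.integral_weight_sq_sub_mul R.S_pos R.S_le i fun b =>
        ‖dualProx (p.f i) τ (y t ω i + τ⁻¹ • p.gBatch i (x t ω) (b.1 i)) - y t ω i‖ ^ 2
  simp_rw [sub_mul] at h0
  rw [integral_sub (R.integrable_wt_mul_dir_sq t i 2) (by
    have := (R.integrable_dir_sq t i).const_mul ((n : ℝ) / S - 1)
    simpa only [sub_mul] using this)] at h0
  have h1 := R.integrable_dir_sq t i
  rw [integral_sub (h1.const_mul _) (h1.const_mul _), integral_const_mul, integral_const_mul,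
    one_mul] at h0
  have h2 : 0 ≤ ∫ ω, ‖p.fullDual τ (x t ω, y t ω) (ξ t ω) i - y t ω i‖ ^ 2 ∂Pr :=
    integral_nonneg fun ω => by positivity
  linarith

theorem memLp_noise (R : Run p Cf Cg σ₀ σ₁ δ μψ Lψ S B η τ x₀ y₀ Pr ξ x y) (t : ℕ) (i : Fin n) :
    MemLp (fun ω => p.dualNoise S τ i (x t ω, y t ω) (ξ t ω)) 2 Pr := by
  have hm := R.stronglyMeasurable_noise t i
  refine memLp_two_of_integrable_sq hm.aestronglyMeasurable ?_
  refine (((R.err_sq t i).1.const_mul 2).add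
    ((R.integrable_wt_mul_dir_sq t i 2).const_mul (2 * τ ^ 2))).mono'
    (hm.norm.pow 2).aestronglyMeasurable (Filter.Eventually.of_forall fun ω => ?_)
  simpa using norm_sq_dualNoise_le p S τ i (x t ω, y t ω) (ξ t ω)

theorem integral_noise_sq (R : Run p Cf Cg σ₀ σ₁ δ μψ Lψ S B η τ x₀ y₀ Pr ξ x y) (t : ℕ)
    (i : Fin n) : ∫ ω, ‖p.dualNoise S τ i (x t ω, y t ω) (ξ t ω)‖ ^ 2 ∂Pr ≤
      2 * (σ₀ ^ 2 / μψ / B) + 2 * τ ^ 2 * ((n : ℝ) / S *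
        ∫ ω, ‖p.fullDual τ (x t ω, y t ω) (ξ t ω) i - y t ω i‖ ^ 2 ∂Pr) := by
  have i1 := (R.err_sq t i).1.const_mul 2
  have i2 := (R.integrable_wt_mul_dir_sq t i 2).const_mul (2 * τ ^ 2)
  refine (integral_mono (integrable_sq_of_memLp (R.memLp_noise t i)) (i1.add i2)
    fun ω => norm_sq_dualNoise_le p S τ i (x t ω, y t ω) (ξ t ω)).trans ?_
  simp only [Pi.add_apply]
  rw [integral_add i1 i2, integral_const_mul, integral_const_mul]
  have := (R.err_sq t i).2
  have h3 := R.integral_wt_sq_mul_dir_sq t i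
  gcongr

/-- The martingale difference property. It removes the pairing with `y₀ - y_t` and, for two times,
gives orthogonality. -/
theorem integral_inner_noise_eq_zero (R : Run p Cf Cg σ₀ σ₁ δ μψ Lψ S B η τ x₀ y₀ Pr ξ x y)
    (t : ℕ) (i : Fin n) {V : Ω → Vec m} (hV : Measurable[past ξ t] V) :
    ∫ ω, inner ℝ (V ω) (p.dualNoise S τ i (x t ω, y t ω) (ξ t ω)) ∂Pr = 0 := by
  have hφ : StronglyMeasurable (Function.uncurry
      fun (u : Vec m × (Vec d × (Fin n → Vec m))) (q : Draw n B Z) =>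
        (inner ℝ u.1 (p.dualNoise S τ i u.2 q) : ℝ)) := by
    have h1 : Measurable fun w : (Vec m × (Vec d × (Fin n → Vec m))) × Draw n B Z => w.1.1 := by
      fun_prop
    have h2 : Measurable fun w : (Vec m × (Vec d × (Fin n → Vec m))) × Draw n B Z =>
        (w.1.2, w.2) := by fun_prop
    exact h1.stronglyMeasurable.inner
      ((R.asm.stronglyMeasurable_dualNoise R.Cf_pos R.L_pos R.τ_pos i).comp_measurable h2)
  refine R.integral_fresh t (U := fun ω => (V ω, (x t ω, y t ω))) (hV.prodMk (R.measurable_state t))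
    hφ fun ω => ?_
  obtain ⟨h1, h2⟩ := R.asm.integral_dualNoise R.Cf_pos R.L_pos R.τ_pos R.S_pos R.S_le R.B_pos i
    (u := (x t ω, y t ω)) (R.x_mem t ω)
  rw [integral_inner h1, h2, inner_zero_right]

theorem integral_inner_noise_noise (R : Run p Cf Cg σ₀ σ₁ δ μψ Lψ S B η τ x₀ y₀ Pr ξ x y)
    {s t : ℕ} (hst : s ≠ t) (i : Fin n) :
    ∫ ω, inner ℝ (p.dualNoise S τ i (x s ω, y s ω) (ξ s ω))
      (p.dualNoise S τ i (x t ω, y t ω) (ξ t ω)) ∂Pr = 0 := by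
  rcases lt_or_gt_of_ne hst with h | h
  · exact R.integral_inner_noise_eq_zero t i (R.measurable_noise_past h i)
  · simp_rw [real_inner_comm (p.dualNoise S τ i (x t _, y t _) (ξ t _))]
    exact R.integral_inner_noise_eq_zero s i (R.measurable_noise_past h i)

/-- Orthogonality makes the second moment of the total noise grow like `T` rather than `T²`; this
makes the random comparison point affordable. -/
theorem integral_norm_sum_noise_sq (R : Run p Cf Cg σ₀ σ₁ δ μψ Lψ S B η τ x₀ y₀ Pr ξ x y)
    (T : ℕ) (i : Fin n) :
    ∫ ω, ‖∑ t ∈ Finset.range T, p.dualNoise S τ i (x t ω, y t ω) (ξ t ω)‖ ^ 2 ∂Pr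
      = ∑ t ∈ Finset.range T, ∫ ω, ‖p.dualNoise S τ i (x t ω, y t ω) (ξ t ω)‖ ^ 2 ∂Pr :=
  integral_norm_sum_sq _ (fun t _ => R.memLp_noise t i)
    fun _ _ _ _ hst => R.integral_inner_noise_noise hst i

theorem memLp_y (R : Run p Cf Cg σ₀ σ₁ δ μψ Lψ S B η τ x₀ y₀ Pr ξ x y) (t : ℕ) (i : Fin n) :
    MemLp (fun ω => y t ω i) 2 Pr := by
  have hm : Measurable fun ω => y t ω i :=
    (measurable_pi_apply i).comp (measurable_snd.comp
      ((R.measurable_state t).mono (past_le R.sampling.meas t) le_rfl))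
  exact MemLp.of_bound hm.stronglyMeasurable.aestronglyMeasurable (Cf * √Lψ)
    (Filter.Eventually.of_forall fun ω => R.norm_y_le t ω i)

theorem memLp_grad (R : Run p Cf Cg σ₀ σ₁ δ μψ Lψ S B η τ x₀ y₀ Pr ξ x y) (t : ℕ) :
    MemLp (fun ω => p.gradFull S τ (x t ω, y t ω) (ξ t ω)) 2 Pr :=
  memLp_two_of_integrable_sq (R.stronglyMeasurable_grad t).aestronglyMeasurable (R.grad_sq t).1

theorem memLp_x (R : Run p Cf Cg σ₀ σ₁ δ μψ Lψ S B η τ x₀ y₀ Pr ξ x y) (t : ℕ) :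
    MemLp (x t) 2 Pr := by
  induction t with
  | zero =>
    have : x 0 = fun _ => x₀ := funext R.alexr.x_zero
    rw [this]
    exact memLp_const _
  | succ t ih =>
    obtain ⟨K, φ, hφ, he⟩ := R.exists_lipschitz_primal t
    have hq : MemLp (fun ω => x t ω - η⁻¹ • p.gradFull S τ (x t ω, y t ω) (ξ t ω)) 2 Pr :=
      ih.sub ((R.memLp_grad t).const_smul η⁻¹)
    have hφ' : LipschitzWith K fun v => φ v - φ 0 :=
      LipschitzWith.of_dist_le_mul fun v w => by simpa using hφ.dist_le_mul v w
    have h1 := (hφ'.comp_memLp (by simp) hq).add (memLp_const (φ 0))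
    refine h1.congr_norm ?_ (Filter.Eventually.of_forall fun ω => ?_)
    · exact ((measurable_fst.comp (R.measurable_state (t + 1))).mono
        (past_le R.sampling.meas _) le_rfl).stronglyMeasurable.aestronglyMeasurable
    · simp [he ω]

theorem memLp_gradMean (R : Run p Cf Cg σ₀ σ₁ δ μψ Lψ S B η τ x₀ y₀ Pr ξ x y) (t : ℕ) :
    MemLp (fun ω => p.gradMean τ (x t ω, y t ω) (ξ t ω)) 2 Pr := by
  have hm : StronglyMeasurable fun ω => p.gradMean τ (x t ω, y t ω) (ξ t ω) := by
    have := (R.asm.stronglyMeasurable_gradMean (B := B) R.Cf_pos R.L_pos R.τ_pos).comp_measurable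
      (R.measurable_pair t)
    exact this
  refine MemLp.of_bound hm.aestronglyMeasurable
    (|1 / (n : ℝ)| * ∑ _ : Fin n, Cg / √μψ * (Cf * √Lψ)) (Filter.Eventually.of_forall fun ω => ?_)
  rw [gradMean, norm_smul, Real.norm_eq_abs]
  refine mul_le_mul_of_nonneg_left ((norm_sum_le _ _).trans (Finset.sum_le_sum fun i _ => ?_))
    (abs_nonneg _)
  refine (R.asm.norm_adjoint_fullDual_le R.Cf_pos R.L_pos _ _ _ i).trans ?_
  have := R.asm.norm_meanJ_le R.μ_pos R.L_pos i (R.x_mem t ω)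
  exact mul_le_mul_of_nonneg_right this (mul_nonneg R.Cf_pos.le (Real.sqrt_nonneg _))

theorem integrable_inner_grad_error (R : Run p Cf Cg σ₀ σ₁ δ μψ Lψ S B η τ x₀ y₀ Pr ξ x y)
    (t : ℕ) (z : Vec d) :
    Integrable (fun ω => (inner ℝ (p.gradMean τ (x t ω, y t ω) (ξ t ω)
      - p.gradFull S τ (x t ω, y t ω) (ξ t ω)) (x t ω - z) : ℝ)) Pr :=
  integrable_inner_of_memLp ((R.memLp_gradMean t).sub (R.memLp_grad t))
    ((R.memLp_x t).sub (memLp_const z))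

theorem integral_inner_grad_error (R : Run p Cf Cg σ₀ σ₁ δ μψ Lψ S B η τ x₀ y₀ Pr ξ x y)
    (t : ℕ) (z : Vec d) :
    ∫ ω, inner ℝ (p.gradMean τ (x t ω, y t ω) (ξ t ω)
      - p.gradFull S τ (x t ω, y t ω) (ξ t ω)) (x t ω - z) ∂Pr = 0 := by
  have hm : Measurable fun w : (Vec d × (Fin n → Vec m)) × Draw n B Z => w.1.1 - z := by fun_prop
  exact R.integral_fresh t (R.measurable_state t)
    (φ := fun u q => (inner ℝ (p.gradMean τ u q - p.gradFull S τ u q) (u.1 - z) : ℝ))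
    (((R.asm.stronglyMeasurable_gradMean R.Cf_pos R.L_pos R.τ_pos).sub
      (R.asm.stronglyMeasurable_gradFull R.Cf_pos R.L_pos R.τ_pos)).inner hm.stronglyMeasurable)
    fun ω => R.asm.integral_inner_gradMean_sub_gradFull R.Cf_pos R.L_pos R.τ_pos R.S_pos R.S_le
      R.B_pos (u := (x t ω, y t ω)) (R.x_mem t ω) _

end Run

end Problem


/-! ### The one-iteration inequality -/

/-- Here `a` is the full update, `y + ι • (a - y)` the actual one, `c = n/S` and `e` the oracle
error. As `ι² = ι`, the decrease of squared distance along the actual step is `ι` times that along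
the full step; the mismatch `1 - c * ι` goes into the noise. Half of the proximal term absorbs `⟨a -
y, e⟩` and the other half, `τ/4 ‖a - y‖²`, is kept to pay for the noise variance. -/
theorem dual_block_inequality {E : Type*} [NormedAddCommGroup E] [InnerProductSpace ℝ E] {τ : ℝ}
    (hτ : 0 < τ) (c : ℝ) {ι : ℝ} (hι : ι * ι = ι) (v a y e : E) :
    τ / 2 * (‖v - y‖ ^ 2 - ‖v - a‖ ^ 2 - ‖a - y‖ ^ 2) + inner ℝ (v - a) e ≤
      τ / 2 * c * (‖v - y‖ ^ 2 - ‖v - (y + ι • (a - y))‖ ^ 2)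
        + inner ℝ (v - y) (e + (τ * (1 - c * ι)) • (a - y))
        - τ / 2 * ((1 - c * ι) * ‖a - y‖ ^ 2) - τ / 4 * ‖a - y‖ ^ 2 + ‖e‖ ^ 2 / τ := by
  have h1 : v - a = (v - y) - (a - y) := by abel
  have h2 : v - (y + ι • (a - y)) = (v - y) - ι • (a - y) := by abel
  rw [h1, h2]
  generalize v - y = w
  generalize a - y = b
  have h3 : 0 ≤ ‖(τ / 2) • b + e‖ ^ 2 / τ := by positivity
  rw [norm_add_sq_real, norm_smul, real_inner_smul_left, mul_pow, Real.norm_eq_abs, sq_abs] at h3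
  have h4 : ((τ / 2) ^ 2 * ‖b‖ ^ 2 + 2 * (τ / 2 * inner ℝ b e) + ‖e‖ ^ 2) / τ
      = τ / 4 * ‖b‖ ^ 2 + inner ℝ b e + ‖e‖ ^ 2 / τ := by field_simp; ring
  rw [h4] at h3
  rw [norm_sub_sq_real, norm_sub_sq_real, norm_smul, real_inner_smul_right, mul_pow,
    Real.norm_eq_abs, sq_abs, inner_sub_left, inner_add_right, real_inner_smul_right]
  have h5 : ι ^ 2 = ι := by rw [sq, hι]
  rw [h5]
  linarith

theorem linear_sub_quadratic_le {η : ℝ} (hη : 0 < η) (a s : ℝ) :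
    a * s ≤ a ^ 2 / η + η / 4 * s ^ 2 := by
  have h : 0 ≤ (a - η / 2 * s) ^ 2 / η := by positivity
  have e : (a - η / 2 * s) ^ 2 / η = a ^ 2 / η - a * s + η / 4 * s ^ 2 := by field_simp; ring
  linarith

namespace Problem

namespace Run

variable {d m n : ℕ} {Z : Type*} [MeasurableSpace Z]
  {p : Problem d m n Z} {Cf Cg σ₀ σ₁ δ μψ Lψ : ℝ} {S B : ℕ} {η τ : ℝ} {x₀ : Vec d}
  {y₀ : Fin n → Vec m} {Ω : Type*} [MeasurableSpace Ω] {Pr : Measure Ω}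
  {ξ : ℕ → Ω → Draw n B Z} {x : ℕ → Ω → Vec d} {y : ℕ → Ω → Fin n → Vec m}

/-- Fenchel–Young bounds `fᵢ(gᵢ(z))` below by the linearization at `x_t` with the full dual update
as slope. The dual three-point inequality handles the change of dual point, and the Lipschitz bound
the move from `x_t` to `x_{t+1}`. -/
theorem block_le (R : Run p Cf Cg σ₀ σ₁ δ μψ Lψ S B η τ x₀ y₀ Pr ξ x y) (t : ℕ) (ω : Ω)
    (i : Fin n) {z : Vec d} (hz : z ∈ p.X) {v : Vec m} (hv : v ∈ conjDom (p.f i)) :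
    inner ℝ v (p.g i (x (t + 1) ω)) - conjReal (p.f i) v - p.f i (p.g i z) ≤
      τ / 2 * ((n : ℝ) / S) * (‖v - y t ω i‖ ^ 2 - ‖v - y (t + 1) ω i‖ ^ 2)
      + inner ℝ (v - y₀ i) (p.dualNoise S τ i (x t ω, y t ω) (ξ t ω))
      + (inner ℝ (y₀ i - y t ω i) (p.dualNoise S τ i (x t ω, y t ω) (ξ t ω))
        - τ / 2 * (weight S i (ξ t ω).1 *
          ‖p.fullDual τ (x t ω, y t ω) (ξ t ω) i - y t ω i‖ ^ 2)
        - τ / 4 * ‖p.fullDual τ (x t ω, y t ω) (ξ t ω) i - y t ω i‖ ^ 2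
        + ‖p.g i (x t ω) - p.gBatch i (x t ω) ((ξ t ω).2.1 i)‖ ^ 2 / τ)
      + Cf * √Lψ * (Cg / √μψ) * ‖x (t + 1) ω - x t ω‖
      + inner ℝ (ContinuousLinearMap.adjoint (p.meanJ i (x t ω))
          (p.fullDual τ (x t ω, y t ω) (ξ t ω) i)) (x t ω - z) := by
  have hC : 0 ≤ Cf * √Lψ := mul_nonneg R.Cf_pos.le (Real.sqrt_nonneg _)
  set a := p.fullDual τ (x t ω, y t ω) (ξ t ω) i with ha
  set b := p.gBatch i (x t ω) ((ξ t ω).2.1 i) with hb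
  have had : a ∈ conjDom (p.f i) := R.asm.fullDual_mem R.Cf_pos R.L_pos _ _ i
  have hmin := dualProx_add_min hC (R.asm.abs_f_sub_le R.Cf_pos R.L_pos i)
    (R.asm.conjDom_nonempty R.Cf_pos R.L_pos i) R.τ_pos (y t ω i) b
  have hcv : ConvexOn ℝ (conjDom (p.f i)) fun w => conjReal (p.f i) w - inner ℝ w b := by
    have hl : ConcaveOn ℝ (conjDom (p.f i)) fun w : Vec m => (inner ℝ w b : ℝ) := by
      have e : (fun w : Vec m => (inner ℝ w b : ℝ)) = innerₛₗ ℝ b :=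
        funext fun w => real_inner_comm _ _
      rw [e]
      exact (innerₛₗ ℝ b).concaveOn (convexOn_conjReal _).1
    exact (convexOn_conjReal _).sub hl
  have h3 := prox_three_point hcv had hmin hv
  have h1 := inner_sub_le_conjReal had (p.g i z)
  have h2 := R.asm.inner_g_subgradient i (R.x_mem t ω) hz had
  have h4 : inner ℝ v (p.g i (x (t + 1) ω) - p.g i (x t ω)) ≤
      Cf * √Lψ * (Cg / √μψ) * ‖x (t + 1) ω - x t ω‖ := by
    refine (real_inner_le_norm _ _).trans ?_
    rw [mul_assoc]
    exact mul_le_mul (norm_le_of_mem_conjDom hC (R.asm.abs_f_sub_le R.Cf_pos R.L_pos i) hv)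
      (R.asm.norm_g_sub_le R.μ_pos R.L_pos i (R.x_mem _ _) (R.x_mem _ _)) (norm_nonneg _) hC
  have hι : incl i (ξ t ω).1 * incl i (ξ t ω).1 = incl i (ξ t ω).1 := by
    unfold incl; split_ifs <;> simp
  have h5 := dual_block_inequality R.τ_pos ((n : ℝ) / S) hι v a (y t ω i) (p.g i (x t ω) - b)
  rw [R.y_succ t ω i, ← ha]
  have hW : p.dualNoise S τ i (x t ω, y t ω) (ξ t ω) =
      (p.g i (x t ω) - b) + (τ * (1 - (n : ℝ) / S * incl i (ξ t ω).1)) • (a - y t ω i) := rfl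
  rw [← hW] at h5
  -- Splitting at the deterministic `y₀` separates a factor that is constant in `t` from one
  -- determined by the past.
  have h6 : inner ℝ (v - y₀ i) (p.dualNoise S τ i (x t ω, y t ω) (ξ t ω)) +
      inner ℝ (y₀ i - y t ω i) (p.dualNoise S τ i (x t ω, y t ω) (ξ t ω)) =
      inner ℝ (v - y t ω i) (p.dualNoise S τ i (x t ω, y t ω) (ξ t ω)) := by
    rw [← inner_add_left]; congr 1; abel
  have h7 : inner ℝ (v - a) (p.g i (x t ω) - b) =
      inner ℝ v (p.g i (x t ω)) - inner ℝ v b - inner ℝ a (p.g i (x t ω)) + inner ℝ a b := by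
    simp only [inner_sub_left, inner_sub_right]; ring
  have h8 : inner ℝ (ContinuousLinearMap.adjoint (p.meanJ i (x t ω)) a) (x t ω - z) =
      - inner ℝ (ContinuousLinearMap.adjoint (p.meanJ i (x t ω)) a) (z - x t ω) := by
    rw [← inner_neg_right, neg_sub]
  rw [inner_sub_right] at h4
  rw [h7] at h5
  rw [h8]
  unfold weight
  linarith

/-- The martingale and residual terms of one iteration. -/
noncomputable def residual (p : Problem d m n Z) (Cf Cg μψ Lψ : ℝ) (S : ℕ) (η τ : ℝ)
    (y₀ : Fin n → Vec m) (z : Vec d) (u : Vec d × (Fin n → Vec m)) (q : Draw n B Z) : ℝ :=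
  (1 / (n : ℝ)) * ∑ i, (inner ℝ (y₀ i - u.2 i) (p.dualNoise S τ i u q)
        - τ / 2 * (weight S i q.1 * ‖p.fullDual τ u q i - u.2 i‖ ^ 2)
        - τ / 4 * ‖p.fullDual τ u q i - u.2 i‖ ^ 2
        + ‖p.g i u.1 - p.gBatch i u.1 (q.2.1 i)‖ ^ 2 / τ)
    + inner ℝ (p.gradMean τ u q - p.gradFull S τ u q) (u.1 - z)
    + ((Cf * √Lψ * (Cg / √μψ)) ^ 2 + ‖p.gradFull S τ u q‖ ^ 2) / η

theorem n_pos (R : Run p Cf Cg σ₀ σ₁ δ μψ Lψ S B η τ x₀ y₀ Pr ξ x y) : (0 : ℝ) < n := by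
  have := R.S_pos.trans R.S_le
  positivity

theorem step_le (R : Run p Cf Cg σ₀ σ₁ δ μψ Lψ S B η τ x₀ y₀ Pr ξ x y) (t : ℕ) (ω : Ω)
    {z : Vec d} (hz : z ∈ Assumptions.finiteDom p) {v : Fin n → Vec m}
    (hv : ∀ i, v i ∈ conjDom (p.f i)) :
    (1 / (n : ℝ)) * ∑ i, (inner ℝ (v i) (p.g i (x (t + 1) ω)) - conjReal (p.f i) (v i)
        - p.f i (p.g i z)) + (p.r (x (t + 1) ω)).toReal - (p.r z).toReal ≤
      η / 2 * (‖x t ω - z‖ ^ 2 - ‖x (t + 1) ω - z‖ ^ 2)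
      + (1 / (n : ℝ)) * ∑ i, (τ / 2 * ((n : ℝ) / S) *
          (‖v i - y t ω i‖ ^ 2 - ‖v i - y (t + 1) ω i‖ ^ 2)
        + inner ℝ (v i - y₀ i) (p.dualNoise S τ i (x t ω, y t ω) (ξ t ω)))
      + residual p Cf Cg μψ Lψ S η τ y₀ z (x t ω, y t ω) (ξ t ω) := by
  have hn := R.n_pos
  have h1 := Finset.sum_le_sum fun i (_ : i ∈ Finset.univ) => R.block_le t ω i hz.1 (hv i)
  have h2 := mul_le_mul_of_nonneg_left h1 (show 0 ≤ 1 / (n : ℝ) by positivity)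
  set G := p.gradFull S τ (x t ω, y t ω) (ξ t ω) with hG
  set c := Cf * √Lψ * (Cg / √μψ) with hc
  have h3 := R.primal_three_point t ω hz
  rw [← hG] at h3
  simp only [Finset.sum_add_distrib, mul_add] at h2
  have e1 : (1 / (n : ℝ)) * ∑ i, inner ℝ (ContinuousLinearMap.adjoint (p.meanJ i (x t ω))
      (p.fullDual τ (x t ω, y t ω) (ξ t ω) i)) (x t ω - z) =
      inner ℝ (p.gradMean τ (x t ω, y t ω) (ξ t ω)) (x t ω - z) := by
    rw [gradMean, real_inner_smul_left, sum_inner]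
  have e2 : (1 / (n : ℝ)) * ∑ _ : Fin n, c * ‖x (t + 1) ω - x t ω‖ =
      c * ‖x (t + 1) ω - x t ω‖ := by
    rw [Finset.sum_const, Finset.card_univ, Fintype.card_fin, nsmul_eq_mul]
    field_simp
  rw [e1, e2] at h2
  -- The gradient error is paired with `x_t - z`, known before the draw, so that it is centred. The
  -- proximal step controls `⟨G, x_{t+1} - z⟩`, and Young the remaining displacement.
  have e3 : inner ℝ (p.gradMean τ (x t ω, y t ω) (ξ t ω)) (x t ω - z) =
      inner ℝ (p.gradMean τ (x t ω, y t ω) (ξ t ω) - G) (x t ω - z) +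
      (inner ℝ G (x (t + 1) ω) - inner ℝ G z) - inner ℝ G (x (t + 1) ω - x t ω) := by
    simp only [inner_sub_left, inner_sub_right]; ring
  have h4 : - inner ℝ G (x (t + 1) ω - x t ω) ≤ ‖G‖ * ‖x (t + 1) ω - x t ω‖ :=
    (neg_le_abs _).trans (abs_real_inner_le_norm _ _)
  -- Each of the two applications spends `η/4 ‖x_{t+1} - x_t‖²`, which together exhaust the proximal
  -- term.
  have h5 := linear_sub_quadratic_le R.η_pos c ‖x (t + 1) ω - x t ω‖
  have h6 := linear_sub_quadratic_le R.η_pos ‖G‖ ‖x (t + 1) ω - x t ω‖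
  have e4 : (c ^ 2 + ‖G‖ ^ 2) / η = c ^ 2 / η + ‖G‖ ^ 2 / η := add_div _ _ _
  rw [norm_sub_rev z, norm_sub_rev z] at h3
  simp only [residual, Finset.sum_add_distrib, mul_add]
  rw [← hG, ← hc, e4]
  rw [e3] at h2
  linarith

end Run

end Problem


/-! ### The objective, the averaged iterate and the pathwise gap -/

namespace Problem

variable {d m n : ℕ} {Z : Type*} [MeasurableSpace Z]
  {p : Problem d m n Z} {Cf Cg σ₀ σ₁ δ μψ Lψ : ℝ}

namespace Assumptions

theorem F_eq_coe (h : p.Assumptions Cf Cg σ₀ σ₁ δ μψ Lψ) {z : Vec d} (hz : z ∈ finiteDom p) :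
    p.F z = (((1 / (n : ℝ)) * ∑ i, p.f i (p.g i z) + (p.r z).toReal : ℝ) : EReal) := by
  rw [F, ← h.coe_toReal_r hz, ← EReal.coe_add, EReal.toReal_coe]

theorem toReal_F (h : p.Assumptions Cf Cg σ₀ σ₁ δ μψ Lψ) {z : Vec d} (hz : z ∈ finiteDom p) :
    (p.F z).toReal = (1 / (n : ℝ)) * ∑ i, p.f i (p.g i z) + (p.r z).toReal := by
  rw [h.F_eq_coe hz, EReal.toReal_coe]

theorem argmin_F_mem (h : p.Assumptions Cf Cg σ₀ σ₁ δ μψ Lψ) {z : Vec d}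
    (hz : IsArgmin p.F p.X z) : z ∈ finiteDom p :=
  (h.isArgmin_prox (ℓ := fun x => (1 / (n : ℝ)) * ∑ i, p.f i (p.g i x)) hz).1

theorem toReal_F_le (h : p.Assumptions Cf Cg σ₀ σ₁ δ μψ Lψ) {z : Vec d}
    (hz : IsArgmin p.F p.X z) {x : Vec d} (hx : x ∈ finiteDom p) :
    (p.F z).toReal ≤ (p.F x).toReal := by
  rw [h.toReal_F (h.argmin_F_mem hz), h.toReal_F hx]
  have := (h.isArgmin_prox (ℓ := fun x => (1 / (n : ℝ)) * ∑ i, p.f i (p.g i x)) hz).2 x hx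
  linarith

theorem dualBest_spec (h : p.Assumptions Cf Cg σ₀ σ₁ δ μψ Lψ) (hCf : 0 < Cf) (hL : 0 < Lψ)
    {x : Vec d} {v : Fin n → Vec m} (hv : p.IsDualBest x v) (i : Fin n) :
    v i ∈ conjDom (p.f i) ∧ p.f i (p.g i x) ≤ inner ℝ (v i) (p.g i x) - conjReal (p.f i) (v i) := by
  obtain ⟨h1, h2⟩ := isArgmax_conj (h.conjDom_nonempty hCf hL i) (hv i)
  obtain ⟨w, hw, hw'⟩ := exists_subgradient (h.f_convex i) (h.continuous_f hCf hL i) (p.g i x)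
  exact ⟨h1, by linarith [h2 w hw]⟩

end Assumptions

namespace Run

variable {S B : ℕ} {η τ : ℝ} {x₀ : Vec d}
  {y₀ : Fin n → Vec m} {Ω : Type*} [MeasurableSpace Ω] {Pr : Measure Ω}
  {ξ : ℕ → Ω → Draw n B Z} {x : ℕ → Ω → Vec d} {y : ℕ → Ω → Fin n → Vec m}

theorem avgIterate_mem (R : Run p Cf Cg σ₀ σ₁ δ μψ Lψ S B η τ x₀ y₀ Pr ξ x y) {T : ℕ}
    (hT : 1 ≤ T) (ω : Ω) : avgIterate x T ω ∈ Assumptions.finiteDom p ∧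
      T * (p.r (avgIterate x T ω)).toReal ≤
        ∑ t ∈ Finset.range T, (p.r (x (t + 1) ω)).toReal := by
  have hT' : (0 : ℝ) < T := by positivity
  have h0 : ∀ t ∈ Finset.range T, 0 ≤ 1 / (T : ℝ) := fun _ _ => by positivity
  have h1 : ∑ _t ∈ Finset.range T, 1 / (T : ℝ) = 1 := by
    rw [Finset.sum_const, Finset.card_range, nsmul_eq_mul]; field_simp
  have h2 : ∀ t ∈ Finset.range T, x (t + 1) ω ∈ Assumptions.finiteDom p := fun t _ =>
    (R.primal_min t ω).1
  have e : avgIterate x T ω = ∑ t ∈ Finset.range T, (1 / (T : ℝ)) • x (t + 1) ω := by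
    rw [avgIterate, Finset.smul_sum]
  refine ⟨by rw [e]; exact R.asm.convexOn_toReal_r.1.sum_mem h0 h1 h2, ?_⟩
  have h3 := R.asm.convexOn_toReal_r.map_sum_le h0 h1 h2
  rw [← e] at h3
  simp only [smul_eq_mul, ← Finset.mul_sum] at h3
  rw [one_div, inv_mul_eq_div, le_div_iff₀ hT'] at h3
  linarith

/-- The bound is pathwise, so the comparison point `v` may depend on `ω` through the averaged
iterate; probability enters only afterwards. -/
theorem gap_le (R : Run p Cf Cg σ₀ σ₁ δ μψ Lψ S B η τ x₀ y₀ Pr ξ x y) {T : ℕ} (hT : 1 ≤ T)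
    (ω : Ω) {z : Vec d} (hz : z ∈ Assumptions.finiteDom p) {v : Fin n → Vec m}
    (hv : p.IsDualBest (avgIterate x T ω) v) :
    T * ((p.F (avgIterate x T ω)).toReal - (p.F z).toReal) ≤
      η / 2 * ‖x₀ - z‖ ^ 2 + 5 * τ / (2 * S) * ∑ i, ‖v i - y₀ i‖ ^ 2
      + S / (8 * τ * n ^ 2) * ∑ i, ‖∑ t ∈ Finset.range T,
          p.dualNoise S τ i (x t ω, y t ω) (ξ t ω)‖ ^ 2
      + ∑ t ∈ Finset.range T,
          residual p Cf Cg μψ Lψ S η τ y₀ z (x t ω, y t ω) (ξ t ω) := by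
  have hn := R.n_pos
  have hS : (0 : ℝ) < S := by have := R.S_pos; positivity
  have hτ := R.τ_pos
  obtain ⟨hm, hr⟩ := R.avgIterate_mem hT ω
  have hv' := R.asm.dualBest_spec R.Cf_pos R.L_pos hv
  rw [R.asm.toReal_F hm, R.asm.toReal_F hz]
  have h1 := Finset.sum_le_sum fun t (_ : t ∈ Finset.range T) =>
    R.step_le t ω hz fun i => (hv' i).1
  have tele1 : ∑ t ∈ Finset.range T, η / 2 * (‖x t ω - z‖ ^ 2 - ‖x (t + 1) ω - z‖ ^ 2)
      ≤ η / 2 * ‖x₀ - z‖ ^ 2 := by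
    rw [← Finset.mul_sum, Finset.sum_range_sub' (fun t => ‖x t ω - z‖ ^ 2), R.alexr.x_zero]
    have := R.η_pos
    gcongr
    linarith [sq_nonneg ‖x T ω - z‖]
  have tele2 : ∀ i, ∑ t ∈ Finset.range T, (τ / 2 * ((n : ℝ) / S) *
          (‖v i - y t ω i‖ ^ 2 - ‖v i - y (t + 1) ω i‖ ^ 2)
        + inner ℝ (v i - y₀ i) (p.dualNoise S τ i (x t ω, y t ω) (ξ t ω)))
      ≤ 5 * τ * n / (2 * S) * ‖v i - y₀ i‖ ^ 2 + S / (8 * τ * n) *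
        ‖∑ t ∈ Finset.range T, p.dualNoise S τ i (x t ω, y t ω) (ξ t ω)‖ ^ 2 := by
    intro i
    rw [Finset.sum_add_distrib, ← Finset.mul_sum,
      Finset.sum_range_sub' (fun t => ‖v i - y t ω i‖ ^ 2), R.alexr.y_zero, ← inner_sum]
    generalize ∑ t ∈ Finset.range T, p.dualNoise S τ i (x t ω, y t ω) (ξ t ω) = M
    -- With this parameter, `S / (8τn)` times the variance factor `2τ²n/S` is `τ/4`, exactly the
    -- amount kept in the dual step. The other side costs `2τn/S`, which with the telescoped
    -- `τn/(2S)` gives `5τn/(2S)`.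
    have hy := linear_sub_quadratic_le (η := 8 * τ * n / S) (by positivity) ‖M‖ ‖v i - y₀ i‖
    have hin := real_inner_le_norm (v i - y₀ i) M
    have hneg : τ / 2 * ((n : ℝ) / S) * (‖v i - y₀ i‖ ^ 2 - ‖v i - y T ω i‖ ^ 2) ≤
        τ / 2 * ((n : ℝ) / S) * ‖v i - y₀ i‖ ^ 2 := by
      gcongr
      linarith [sq_nonneg ‖v i - y T ω i‖]
    have e1 : ‖M‖ ^ 2 / (8 * τ * n / S) = S / (8 * τ * n) * ‖M‖ ^ 2 := by field_simp
    have e2 : 5 * τ * n / (2 * S) * ‖v i - y₀ i‖ ^ 2 = τ / 2 * ((n : ℝ) / S) * ‖v i - y₀ i‖ ^ 2 +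
        8 * τ * n / S / 4 * ‖v i - y₀ i‖ ^ 2 := by field_simp; ring
    rw [e1] at hy
    rw [e2]
    linarith
  have tele2' := Finset.sum_le_sum fun i (_ : i ∈ Finset.univ) => tele2 i
  rw [Finset.sum_comm, Finset.sum_add_distrib, ← Finset.mul_sum, ← Finset.mul_sum] at tele2'
  have tele3 := mul_le_mul_of_nonneg_left tele2' (show 0 ≤ 1 / (n : ℝ) by positivity)
  rw [Finset.mul_sum (Finset.range T)] at tele3
  rw [Finset.sum_add_distrib, Finset.sum_add_distrib] at h1
  have hlow : T * ((1 / (n : ℝ)) * ∑ i, p.f i (p.g i (avgIterate x T ω))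
        + (p.r (avgIterate x T ω)).toReal - ((1 / (n : ℝ)) * ∑ i, p.f i (p.g i z)
        + (p.r z).toReal)) ≤
      ∑ t ∈ Finset.range T, ((1 / (n : ℝ)) * ∑ i, (inner ℝ (v i) (p.g i (x (t + 1) ω))
        - conjReal (p.f i) (v i) - p.f i (p.g i z)) + (p.r (x (t + 1) ω)).toReal
        - (p.r z).toReal) := by
    rw [Finset.sum_sub_distrib, Finset.sum_add_distrib, ← Finset.mul_sum, Finset.sum_comm,
      Finset.sum_const, Finset.card_range, nsmul_eq_mul]
    have hblock : T * ∑ i, p.f i (p.g i (avgIterate x T ω)) - T * ∑ i, p.f i (p.g i z) ≤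
        ∑ i, ∑ t ∈ Finset.range T, (inner ℝ (v i) (p.g i (x (t + 1) ω))
        - conjReal (p.f i) (v i) - p.f i (p.g i z)) := by
      rw [Finset.mul_sum, Finset.mul_sum, ← Finset.sum_sub_distrib]
      refine Finset.sum_le_sum fun i _ => ?_
      rw [Finset.sum_sub_distrib, Finset.sum_sub_distrib, Finset.sum_const, Finset.sum_const,
        Finset.card_range, nsmul_eq_mul, nsmul_eq_mul]
      have h3 := R.asm.inner_g_average_le i hT (x := fun t => x (t + 1) ω)
        (fun t => R.x_mem _ _) hm.1 (hv' i).1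
      change (T : ℝ) * inner ℝ (v i) (p.g i (avgIterate x T ω)) ≤ _ at h3
      have h4 := mul_le_mul_of_nonneg_left (hv' i).2 (show 0 ≤ (T : ℝ) by positivity)
      linarith
    have hblock' := mul_le_mul_of_nonneg_left hblock (show 0 ≤ 1 / (n : ℝ) by positivity)
    linarith
  have e3 : 1 / (n : ℝ) * (5 * τ * n / (2 * S) * ∑ i, ‖v i - y₀ i‖ ^ 2 + S / (8 * τ * n) *
      ∑ i, ‖∑ t ∈ Finset.range T, p.dualNoise S τ i (x t ω, y t ω) (ξ t ω)‖ ^ 2) =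
      5 * τ / (2 * S) * ∑ i, ‖v i - y₀ i‖ ^ 2 + S / (8 * τ * n ^ 2) *
      ∑ i, ‖∑ t ∈ Finset.range T, p.dualNoise S τ i (x t ω, y t ω) (ξ t ω)‖ ^ 2 := by
    field_simp
  rw [e3] at tele3
  linarith

end Run

end Problem


/-! ### The gap in expectation -/

theorem bregmanSum_quad {m n : ℕ} (u v : Fin n → Vec m) :
    bregmanSum (fun _ => quad) u v = 1 / 2 * ∑ i, ‖u i - v i‖ ^ 2 := by
  simp only [bregmanSum, bregman_quad, Finset.mul_sum]

namespace Problem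

variable {d m n : ℕ} {Z : Type*} [MeasurableSpace Z]
  {p : Problem d m n Z} {Cf Cg σ₀ σ₁ δ μψ Lψ : ℝ}

theorem Assumptions.measurable_toReal_F (h : p.Assumptions Cf Cg σ₀ σ₁ δ μψ Lψ) (hCf : 0 < Cf)
    (hL : 0 < Lψ) {Ω : Type*} [MeasurableSpace Ω] {u : Ω → Vec d} (hu : Measurable u)
    (hmem : ∀ ω, u ω ∈ finiteDom p) : Measurable fun ω => (p.F (u ω)).toReal := by
  simp_rw [fun ω => h.toReal_F (hmem ω)]
  refine Measurable.add (Measurable.const_mul (Finset.measurable_fun_sum _ fun i _ => ?_) _) ?_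
  · exact (h.continuous_f hCf hL i).measurable.comp
      ((h.stronglyMeasurable_g i).measurable.comp hu)
  -- Nothing is known about `r` off `X`, so its measurability is taken on the subtype.
  · have hr : LowerSemicontinuous (p.X.domRestrict p.r) :=
      lowerSemicontinuous_restrict_iff.2 h.r_lsc
    have hs : Measurable fun ω => (⟨u ω, (hmem ω).1⟩ : p.X) := hu.subtype_mk
    exact (hr.measurable.comp hs).ereal_toReal

namespace Run

variable {S B : ℕ} {η τ : ℝ} {x₀ : Vec d}
  {y₀ : Fin n → Vec m} {Ω : Type*} [MeasurableSpace Ω] {Pr : Measure Ω} [IsProbabilityMeasure Pr]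
  {ξ : ℕ → Ω → Draw n B Z} {x : ℕ → Ω → Vec d} {y : ℕ → Ω → Fin n → Vec m}

theorem integral_residual_le (R : Run p Cf Cg σ₀ σ₁ δ μψ Lψ S B η τ x₀ y₀ Pr ξ x y) (t : ℕ)
    (z : Vec d) :
    Integrable (fun ω => residual p Cf Cg μψ Lψ S η τ y₀ z (x t ω, y t ω) (ξ t ω)) Pr ∧
    ∫ ω, residual p Cf Cg μψ Lψ S η τ y₀ z (x t ω, y t ω) (ξ t ω) ∂Pr ≤
      (1 / (n : ℝ)) * ∑ i, (- (τ / 4 *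
          ∫ ω, ‖p.fullDual τ (x t ω, y t ω) (ξ t ω) i - y t ω i‖ ^ 2 ∂Pr)
        + σ₀ ^ 2 / μψ / B / τ)
      + ((Cf * √Lψ * (Cg / √μψ)) ^ 2
        + (Cf * √Lψ) ^ 2 * (2 * (Cg / √μψ) ^ 2 + 2 * (σ₁ ^ 2 / μψ))) / η := by
  have hτ := R.τ_pos
  have hη := R.η_pos
  have a1 : ∀ i, Integrable (fun ω => (inner ℝ (y₀ i - y t ω i)
      (p.dualNoise S τ i (x t ω, y t ω) (ξ t ω)) : ℝ)) Pr := fun i =>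
    integrable_inner_of_memLp ((memLp_const (y₀ i)).sub (R.memLp_y t i)) (R.memLp_noise t i)
  have a2 : ∀ i, Integrable (fun ω => τ / 2 * (weight S i (ξ t ω).1 *
      ‖p.fullDual τ (x t ω, y t ω) (ξ t ω) i - y t ω i‖ ^ 2)) Pr := fun i => by
    have := R.integrable_wt_mul_dir_sq t i 1
    simp only [pow_one] at this
    exact this.const_mul _
  have a3 : ∀ i, Integrable (fun ω => τ / 4 *
      ‖p.fullDual τ (x t ω, y t ω) (ξ t ω) i - y t ω i‖ ^ 2) Pr := fun i =>
    (R.integrable_dir_sq t i).const_mul _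
  have a4 : ∀ i, Integrable (fun ω =>
      ‖p.g i (x t ω) - p.gBatch i (x t ω) ((ξ t ω).2.1 i)‖ ^ 2 / τ) Pr := fun i =>
    (R.err_sq t i).1.div_const _
  have a12 := fun i => (a1 i).sub' (a2 i)
  have a123 := fun i => (a12 i).sub' (a3 i)
  have a1234 := fun i => (a123 i).fun_add (a4 i)
  have b1 := (integrable_finsetSum Finset.univ fun i _ => a1234 i).const_mul (1 / (n : ℝ))
  have b2 := R.integrable_inner_grad_error t z
  have b3 := ((integrable_const (μ := Pr) ((Cf * √Lψ * (Cg / √μψ)) ^ 2)).fun_add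
    (R.grad_sq t).1).div_const η
  refine ⟨(b1.fun_add b2).fun_add b3, ?_⟩
  simp only [residual]
  rw [integral_add (b1.fun_add b2) b3, integral_add b1 b2, integral_const_mul,
    integral_finsetSum _ fun i _ => a1234 i, R.integral_inner_grad_error, add_zero,
    integral_div, integral_add (integrable_const _) (R.grad_sq t).1]
  have hV : ∀ i, Measurable[past ξ t] fun ω => y₀ i - y t ω i := fun i =>
    measurable_const.sub ((measurable_pi_apply i).comp
      (measurable_snd.comp (R.measurable_state t)))
  have hterm : ∀ i, ∫ ω, (inner ℝ (y₀ i - y t ω i) (p.dualNoise S τ i (x t ω, y t ω) (ξ t ω))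
        - τ / 2 * (weight S i (ξ t ω).1 *
          ‖p.fullDual τ (x t ω, y t ω) (ξ t ω) i - y t ω i‖ ^ 2)
        - τ / 4 * ‖p.fullDual τ (x t ω, y t ω) (ξ t ω) i - y t ω i‖ ^ 2
        + ‖p.g i (x t ω) - p.gBatch i (x t ω) ((ξ t ω).2.1 i)‖ ^ 2 / τ) ∂Pr ≤
      - (τ / 4 * ∫ ω, ‖p.fullDual τ (x t ω, y t ω) (ξ t ω) i - y t ω i‖ ^ 2 ∂Pr)
        + σ₀ ^ 2 / μψ / B / τ := by
    intro i
    rw [integral_add (a123 i) (a4 i), integral_sub (a12 i) (a3 i), integral_sub (a1 i) (a2 i),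
      R.integral_inner_noise_eq_zero t i (hV i), integral_const_mul, integral_const_mul,
      R.integral_wt_mul_dir_sq, integral_div]
    have := div_le_div_of_nonneg_right (R.err_sq t i).2 hτ.le
    linarith
  have hc : ∫ _ : Ω, (Cf * √Lψ * (Cg / √μψ)) ^ 2 ∂Pr = (Cf * √Lψ * (Cg / √μψ)) ^ 2 := by simp
  rw [hc]
  refine add_le_add (mul_le_mul_of_nonneg_left (Finset.sum_le_sum fun i _ => hterm i)
    (by positivity)) (div_le_div_of_nonneg_right ?_ hη.le)
  linarith [(R.grad_sq t).2]

/-- Orthogonality and the choice of the Young parameter turn the total noise into the negative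
quadratic terms of the residuals with opposite sign, plus a quarter of their oracle variance. -/
theorem noise_budget (R : Run p Cf Cg σ₀ σ₁ δ μψ Lψ S B η τ x₀ y₀ Pr ξ x y) (T : ℕ) :
    S / (8 * τ * n ^ 2) * ∑ i, ∫ ω, ‖∑ t ∈ Finset.range T,
        p.dualNoise S τ i (x t ω, y t ω) (ξ t ω)‖ ^ 2 ∂Pr ≤
      ∑ t ∈ Finset.range T, (1 / (n : ℝ)) * ∑ i, (τ / 4 *
          ∫ ω, ‖p.fullDual τ (x t ω, y t ω) (ξ t ω) i - y t ω i‖ ^ 2 ∂Pr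
        + σ₀ ^ 2 / μψ / B / τ / 4) := by
  have hn := R.n_pos
  have hS : (0 : ℝ) < S := by have := R.S_pos; positivity
  have hSn : (S : ℝ) ≤ n := by exact_mod_cast R.S_le
  have hτ := R.τ_pos
  have hμ := R.μ_pos
  simp_rw [R.integral_norm_sum_noise_sq T]
  rw [Finset.sum_comm, Finset.mul_sum]
  refine Finset.sum_le_sum fun t _ => ?_
  rw [Finset.mul_sum, Finset.mul_sum]
  refine Finset.sum_le_sum fun i _ => ?_
  have h := mul_le_mul_of_nonneg_left (R.integral_noise_sq t i)
    (show 0 ≤ (S : ℝ) / (8 * τ * n ^ 2) by positivity)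
  refine h.trans ?_
  set D := ∫ ω, ‖p.fullDual τ (x t ω, y t ω) (ξ t ω) i - y t ω i‖ ^ 2 ∂Pr
  set s := σ₀ ^ 2 / μψ / (B : ℝ) with hs
  have hs0 : 0 ≤ s := by positivity
  have e : (S : ℝ) / (8 * τ * n ^ 2) * (2 * s + 2 * τ ^ 2 * ((n : ℝ) / S * D))
      = 1 / n * (τ / 4 * D + (S : ℝ) / n * (s / τ / 4)) := by field_simp; ring
  rw [e]
  have : (S : ℝ) / n * (s / τ / 4) ≤ s / τ / 4 :=
    mul_le_of_le_one_left (by positivity) ((div_le_one hn).2 hSn)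
  gcongr

theorem expected_gap_le (R : Run p Cf Cg σ₀ σ₁ δ μψ Lψ S B η τ x₀ y₀ Pr ξ x y) {T : ℕ}
    (hT : 1 ≤ T) {z : Vec d} (hz : IsArgmin p.F p.X z) {v : Ω → Fin n → Vec m}
    (hv : ∀ ω, p.IsDualBest (avgIterate x T ω) (v ω))
    (hint : Integrable (fun ω => bregmanSum (fun _ => quad) (v ω) y₀) Pr) :
    Integrable (fun ω => (p.F (avgIterate x T ω)).toReal - (p.F z).toReal) Pr ∧
    T * ∫ ω, ((p.F (avgIterate x T ω)).toReal - (p.F z).toReal) ∂Pr ≤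
      η / 2 * ‖x₀ - z‖ ^ 2 + 5 * τ / S * ∫ ω, bregmanSum (fun _ => quad) (v ω) y₀ ∂Pr
      + T * (5 / 4 * (σ₀ ^ 2 / μψ / B / τ) + ((Cf * √Lψ * (Cg / √μψ)) ^ 2
        + (Cf * √Lψ) ^ 2 * (2 * (Cg / √μψ) ^ 2 + 2 * (σ₁ ^ 2 / μψ))) / η) := by
  have hT' : (0 : ℝ) < T := by positivity
  have hn := R.n_pos
  have hzf := R.asm.argmin_F_mem hz
  have hbreg : ∀ ω, ∑ i, ‖v ω i - y₀ i‖ ^ 2 = 2 * bregmanSum (fun _ => quad) (v ω) y₀ := by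
    intro ω; rw [bregmanSum_quad]; ring
  have c1 : Integrable (fun _ : Ω => η / 2 * ‖x₀ - z‖ ^ 2) Pr := integrable_const _
  have c2 : Integrable (fun ω => 5 * τ / (2 * S) * ∑ i, ‖v ω i - y₀ i‖ ^ 2) Pr := by
    simp_rw [hbreg]
    exact (hint.const_mul 2).const_mul _
  have c3' : ∀ i, Integrable (fun ω => ‖∑ t ∈ Finset.range T,
      p.dualNoise S τ i (x t ω, y t ω) (ξ t ω)‖ ^ 2) Pr := fun i =>
    integrable_sq_of_memLp (memLp_finsetSum _ fun t _ => R.memLp_noise t i)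
  have c3 : Integrable (fun ω => S / (8 * τ * n ^ 2) * ∑ i, ‖∑ t ∈ Finset.range T,
      p.dualNoise S τ i (x t ω, y t ω) (ξ t ω)‖ ^ 2) Pr :=
    (integrable_finsetSum _ fun i _ => c3' i).const_mul _
  have c4 : Integrable (fun ω => ∑ t ∈ Finset.range T,
      residual p Cf Cg μψ Lψ S η τ y₀ z (x t ω, y t ω) (ξ t ω)) Pr :=
    integrable_finsetSum _ fun t _ => (R.integral_residual_le t z).1
  have c := ((c1.fun_add c2).fun_add c3).fun_add c4
  have hle := fun ω => R.gap_le hT ω hzf (hv ω)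
  have hxb : Measurable (avgIterate x T) := by
    refine Measurable.fun_const_smul (Finset.measurable_fun_sum _ fun t _ => ?_) _
    exact (measurable_fst.comp (R.measurable_state (t + 1))).mono
      (past_le R.sampling.meas _) le_rfl
  have hFm := (R.asm.measurable_toReal_F R.Cf_pos R.L_pos hxb
    fun ω => (R.avgIterate_mem hT ω).1).sub_const (p.F z).toReal
  have hpos : ∀ ω, 0 ≤ (p.F (avgIterate x T ω)).toReal - (p.F z).toReal := fun ω =>
    sub_nonneg.2 (R.asm.toReal_F_le hz (R.avgIterate_mem hT ω).1)
  -- The gap is non-negative by minimality of `z`, so the pathwise upper bound dominates its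
  -- absolute value.
  have hgap : Integrable (fun ω => (p.F (avgIterate x T ω)).toReal - (p.F z).toReal) Pr := by
    refine (c.div_const T).mono' hFm.aestronglyMeasurable (Filter.Eventually.of_forall fun ω => ?_)
    rw [Real.norm_of_nonneg (hpos ω), le_div_iff₀ hT', mul_comm]
    exact hle ω
  refine ⟨hgap, ?_⟩
  rw [← integral_const_mul]
  refine (integral_mono (hgap.const_mul _) c hle).trans ?_
  rw [integral_add ((c1.fun_add c2).fun_add c3) c4, integral_add (c1.fun_add c2) c3,
    integral_add c1 c2, integral_const_mul (5 * τ / (2 * (S : ℝ))),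
    integral_const_mul ((S : ℝ) / (8 * τ * n ^ 2)),
    integral_finsetSum _ fun i _ => c3' i,
    integral_finsetSum _ fun t _ => (R.integral_residual_le t z).1]
  simp_rw [hbreg]
  rw [integral_const_mul 2]
  have h1 := R.noise_budget T
  have h2 := Finset.sum_le_sum fun t (_ : t ∈ Finset.range T) => (R.integral_residual_le t z).2
  set Q := ((Cf * √Lψ * (Cg / √μψ)) ^ 2
        + (Cf * √Lψ) ^ 2 * (2 * (Cg / √μψ) ^ 2 + 2 * (σ₁ ^ 2 / μψ))) / η
  set s := σ₀ ^ 2 / μψ / B / τ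
  -- The terms in `‖ȳ_t - y_t‖²` cancel exactly; the oracle variance appears once in the residual
  -- and a quarter time in the noise, hence `5/4`.
  have h3 : ∑ t ∈ Finset.range T, ((1 / (n : ℝ)) * ∑ i, (τ / 4 *
          ∫ ω, ‖p.fullDual τ (x t ω, y t ω) (ξ t ω) i - y t ω i‖ ^ 2 ∂Pr + s / 4))
      + ∑ t ∈ Finset.range T, ((1 / (n : ℝ)) * ∑ i, (- (τ / 4 *
          ∫ ω, ‖p.fullDual τ (x t ω, y t ω) (ξ t ω) i - y t ω i‖ ^ 2 ∂Pr) + s) + Q)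
      = T * (5 / 4 * s + Q) := by
    rw [← Finset.sum_add_distrib]
    have : ∀ t ∈ Finset.range T, ((1 / (n : ℝ)) * ∑ i, (τ / 4 *
          ∫ ω, ‖p.fullDual τ (x t ω, y t ω) (ξ t ω) i - y t ω i‖ ^ 2 ∂Pr + s / 4))
        + ((1 / (n : ℝ)) * ∑ i, (- (τ / 4 *
          ∫ ω, ‖p.fullDual τ (x t ω, y t ω) (ξ t ω) i - y t ω i‖ ^ 2 ∂Pr) + s) + Q)
        = 5 / 4 * s + Q := by
      intro t _
      rw [← add_assoc, ← mul_add, ← Finset.sum_add_distrib]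
      have e : ∀ i ∈ (Finset.univ : Finset (Fin n)), (τ / 4 *
          ∫ ω, ‖p.fullDual τ (x t ω, y t ω) (ξ t ω) i - y t ω i‖ ^ 2 ∂Pr + s / 4)
          + (- (τ / 4 *
          ∫ ω, ‖p.fullDual τ (x t ω, y t ω) (ξ t ω) i - y t ω i‖ ^ 2 ∂Pr) + s) = 5 / 4 * s :=
        fun i _ => by ring
      rw [Finset.sum_congr rfl e, Finset.sum_const, Finset.card_univ, Fintype.card_fin,
        nsmul_eq_mul]
      field_simp
    rw [Finset.sum_congr rfl this, Finset.sum_const, Finset.card_range, nsmul_eq_mul]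
  have e1 : ∫ _ : Ω, η / 2 * ‖x₀ - z‖ ^ 2 ∂Pr = η / 2 * ‖x₀ - z‖ ^ 2 := by simp
  have e2 : ∀ I : ℝ, 5 * τ / (2 * S) * (2 * I) = 5 * τ / S * I := fun I => by
    have hS : (0 : ℝ) < S := by have := R.S_pos; positivity
    field_simp
  rw [e1, e2]
  linarith

/-- Both dual points lie in the ball of radius `Cf * √Lψ`, so each block contributes at most `½(2 Cf
√Lψ)²`. -/
theorem bregmanSum_bound (R : Run p Cf Cg σ₀ σ₁ δ μψ Lψ S B η τ x₀ y₀ Pr ξ x y)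
    {xb : Ω → Vec d} {v : Ω → Fin n → Vec m} (hvm : Measurable v)
    (hv : ∀ ω, p.IsDualBest (xb ω) (v ω)) :
    Integrable (fun ω => bregmanSum (fun _ => quad) (v ω) y₀) Pr ∧
    ∫ ω, bregmanSum (fun _ => quad) (v ω) y₀ ∂Pr ≤ 2 * (Cf * √Lψ) ^ 2 * n := by
  have hle : ∀ ω, bregmanSum (fun _ => quad) (v ω) y₀ ≤ 2 * (Cf * √Lψ) ^ 2 * n := by
    intro ω
    rw [bregmanSum_quad]
    have h1 : ∀ i ∈ (Finset.univ : Finset (Fin n)),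
        ‖v ω i - y₀ i‖ ^ 2 ≤ (2 * (Cf * √Lψ)) ^ 2 := by
      intro i _
      have h2 := R.asm.norm_le_of_mem_Y R.Cf_pos R.L_pos (hv ω i).1
      have h3 := R.asm.norm_le_of_mem_Y R.Cf_pos R.L_pos (R.y₀_mem i)
      have h4 := norm_sub_le (v ω i) (y₀ i)
      gcongr
      linarith
    have h5 := Finset.sum_le_sum h1
    rw [Finset.sum_const, Finset.card_univ, Fintype.card_fin, nsmul_eq_mul] at h5
    linarith
  have hpos : ∀ ω, 0 ≤ bregmanSum (fun _ => quad) (v ω) y₀ := by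
    intro ω; rw [bregmanSum_quad]; positivity
  have hm : Measurable fun ω => bregmanSum (fun _ => quad) (v ω) y₀ := by
    simp only [bregmanSum_quad]
    refine Measurable.const_mul (Finset.measurable_fun_sum _ fun i _ => ?_) _
    exact ((((measurable_pi_apply i).comp hvm).sub_const _).norm).pow_const 2
  have hint : Integrable (fun ω => bregmanSum (fun _ => quad) (v ω) y₀) Pr :=
    Integrable.of_bound hm.aestronglyMeasurable (2 * (Cf * √Lψ) ^ 2 * n)
      (Filter.Eventually.of_forall fun ω => by rw [Real.norm_of_nonneg (hpos ω)]; exact hle ω)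
  refine ⟨hint, ?_⟩
  simpa using integral_mono hint (integrable_const _) hle

end Run

end Problem

end FCCO

/-! ### Choice of the constants and conclusion -/

open FCCO
theorem theorem2 (Cf Cg σ₀ σ₁ δ μψ Lψ D : ℝ)
    (hCf : 0 < Cf) (hCg : 0 < Cg) (hμψ : 0 < μψ) (hLψ : 0 < Lψ) :
    ∃ cη cτ K : ℝ, 0 < cη ∧ 0 < cτ ∧ 0 < K ∧
      ∀ (d m n : ℕ) (Z : Type*) [MeasurableSpace Z] (p : Problem d m n Z),
        p.Assumptions Cf Cg σ₀ σ₁ δ μψ Lψ →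
      ∀ (S B : ℕ), 1 ≤ S → S ≤ n → 1 ≤ B →
      ∀ x₀ ∈ p.X, ∀ y₀ : Fin n → Vec m, (∀ i, y₀ i ∈ p.Y i) →
      ∀ xstar : Vec d, IsArgmin p.F p.X xstar → ‖x₀ - xstar‖ ≤ D →
      ∀ (Ω : Type*) [MeasurableSpace Ω] (Pr : Measure Ω) [IsProbabilityMeasure Pr]
        (ξ : ℕ → Ω → Problem.Draw n B Z), p.IsSampling S B Pr ξ →
      ∀ ε : ℝ, 0 < ε →
      ∀ (x : ℕ → Ω → Vec d) (y : ℕ → Ω → Fin n → Vec m),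
        p.IsALEXR S B (fun _ => quad) 0 (cη / ε) (cτ / (B * ε)) x₀ y₀ ξ x y →
      ∀ T : ℕ, 1 ≤ T →
      ∀ yt : Ω → Fin n → Vec m, Measurable yt →
        (∀ ω, p.IsDualBest (avgIterate x T ω) (yt ω)) →
      ∀ Ω₀ : ℝ, Ω₀ = ∫ ω, bregmanSum (fun _ => quad) (yt ω) y₀ ∂Pr →
        Integrable (fun ω => bregmanSum (fun _ => quad) (yt ω) y₀) Pr ∧
        Ω₀ ≤ K * n ∧
        (K * max 1 (Ω₀ / (B * S)) / ε ^ 2 ≤ T →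
          (∀ ω, p.F (avgIterate x T ω) ≠ ⊤) ∧
          Integrable (fun ω => (p.F (avgIterate x T ω)).toReal - (p.F xstar).toReal) Pr ∧
          ∫ ω, ((p.F (avgIterate x T ω)).toReal - (p.F xstar).toReal) ∂Pr ≤ ε) := by
  set Q := (Cf * √Lψ * (Cg / √μψ)) ^ 2
    + (Cf * √Lψ) ^ 2 * (2 * (Cg / √μψ) ^ 2 + 2 * (σ₁ ^ 2 / μψ)) with hQ
  set s := σ₀ ^ 2 / μψ with hs
  have hQ0 : 0 ≤ Q := by positivity
  have hs0 : 0 ≤ s := by positivity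
  -- `4Q` and `5s` bring `Q/η` and `5s/(4Bτ)` below `ε/4`. In `K`, `2cηD²` handles the initial
  -- primal distance, `20cτ` the dual divergence, and `2(Cf√Lψ)²` the bound on `Ω₀`; the ones give
  -- positivity.
  refine ⟨4 * Q + 1, 5 * s + 1,
    2 * (4 * Q + 1) * D ^ 2 + 20 * (5 * s + 1) + 2 * (Cf * √Lψ) ^ 2 + 1,
    by positivity, by positivity, by positivity, ?_⟩
  set cη := 4 * Q + 1 with hcη
  set cτ := 5 * s + 1 with hcτ
  set K := 2 * cη * D ^ 2 + 20 * cτ + 2 * (Cf * √Lψ) ^ 2 + 1 with hK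
  have hcη0 : 0 < cη := by positivity
  have hcτ0 : 0 < cτ := by positivity
  have hK0 : 0 < K := by positivity
  intro d m n Z _ p h S B hS hSn hB x₀ hx₀ y₀ hy₀ xstar hxs hD Ω _ Pr _ ξ hξ ε hε x y hal T hT
    yt hytm hyt Ω₀ hΩ₀
  have hB' : (0 : ℝ) < B := by positivity
  have hS' : (0 : ℝ) < S := by positivity
  have hT' : (0 : ℝ) < T := by positivity
  have R : p.Run Cf Cg σ₀ σ₁ δ μψ Lψ S B (cη / ε) (cτ / (B * ε)) x₀ y₀ Pr ξ x y :=
    ⟨h, hCf, hμψ, hLψ, hS, hSn, hB, by positivity, by positivity, hx₀, hy₀, hξ, hal⟩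
  obtain ⟨hint, hbound⟩ := R.bregmanSum_bound hytm hyt
  refine ⟨hint, ?_, fun hTK => ?_⟩
  · rw [hΩ₀]
    refine hbound.trans (mul_le_mul_of_nonneg_right ?_ (Nat.cast_nonneg n))
    have : 0 ≤ 2 * cη * D ^ 2 + 20 * cτ + 1 := by positivity
    linarith
  · obtain ⟨hgi, hgap⟩ := R.expected_gap_le hT hxs hyt hint
    refine ⟨fun ω => ?_, hgi, ?_⟩
    · rw [h.F_eq_coe (R.avgIterate_mem hT ω).1]
      exact EReal.coe_ne_top _
    · rw [← hΩ₀, ← hQ, ← hs] at hgap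
      set M := max 1 (Ω₀ / (B * S)) with hM
      rw [div_le_iff₀ (by positivity)] at hTK
      have hM1 : 1 ≤ M := le_max_left _ _
      have hM2 : Ω₀ / (B * S) ≤ M := le_max_right _ _
      have hD2 : ‖x₀ - xstar‖ ^ 2 ≤ D ^ 2 := by gcongr
      set I := ∫ ω, ((p.F (avgIterate x T ω)).toReal - (p.F xstar).toReal) ∂Pr
      have t1 : cη / ε / 2 * ‖x₀ - xstar‖ ^ 2 ≤ T * (ε / 4) := by
        have a1 : 2 * cη * D ^ 2 ≤ T * ε ^ 2 := by
          have : 2 * cη * D ^ 2 * 1 ≤ K * M := by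
            apply mul_le_mul _ hM1 zero_le_one hK0.le
            have : 0 ≤ 20 * cτ + 2 * (Cf * √Lψ) ^ 2 + 1 := by positivity
            linarith
          linarith
        calc cη / ε / 2 * ‖x₀ - xstar‖ ^ 2 ≤ cη / ε / 2 * D ^ 2 := by gcongr
          _ = 2 * cη * D ^ 2 / (4 * ε) := by field_simp; ring
          _ ≤ T * ε ^ 2 / (4 * ε) := by gcongr
          _ = T * (ε / 4) := by field_simp
      have t2 : 5 * (cτ / (B * ε)) / S * Ω₀ ≤ T * (ε / 4) := by
        have a1 : 20 * cτ * (Ω₀ / (B * S)) ≤ T * ε ^ 2 := by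
          have a2 : 20 * cτ * (Ω₀ / (B * S)) ≤ 20 * cτ * M := by gcongr
          have a3 : 20 * cτ * M ≤ K * M := by
            apply mul_le_mul_of_nonneg_right _ (by linarith)
            have : 0 ≤ 2 * cη * D ^ 2 + 2 * (Cf * √Lψ) ^ 2 + 1 := by positivity
            linarith
          linarith
        calc 5 * (cτ / (B * ε)) / S * Ω₀ = 20 * cτ * (Ω₀ / (B * S)) / (4 * ε) := by
              field_simp; ring
          _ ≤ T * ε ^ 2 / (4 * ε) := by gcongr
          _ = T * (ε / 4) := by field_simp
      -- The factor `1/B` in `τ` cancels against the `1/B` of the batch variance, which leaves the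
      -- batch size as a gain in the dual divergence term alone.
      have t3 : 5 / 4 * (s / B / (cτ / (B * ε))) ≤ ε / 4 := by
        have e : 5 / 4 * (s / B / (cτ / (B * ε))) = 5 * s / cτ * (ε / 4) := by field_simp
        rw [e]
        exact mul_le_of_le_one_left (by positivity) ((div_le_one hcτ0).2 (by linarith))
      have t4 : Q / (cη / ε) ≤ ε / 4 := by
        have e : Q / (cη / ε) = 4 * Q / cη * (ε / 4) := by field_simp
        rw [e]
        exact mul_le_of_le_one_left (by positivity) ((div_le_one hcη0).2 (by linarith))
      have t5 : T * (5 / 4 * (s / B / (cτ / (B * ε))) + Q / (cη / ε)) ≤ T * (ε / 4 + ε / 4) := by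
        gcongr
      have : T * I ≤ T * ε := by linarith
      exact le_of_mul_le_mul_left this hT'
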